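/- **Setting.** Let $a:\mathbb R^d\to[0,\infty)$ be a measurable, even, bounded, integrable function with $\int_{\mathbb R^d}|z|^3a(z)\,dz<\infty$ and $a(z)\ge c$ for $|z|\le r_0$, for some $c,r_0>0$. Let $G,Y\subset\mathbb T^d=\mathbb R^d/\mathbb Z^d$ be disjoint non-empty open sets with Lipschitz boundaries such that $\mathbb T^d=\overline G\cup Y$, and suppose that the periodic extension $Y^\sharp\subset\mathbb R^d$ of $Y$ is unbounded and $a$-connected: any two points of $Y^\sharp$ are joined by a finite sequence $x^1,\dots,x^M$ in $Y^\sharp$ such that each difference $x^j-x^{j+1}$ lies in the essential support of $a$ (every neighbourhood of it meets $\{a>0\}$ in a set of positive measure). Let $w:\mathbb T^d\times\mathbb T^d\to\mathbb R$ be measurable with $w(\xi,\eta)=w(\eta,\xi)$ and $0<\alpha_1\le w\le\alpha_2<\infty$. Put $$v(\xi,\eta)=w(\xi,\eta)\bigl(1-\mathbf 1_Y(\xi)\mathbf 1_Y(\eta)\bigr),\qquad \tilde a(\xi)=\sum_{n\in\mathbb Z^d}a(\xi+n),$$ $$\tilde b(\xi)=\frac1{|Y|}\int_Y\tilde a(\eta-\xi)v(\eta,\xi)\,d\eta,\qquad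 \tilde c(\xi)=\int_Y\tilde a(\xi-\eta)v(\xi,\eta)\,d\eta .$$ *Effective matrix.* There is a periodic vector field $\varphi$, square integrable on $Y$, with $$\int_Y\tilde a(\xi-\eta)\bigl(\varphi(\eta)-\varphi(\xi)\bigr)d\eta=-\int_{Y^\sharp}a(\xi-\eta)(\eta-\xi)\,d\eta\quad\text{for a.e. }\xi\in Y;$$ with any such $\varphi$ define the matrix $\Theta$ by $$|Y|\,\Theta_{ij}=\int_{Y^\sharp}\int_Y a(\xi-\eta)\Bigl[\tfrac12(\xi-\eta)_i(\xi-\eta)_j-(\xi-\eta)_i\varphi_j(\eta)\Bigr]d\eta\,d\xi .$$ *Operators.* In $L^2(E)=L^2(\mathbb R^d)\oplus L^2(\mathbb R^d\times G)$ (complex-valued functions) let $L$ be the operator with domain $H^2(\mathbb R^d)\oplus L^2(\mathbb R^d\times G)$, $$L\begin{pmatrix}f_0\\ g\end{pmatrix}(x,\xi)=\begin{pmatrix}\sum_{i,j}\Theta_{ij}\partial_i\partial_jf_0(x)+\int_G\tilde b(\xi)\bigl(g(x,\xi)-f_0(x)\bigr)d\xi\\[1mm] \int_G\tilde a(\xi-\xi')v(\xi,\xi')\bigl(g(x,\xi')-g(x,\xi)\bigr)d\xi'+\tilde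 c(\xi)\bigl(f_0(x)-g(x,\xi)\bigr)\end{pmatrix}.$$ In $L^2(G)$ let $\Phi$ be multiplication by $\Phi(\xi)=\int_{\mathbb T^d}\tilde a(\xi-\xi')v(\xi,\xi')\,d\xi'$ and let $(Kg)(\xi)=\int_G\tilde a(\xi-\xi')v(\xi,\xi')g(\xi')\,d\xi'$. Let $\gamma_1=\alpha_1\|a\|_{L^1}$, $\gamma_2=\alpha_2\|a\|_{L^1}$, and let $\operatorname{Ran}\Phi$ be the essential range of $\Phi$ on $G$. *Spectra.* For a closed operator $A$, $\sigma(A)$ is the spectrum; $\sigma_{ess}(A)$ (the "continuous part" of the spectrum in the sense of Weyl) is the set of $\lambda$ for which there are $u_n\in D(A)$ with $\|u_n\|=1$, $u_n\rightharpoonup0$ weakly and $(A-\lambda)u_n\to0$; and $\sigma_c(A)$ is the set of $\lambda\in\sigma(A)$ that are not eigenvalues and for which $A-\lambda$ has dense range. **Theorem.** As subsets of $\mathbb C$, $\sigma(-L)=\sigma_1\cup\sigma_2$, where $$\sigma_1=\sigma(\Phi-K),\qquad \sigma_2=\bigl\{\lambda\ge0:\ \lambda\notin\sigma(\Phi-K),\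 1+\bigl(\tilde b,(\Phi-K-\lambda)^{-1}\mathbf 1\bigr)_{L^2(G)}\ge0\bigr\}.$$ Moreover there are $\lambda_1,\lambda_2$ with $0<\lambda_1<\gamma_1\le\gamma_2<\lambda_2$ such that $$[0,\lambda_1]\cup\operatorname{Ran}\Phi\cup[\lambda_2,\infty)\subset\sigma_{ess}(-L),$$ and every point of $[0,\lambda_1]\cup\operatorname{Ran}\Phi\cup[\lambda_2,\infty)$ lies in $\sigma_c(-L)$, except for points of $\operatorname{Ran}\Phi$ that are eigenvalues of $-L$; in particular $[0,\lambda_1]\cup[\lambda_2,\infty)\subset\sigma_c(-L)$. -/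

import Mathlib

open MeasureTheory Filter Topology
open scoped ENNReal LineDeriv SchwartzMap

noncomputable section

/-! ## Spectra of unbounded operators -/

section UnboundedOperators

variable {H : Type*} [NormedAddCommGroup H] [InnerProductSpace ℂ H]

/-- `R` is the resolvent `(T - z)⁻¹`: an everywhere defined bounded two-sided inverse of `T - z`. -/
def IsResolventAt (T : H →ₗ.[ℂ] H) (z : ℂ) (R : H →L[ℂ] H) : Prop :=
  (∀ u : H, ∃ h : R u ∈ T.domain, T ⟨R u, h⟩ - z • R u = u) ∧
    ∀ x : T.domain, R (T x - z • (x : H)) = x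

/-- The spectrum of an unbounded operator: the complement of its resolvent set. -/
def opSpectrum (T : H →ₗ.[ℂ] H) : Set ℂ :=
  {z | ¬ ∃ R : H →L[ℂ] H, IsResolventAt T z R}

/-- `z` is an eigenvalue of `T`. -/
def IsEigenvalue (T : H →ₗ.[ℂ] H) (z : ℂ) : Prop :=
  ∃ x : T.domain, (x : H) ≠ 0 ∧ T x = z • (x : H)

/-- The continuous spectrum in the strict sense: spectral points `z` for which `T - z` is injective
with dense range. -/
def contSpectrum (T : H →ₗ.[ℂ] H) : Set ℂ :=
  {z | z ∈ opSpectrum T ∧ ¬ IsEigenvalue T z ∧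
    Dense (Set.range fun x : T.domain => T x - z • (x : H))}

/-- The essential spectrum, by Weyl's criterion: there is a normalised, weakly null sequence
`u n` in the domain with `(T - z) (u n) → 0`. -/
def essSpectrum (T : H →ₗ.[ℂ] H) : Set ℂ :=
  {z | ∃ u : ℕ → T.domain, (∀ n, ‖(u n : H)‖ = 1) ∧
    (∀ v : H, Tendsto (fun n => inner ℂ v (u n : H)) atTop (𝓝 0)) ∧
    Tendsto (fun n => T (u n) - z • (u n : H)) atTop (𝓝 0)}

end UnboundedOperators

/-! ## Periodic geometry -/

/-- The lattice vector with integer coordinates `n`. -/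
def latticeVec {d : ℕ} (n : Fin d → ℤ) : EuclideanSpace ℝ (Fin d) :=
  WithLp.toLp 2 fun i => (n i : ℝ)

/-- The periodicity cell `[0, 1)^d`. -/
def unitCell (d : ℕ) : Set (EuclideanSpace ℝ (Fin d)) :=
  {x | ∀ i, x i ∈ Set.Ico (0 : ℝ) 1}

/-- `U` has a Lipschitz boundary: near each boundary point, `U` is the part above the graph of a
Lipschitz function, in the direction of some unit vector `e`. -/
def HasLipschitzBoundary {d : ℕ} (U : Set (EuclideanSpace ℝ (Fin d))) : Prop :=
  ∀ x ∈ frontier U, ∃ (e : EuclideanSpace ℝ (Fin d)) (γ : EuclideanSpace ℝ (Fin d) → ℝ)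
    (C : NNReal) (r : ℝ), ‖e‖ = 1 ∧ LipschitzWith C γ ∧ 0 < r ∧
      ∀ y ∈ Metric.ball x r, y ∈ U ↔ γ (y - inner ℝ e y • e) < inner ℝ e y

/-- The essential support of `{a > 0}`: points each neighbourhood of which meets `{a > 0}` in a set
of positive measure. -/
def essPosSet {d : ℕ} (a : EuclideanSpace ℝ (Fin d) → ℝ) : Set (EuclideanSpace ℝ (Fin d)) :=
  {z | ∀ U ∈ 𝓝 z, 0 < volume {y ∈ U | 0 < a y}}

/-- The coefficients and the geometry. Subsets of the torus and functions on it are represented by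
periodic subsets of `ℝ^d` and periodic functions on `ℝ^d`; `G` and `Y` are the periodic sets. -/
structure HighContrastModel (d : ℕ) where
  /-- the convolution kernel -/
  a : EuclideanSpace ℝ (Fin d) → ℝ
  /-- the slow phase (periodic) -/
  G : Set (EuclideanSpace ℝ (Fin d))
  /-- the fast phase (periodic) -/
  Y : Set (EuclideanSpace ℝ (Fin d))
  /-- the modulation of the jump rates -/
  w : EuclideanSpace ℝ (Fin d) → EuclideanSpace ℝ (Fin d) → ℝ
  /-- the lower bound of `w` -/
  α₁ : ℝ
  /-- the upper bound of `w` -/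
  α₂ : ℝ
  a_measurable : Measurable a
  a_nonneg : ∀ z, 0 ≤ a z
  a_even : ∀ z, a (-z) = a z
  a_integrable : Integrable a
  a_bounded : ∃ B, ∀ z, a z ≤ B
  a_moment : Integrable fun z => ‖z‖ ^ 3 * a z
  a_lower : ∃ r₀ > 0, ∃ c > 0, ∀ z, ‖z‖ ≤ r₀ → c ≤ a z
  G_open : IsOpen G
  Y_open : IsOpen Y
  G_periodic : ∀ (n : Fin d → ℤ) x, x + latticeVec n ∈ G ↔ x ∈ G
  Y_periodic : ∀ (n : Fin d → ℤ) x, x + latticeVec n ∈ Y ↔ x ∈ Y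
  G_nonempty : G.Nonempty
  Y_nonempty : Y.Nonempty
  G_disjoint_Y : Disjoint G Y
  cover : closure G ∪ Y = Set.univ
  G_lipschitz : HasLipschitzBoundary G
  Y_lipschitz : HasLipschitzBoundary Y
  Y_unbounded : ¬ Bornology.IsBounded Y
  Y_connected : ∀ x ∈ Y, ∀ y ∈ Y,
    Relation.ReflTransGen (fun p q => q ∈ Y ∧ p - q ∈ essPosSet a) x y
  w_measurable : Measurable (Function.uncurry w)
  w_periodic : ∀ (m n : Fin d → ℤ) ξ η, w (ξ + latticeVec m) (η + latticeVec n) = w ξ η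
  w_symm : ∀ ξ η, w ξ η = w η ξ
  α₁_pos : 0 < α₁
  w_lower : ∀ ξ η, α₁ ≤ w ξ η
  w_upper : ∀ ξ η, w ξ η ≤ α₂

namespace HighContrastModel

variable {d : ℕ} (M : HighContrastModel d)

/-- `v(ξ, η) = w(ξ, η) (1 - 1_Y(ξ) 1_Y(η))`. -/
def v (ξ η : EuclideanSpace ℝ (Fin d)) : ℝ :=
  M.w ξ η * (1 - M.Y.indicator (fun _ => 1) ξ * M.Y.indicator (fun _ => 1) η)

/-- The periodisation `ã` of `a`. -/
def aTilde (ξ : EuclideanSpace ℝ (Fin d)) : ℝ :=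
  ∑' n : Fin d → ℤ, M.a (ξ + latticeVec n)

/-- `G` inside one periodicity cell. -/
def Gcell : Set (EuclideanSpace ℝ (Fin d)) := M.G ∩ unitCell d

/-- `Y` inside one periodicity cell. -/
def Ycell : Set (EuclideanSpace ℝ (Fin d)) := M.Y ∩ unitCell d

/-- Lebesgue measure on `G` (one cell). -/
def μG : Measure (EuclideanSpace ℝ (Fin d)) := volume.restrict M.Gcell

/-- `K(ξ, ξ') = ã(ξ - ξ') v(ξ, ξ')`. -/
def kernel (ξ ξ' : EuclideanSpace ℝ (Fin d)) : ℝ := M.aTilde (ξ - ξ') * M.v ξ ξ'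

/-- The total jump rate `Φ`. -/
def Phi (ξ : EuclideanSpace ℝ (Fin d)) : ℝ := ∫ ξ' in unitCell d, M.kernel ξ ξ'

/-- `b̃(ξ) = |Y|⁻¹ ∫_Y ã(η - ξ) v(η, ξ) dη`. -/
def bTilde (ξ : EuclideanSpace ℝ (Fin d)) : ℝ :=
  (volume.real M.Ycell)⁻¹ * ∫ η in M.Ycell, M.kernel η ξ

/-- `c̃(ξ) = ∫_Y ã(ξ - η) v(ξ, η) dη`. -/
def cTilde (ξ : EuclideanSpace ℝ (Fin d)) : ℝ := ∫ η in M.Ycell, M.kernel ξ η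

/-- `γ₁ = α₁ ‖a‖_{L¹}`. -/
def γ₁ : ℝ := M.α₁ * ∫ z, M.a z

/-- `γ₂ = α₂ ‖a‖_{L¹}`. -/
def γ₂ : ℝ := M.α₂ * ∫ z, M.a z

/-- The essential range over `G` of the function `Φ`. -/
def ranPhi : Set ℝ := {r | ∀ ε > 0, 0 < M.μG {ξ | |M.Phi ξ - r| < ε}}

/-! ### The effective matrix -/

/-- `φ` is a corrector: a periodic vector field, square integrable on `Y` (one cell), with
`∫_Y ã(ξ - η) (φ(η) - φ(ξ)) dη = - ∫_{Y^♯} a(ξ - η) (η - ξ) dη` for a.e. `ξ ∈ Y`. -/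
def IsCorrector (φ : EuclideanSpace ℝ (Fin d) → EuclideanSpace ℝ (Fin d)) : Prop :=
  (∀ (n : Fin d → ℤ) ξ, φ (ξ + latticeVec n) = φ ξ) ∧
  MemLp φ 2 (volume.restrict M.Ycell) ∧
  ∀ᵐ ξ ∂(volume.restrict M.Ycell),
    ∫ η in M.Ycell, M.aTilde (ξ - η) • (φ η - φ ξ) = -∫ η in M.Y, M.a (ξ - η) • (η - ξ)

/-- The effective matrix `Θ` computed from a corrector `φ`. -/
def effMatrix (φ : EuclideanSpace ℝ (Fin d) → EuclideanSpace ℝ (Fin d)) :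
    Matrix (Fin d) (Fin d) ℝ := fun i j =>
  (volume.real M.Ycell)⁻¹ * ∫ ξ in M.Y, ∫ η in M.Ycell,
    M.a (ξ - η) * (2⁻¹ * ((ξ - η) i * (ξ - η) j) - (ξ - η) i * φ η j)

/-! ### The operator `Φ - K` on `L²(G)` -/

/-- `L²(G)`. -/
abbrev L2G := Lp ℂ 2 M.μG

/-- The graph of `Φ - K`. -/
def phiSubKGraph : Submodule ℂ (M.L2G × M.L2G) where
  carrier := {p | (∀ᵐ ξ ∂M.μG, Integrable (fun ξ' => (M.kernel ξ ξ' : ℂ) * p.1 ξ') M.μG) ∧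
    ∀ᵐ ξ ∂M.μG, p.2 ξ = (M.Phi ξ : ℂ) * p.1 ξ - ∫ ξ', (M.kernel ξ ξ' : ℂ) * p.1 ξ' ∂M.μG}
  add_mem' := by
    rintro ⟨g, h⟩ ⟨g', h'⟩ ⟨hi, he⟩ ⟨hi', he'⟩
    have hg := Lp.coeFn_add g g'
    have key : ∀ ξ, (fun ξ' => (M.kernel ξ ξ' : ℂ) * (g + g') ξ') =ᵐ[M.μG]
        fun ξ' => (M.kernel ξ ξ' : ℂ) * g ξ' + (M.kernel ξ ξ' : ℂ) * g' ξ' := fun ξ => by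
      filter_upwards [hg] with ξ' h1
      rw [h1, Pi.add_apply, mul_add]
    refine ⟨?_, ?_⟩
    · filter_upwards [hi, hi'] with ξ h1 h2
      exact (h1.add h2).congr (key ξ).symm
    · filter_upwards [hi, hi', he, he', hg, Lp.coeFn_add h h'] with ξ h1 h2 h3 h4 h5 h6
      simp only [Prod.fst_add, Prod.snd_add] at *
      rw [integral_congr_ae (key ξ), integral_add h1 h2, h5, h6, Pi.add_apply, Pi.add_apply, h3, h4]
      ring
  zero_mem' := by
    have hg := Lp.coeFn_zero ℂ 2 M.μG
    have key : ∀ ξ, (fun ξ' => (M.kernel ξ ξ' : ℂ) * (0 : M.L2G) ξ') =ᵐ[M.μG]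
        fun _ => 0 := fun ξ => by
      filter_upwards [hg] with ξ' h1
      rw [h1, Pi.zero_apply, mul_zero]
    refine ⟨?_, ?_⟩
    · filter_upwards with ξ
      exact (integrable_zero _ _ _).congr (key ξ).symm
    · filter_upwards [hg] with ξ h1
      simp only [Prod.fst_zero, Prod.snd_zero] at *
      rw [integral_congr_ae (key ξ), h1]
      simp
  smul_mem' := by
    rintro c ⟨g, h⟩ ⟨hi, he⟩
    have hg := Lp.coeFn_smul c g
    have key : ∀ ξ, (fun ξ' => (M.kernel ξ ξ' : ℂ) * (c • g) ξ') =ᵐ[M.μG]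
        fun ξ' => c * ((M.kernel ξ ξ' : ℂ) * g ξ') := fun ξ => by
      filter_upwards [hg] with ξ' h1
      rw [h1, Pi.smul_apply, smul_eq_mul, mul_left_comm]
    refine ⟨?_, ?_⟩
    · filter_upwards [hi] with ξ h1
      exact (h1.const_mul c).congr (key ξ).symm
    · filter_upwards [he, hg, Lp.coeFn_smul c h] with ξ h3 h5 h6
      simp only [Prod.smul_fst, Prod.smul_snd] at *
      rw [integral_congr_ae (key ξ), integral_const_mul, h5, h6, Pi.smul_apply, Pi.smul_apply, h3]
      simp only [smul_eq_mul]
      ring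

/-- `phiSubKGraph` is single-valued. -/
theorem phiSubKGraph_single (p : M.L2G × M.L2G) (hp : p ∈ M.phiSubKGraph) (h0 : p.1 = 0) :
    p.2 = 0 := by
  obtain ⟨g, h⟩ := p
  obtain ⟨hi, he⟩ := hp
  simp only at h0 he
  subst h0
  have hg := Lp.coeFn_zero ℂ 2 M.μG
  apply Lp.ext
  filter_upwards [he, hg] with ξ h1 h2
  have key : (fun ξ' => (M.kernel ξ ξ' : ℂ) * (0 : M.L2G) ξ') =ᵐ[M.μG] fun _ => 0 := by
    filter_upwards [hg] with ξ' h1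
    rw [h1, Pi.zero_apply, mul_zero]
  rw [h1, integral_congr_ae key, h2]
  simp

/-- The operator `Φ - K` on `L²(G)`. -/
def phiSubK : M.L2G →ₗ.[ℂ] M.L2G := M.phiSubKGraph.toLinearPMap

theorem phiSubK_graph : M.phiSubK.graph = M.phiSubKGraph :=
  Submodule.toLinearPMap_graph_eq _ M.phiSubKGraph_single

instance : IsFiniteMeasure M.μG := by
  refine isFiniteMeasure_restrict.mpr (ne_of_lt ?_)
  refine (measure_mono (t := Metric.closedBall 0 (Real.sqrt d)) ?_).trans_lt
    measure_closedBall_lt_top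
  rintro x ⟨-, hx⟩
  rw [mem_closedBall_zero_iff, EuclideanSpace.norm_eq]
  apply Real.sqrt_le_sqrt
  calc ∑ i, ‖x i‖ ^ 2 ≤ ∑ _i : Fin d, (1 : ℝ) := by
        refine Finset.sum_le_sum fun i _ => ?_
        rw [Real.norm_eq_abs, sq_abs]
        have h := hx i
        nlinarith [h.1, h.2]
    _ = d := by simp

/-- `σ₁ = σ(Φ - K)`. -/
def sigma₁ : Set ℂ := opSpectrum M.phiSubK

/-- `σ₂ = {λ ≥ 0 : 1 + (b̃, (Φ - K - λ)⁻¹ 1) ≥ 0}`, `λ` outside the spectrum of `Φ - K`. -/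
def sigma₂ : Set ℂ :=
  {z | ∃ t : ℝ, 0 ≤ t ∧ z = t ∧ ∃ R : M.L2G →L[ℂ] M.L2G, IsResolventAt M.phiSubK z R ∧
    0 ≤ (1 + ∫ ξ, (M.bTilde ξ : ℂ) * R (Lp.const 2 M.μG 1) ξ ∂M.μG).re}

/-! ### The generator `L` on `L²(E)` -/

/-- `L²(E) = L²(ℝ^d) ⊕ L²(ℝ^d × G)`, elements `F = (f₀, g)`. -/
abbrev L2E := WithLp 2 (Lp ℂ 2 (volume : Measure (EuclideanSpace ℝ (Fin d))) ×
  Lp ℂ 2 ((volume : Measure (EuclideanSpace ℝ (Fin d))).prod M.μG))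

/-- `Θ · ∇∇ f` in the sense of distributions. -/
def ellipticPart (Θ : Matrix (Fin d) (Fin d) ℝ) (f : 𝓢'(EuclideanSpace ℝ (Fin d), ℂ)) :
    𝓢'(EuclideanSpace ℝ (Fin d), ℂ) :=
  ∑ i, ∑ j, (Θ i j : ℂ) •
    ∂_{(EuclideanSpace.single i (1 : ℝ))} (∂_{(EuclideanSpace.single j (1 : ℝ))} f)

theorem ellipticPart_add (Θ : Matrix (Fin d) (Fin d) ℝ)
    (f g : 𝓢'(EuclideanSpace ℝ (Fin d), ℂ)) :
    ellipticPart Θ (f + g) = ellipticPart Θ f + ellipticPart Θ g := by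
  simp only [ellipticPart, LineDeriv.lineDerivOp_add, smul_add, Finset.sum_add_distrib]

theorem ellipticPart_smul (Θ : Matrix (Fin d) (Fin d) ℝ) (c : ℂ)
    (f : 𝓢'(EuclideanSpace ℝ (Fin d), ℂ)) : ellipticPart Θ (c • f) = c • ellipticPart Θ f := by
  simp only [ellipticPart, LineDeriv.lineDerivOp_smul, Finset.smul_sum]
  simp only [smul_comm c]

theorem ellipticPart_zero (Θ : Matrix (Fin d) (Fin d) ℝ) :
    ellipticPart Θ (0 : 𝓢'(EuclideanSpace ℝ (Fin d), ℂ)) = 0 := by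
  have h := ellipticPart_add Θ 0 (0 : 𝓢'(EuclideanSpace ℝ (Fin d), ℂ))
  rw [add_zero] at h
  exact left_eq_add.mp h

/-- The graph of `L`: pairs `(F, h)` with `F = (f₀, g)`, `f₀ ∈ H²(ℝ^d)` and
`h₀ = Θ · ∇∇ f₀ + ∫_G b̃(ξ) (g(·, ξ) - f₀) dξ`,
`h₁ = ∫_G ã(ξ - ξ') v(ξ, ξ') (g(x, ξ') - g(x, ξ)) dξ' + c̃(ξ) (f₀(x) - g(x, ξ))`. -/
def generatorGraph (Θ : Matrix (Fin d) (Fin d) ℝ) : Submodule ℂ (M.L2E × M.L2E) where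
  carrier := {p |
    TemperedDistribution.MemSobolev 2 2 (p.1.fst : 𝓢'(EuclideanSpace ℝ (Fin d), ℂ)) ∧
    (∀ᵐ x, Integrable (fun ξ => (M.bTilde ξ : ℂ) * (p.1.snd (x, ξ) - p.1.fst x)) M.μG) ∧
    (∀ᵐ q ∂(volume.prod M.μG), Integrable
      (fun ξ' => (M.kernel q.2 ξ' : ℂ) * (p.1.snd (q.1, ξ') - p.1.snd q)) M.μG) ∧
    (∃ u : Lp ℂ 2 (volume : Measure (EuclideanSpace ℝ (Fin d))),
      (u : 𝓢'(EuclideanSpace ℝ (Fin d), ℂ)) = ellipticPart Θ p.1.fst ∧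
      ∀ᵐ x, p.2.fst x =
        u x + ∫ ξ, (M.bTilde ξ : ℂ) * (p.1.snd (x, ξ) - p.1.fst x) ∂M.μG) ∧
    ∀ᵐ q ∂(volume.prod M.μG), p.2.snd q =
      ∫ ξ', (M.kernel q.2 ξ' : ℂ) * (p.1.snd (q.1, ξ') - p.1.snd q) ∂M.μG
        + (M.cTilde q.2 : ℂ) * (p.1.fst q.1 - p.1.snd q)}
  add_mem' := by
    rintro ⟨F, h⟩ ⟨F', h'⟩ ⟨hs, hi, hj, ⟨u, hu, he⟩, hk⟩ ⟨hs', hi', hj', ⟨u', hu', he'⟩, hk'⟩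
    have hF : ∀ᵐ x, (F + F').fst x = F.fst x + F'.fst x := Lp.coeFn_add F.fst F'.fst
    have hG : ∀ᵐ q ∂(volume.prod M.μG), (F + F').snd q = F.snd q + F'.snd q :=
      Lp.coeFn_add F.snd F'.snd
    have hGx := Measure.ae_ae_of_ae_prod hG
    have hFq := (Measure.quasiMeasurePreserving_fst (μ := volume) (ν := M.μG)).ae hF
    have hGq := (Measure.quasiMeasurePreserving_fst (μ := volume) (ν := M.μG)).ae hGx
    have hcoe : ((F + F').fst : 𝓢'(EuclideanSpace ℝ (Fin d), ℂ)) = F.fst + F'.fst := by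
      simp only [← Lp.toTemperedDistributionCLM_apply, WithLp.add_fst, map_add]
    have k1 : ∀ᵐ x, (fun ξ => (M.bTilde ξ : ℂ) * ((F + F').snd (x, ξ) - (F + F').fst x)) =ᵐ[M.μG]
        fun ξ => (M.bTilde ξ : ℂ) * (F.snd (x, ξ) - F.fst x)
          + (M.bTilde ξ : ℂ) * (F'.snd (x, ξ) - F'.fst x) := by
      filter_upwards [hF, hGx] with x h1 h2
      filter_upwards [h2] with ξ h3
      rw [h1, h3]
      ring
    have k2 : ∀ᵐ q ∂(volume.prod M.μG),
        (fun ξ' => (M.kernel q.2 ξ' : ℂ) * ((F + F').snd (q.1, ξ') - (F + F').snd q)) =ᵐ[M.μG]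
        fun ξ' => (M.kernel q.2 ξ' : ℂ) * (F.snd (q.1, ξ') - F.snd q)
          + (M.kernel q.2 ξ' : ℂ) * (F'.snd (q.1, ξ') - F'.snd q) := by
      filter_upwards [hG, hGq] with q h1 h2
      filter_upwards [h2] with ξ h3
      rw [h1, h3]
      ring
    refine ⟨?_, ?_, ?_, ⟨u + u', ?_, ?_⟩, ?_⟩
    · change TemperedDistribution.MemSobolev 2 2
        ((F + F').fst : 𝓢'(EuclideanSpace ℝ (Fin d), ℂ))
      rw [hcoe]
      exact hs.add hs'
    · filter_upwards [hi, hi', k1] with x h1 h2 h3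
      exact (h1.add h2).congr h3.symm
    · filter_upwards [hj, hj', k2] with q h1 h2 h3
      exact (h1.add h2).congr h3.symm
    · change _ = ellipticPart Θ ((F + F').fst : 𝓢'(EuclideanSpace ℝ (Fin d), ℂ))
      rw [hcoe, ellipticPart_add, ← hu, ← hu']
      simp only [← Lp.toTemperedDistributionCLM_apply, map_add]
    · have e1 : ∀ᵐ x, (h + h').fst x = h.fst x + h'.fst x := Lp.coeFn_add h.fst h'.fst
      filter_upwards [hi, hi', he, he', k1, e1, Lp.coeFn_add u u'] with x h1 h2 h3 h4 h5 h6 h7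
      simp only [Prod.fst_add, Prod.snd_add] at *
      rw [integral_congr_ae h5, integral_add h1 h2, h6, h7, h3, h4, Pi.add_apply]
      ring
    · have e1 : ∀ᵐ q ∂(volume.prod M.μG), (h + h').snd q = h.snd q + h'.snd q :=
        Lp.coeFn_add h.snd h'.snd
      filter_upwards [hj, hj', hk, hk', k2, e1, hFq, hG] with q h1 h2 h3 h4 h5 h6 h7 h8
      simp only [Prod.fst_add, Prod.snd_add] at *
      rw [integral_congr_ae h5, integral_add h1 h2, h6, h7, h8, h3, h4]
      ring
  zero_mem' := by
    have hF : ∀ᵐ x, (0 : M.L2E).fst x = 0 := Lp.coeFn_zero _ _ _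
    have hG : ∀ᵐ q ∂(volume.prod M.μG), (0 : M.L2E).snd q = 0 := Lp.coeFn_zero _ _ _
    have hGx := Measure.ae_ae_of_ae_prod hG
    have hFq := (Measure.quasiMeasurePreserving_fst (μ := volume) (ν := M.μG)).ae hF
    have hGq := (Measure.quasiMeasurePreserving_fst (μ := volume) (ν := M.μG)).ae hGx
    have hcoe : ((0 : M.L2E).fst : 𝓢'(EuclideanSpace ℝ (Fin d), ℂ)) = 0 := by
      simp only [← Lp.toTemperedDistributionCLM_apply, WithLp.zero_fst, map_zero]
    have k1 : ∀ᵐ x, (fun ξ => (M.bTilde ξ : ℂ) * ((0 : M.L2E).snd (x, ξ) - (0 : M.L2E).fst x))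
        =ᵐ[M.μG] fun _ => 0 := by
      filter_upwards [hF, hGx] with x h1 h2
      filter_upwards [h2] with ξ h3
      rw [h1, h3]
      ring
    have k2 : ∀ᵐ q ∂(volume.prod M.μG),
        (fun ξ' => (M.kernel q.2 ξ' : ℂ) * ((0 : M.L2E).snd (q.1, ξ') - (0 : M.L2E).snd q))
        =ᵐ[M.μG] fun _ => 0 := by
      filter_upwards [hG, hGq] with q h1 h2
      filter_upwards [h2] with ξ h3
      rw [h1, h3]
      ring
    refine ⟨?_, ?_, ?_, ⟨0, ?_, ?_⟩, ?_⟩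
    · change TemperedDistribution.MemSobolev 2 2
        ((0 : M.L2E).fst : 𝓢'(EuclideanSpace ℝ (Fin d), ℂ))
      rw [hcoe]
      exact TemperedDistribution.memSobolev_fun_zero _ _ _ _
    · filter_upwards [k1] with x h3
      exact (integrable_zero _ _ _).congr h3.symm
    · filter_upwards [k2] with q h3
      exact (integrable_zero _ _ _).congr h3.symm
    · change _ = ellipticPart Θ ((0 : M.L2E).fst : 𝓢'(EuclideanSpace ℝ (Fin d), ℂ))
      rw [hcoe, ellipticPart_zero]
      simp only [← Lp.toTemperedDistributionCLM_apply, map_zero]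
    · filter_upwards [k1, hF,
        Lp.coeFn_zero ℂ 2 (volume : Measure (EuclideanSpace ℝ (Fin d)))] with x h5 h6 h7
      simp only [Prod.fst_zero, Prod.snd_zero] at *
      rw [integral_congr_ae h5, h6, h7]
      simp
    · filter_upwards [k2, hFq, hG] with q h5 h7 h8
      simp only [Prod.fst_zero, Prod.snd_zero] at *
      rw [integral_congr_ae h5, h7, h8]
      simp
  smul_mem' := by
    rintro c ⟨F, h⟩ ⟨hs, hi, hj, ⟨u, hu, he⟩, hk⟩
    have hF : ∀ᵐ x, (c • F).fst x = c * F.fst x := Lp.coeFn_smul c F.fst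
    have hG : ∀ᵐ q ∂(volume.prod M.μG), (c • F).snd q = c * F.snd q := Lp.coeFn_smul c F.snd
    have hGx := Measure.ae_ae_of_ae_prod hG
    have hFq := (Measure.quasiMeasurePreserving_fst (μ := volume) (ν := M.μG)).ae hF
    have hGq := (Measure.quasiMeasurePreserving_fst (μ := volume) (ν := M.μG)).ae hGx
    have hcoe : ((c • F).fst : 𝓢'(EuclideanSpace ℝ (Fin d), ℂ)) =
        c • (F.fst : 𝓢'(EuclideanSpace ℝ (Fin d), ℂ)) := by
      simp only [← Lp.toTemperedDistributionCLM_apply, WithLp.smul_fst, map_smul]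
    have k1 : ∀ᵐ x, (fun ξ => (M.bTilde ξ : ℂ) * ((c • F).snd (x, ξ) - (c • F).fst x)) =ᵐ[M.μG]
        fun ξ => c * ((M.bTilde ξ : ℂ) * (F.snd (x, ξ) - F.fst x)) := by
      filter_upwards [hF, hGx] with x h1 h2
      filter_upwards [h2] with ξ h3
      rw [h1, h3]
      ring
    have k2 : ∀ᵐ q ∂(volume.prod M.μG),
        (fun ξ' => (M.kernel q.2 ξ' : ℂ) * ((c • F).snd (q.1, ξ') - (c • F).snd q)) =ᵐ[M.μG]
        fun ξ' => c * ((M.kernel q.2 ξ' : ℂ) * (F.snd (q.1, ξ') - F.snd q)) := by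
      filter_upwards [hG, hGq] with q h1 h2
      filter_upwards [h2] with ξ h3
      rw [h1, h3]
      ring
    refine ⟨?_, ?_, ?_, ⟨c • u, ?_, ?_⟩, ?_⟩
    · change TemperedDistribution.MemSobolev 2 2
        ((c • F).fst : 𝓢'(EuclideanSpace ℝ (Fin d), ℂ))
      rw [hcoe]
      exact hs.smul c
    · filter_upwards [hi, k1] with x h1 h3
      exact (h1.const_mul c).congr h3.symm
    · filter_upwards [hj, k2] with q h1 h3
      exact (h1.const_mul c).congr h3.symm
    · change _ = ellipticPart Θ ((c • F).fst : 𝓢'(EuclideanSpace ℝ (Fin d), ℂ))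
      rw [hcoe, ellipticPart_smul, ← hu]
      simp only [← Lp.toTemperedDistributionCLM_apply, map_smul]
    · have e1 : ∀ᵐ x, (c • h).fst x = c * h.fst x := Lp.coeFn_smul c h.fst
      filter_upwards [he, k1, e1, Lp.coeFn_smul c u] with x h3 h5 h6 h7
      simp only [Prod.smul_fst, Prod.smul_snd] at *
      rw [integral_congr_ae h5, integral_const_mul, h6, h7, h3, Pi.smul_apply, smul_eq_mul]
      ring
    · have e1 : ∀ᵐ q ∂(volume.prod M.μG), (c • h).snd q = c * h.snd q := Lp.coeFn_smul c h.snd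
      filter_upwards [hk, k2, e1, hFq, hG] with q h3 h5 h6 h7 h8
      simp only [Prod.smul_fst, Prod.smul_snd] at *
      rw [integral_congr_ae h5, integral_const_mul, h6, h7, h8, h3]
      ring

/-- `generatorGraph` is single-valued. -/
theorem generatorGraph_single (Θ : Matrix (Fin d) (Fin d) ℝ) (p : M.L2E × M.L2E)
    (hp : p ∈ M.generatorGraph Θ) (h0 : p.1 = 0) : p.2 = 0 := by
  obtain ⟨F, h⟩ := p
  obtain ⟨-, -, -, ⟨u, hu, he⟩, hk⟩ := hp
  simp only at h0 hu he hk
  subst h0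
  have hF : ∀ᵐ x, (0 : M.L2E).fst x = 0 := Lp.coeFn_zero _ _ _
  have hG : ∀ᵐ q ∂(volume.prod M.μG), (0 : M.L2E).snd q = 0 := Lp.coeFn_zero _ _ _
  have hGx := Measure.ae_ae_of_ae_prod hG
  have hFq := (Measure.quasiMeasurePreserving_fst (μ := volume) (ν := M.μG)).ae hF
  have hGq := (Measure.quasiMeasurePreserving_fst (μ := volume) (ν := M.μG)).ae hGx
  have hcoe : ((0 : M.L2E).fst : 𝓢'(EuclideanSpace ℝ (Fin d), ℂ)) = 0 := by
    simp only [← Lp.toTemperedDistributionCLM_apply, WithLp.zero_fst, map_zero]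
  have hu0 : u = 0 := by
    have h1 : Lp.toTemperedDistributionCLM ℂ volume 2 u = 0 := by
      rw [Lp.toTemperedDistributionCLM_apply, hu, hcoe, ellipticPart_zero]
    have h2 : u ∈ (Lp.toTemperedDistributionCLM ℂ
      (volume : Measure (EuclideanSpace ℝ (Fin d))) 2).ker := h1
    rw [Lp.ker_toTemperedDistributionCLM_eq_bot] at h2
    exact h2
  have z1 : h.fst = 0 := by
    apply Lp.ext
    filter_upwards [he, hF, hGx,
      Lp.coeFn_zero ℂ 2 (volume : Measure (EuclideanSpace ℝ (Fin d)))] with x h1 h2 h3 h4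
    have key : (fun ξ => (M.bTilde ξ : ℂ) * ((0 : M.L2E).snd (x, ξ) - (0 : M.L2E).fst x))
        =ᵐ[M.μG] fun _ => 0 := by
      filter_upwards [h3] with ξ h5
      rw [h2, h5]
      ring
    rw [h1, integral_congr_ae key, hu0, h4]
    simp
  have z2 : h.snd = 0 := by
    apply Lp.ext
    filter_upwards [hk, hG, hGq, hFq,
      Lp.coeFn_zero ℂ 2 ((volume : Measure (EuclideanSpace ℝ (Fin d))).prod M.μG)]
      with q h1 h2 h3 h4 h5
    have key : (fun ξ' => (M.kernel q.2 ξ' : ℂ) * ((0 : M.L2E).snd (q.1, ξ') - (0 : M.L2E).snd q))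
        =ᵐ[M.μG] fun _ => 0 := by
      filter_upwards [h3] with ξ h6
      rw [h2, h6]
      ring
    rw [h1, integral_congr_ae key, h2, h4, h5]
    simp
  exact WithLp.ofLp_injective 2 (Prod.ext z1 z2)

/-- The operator `L` on `L²(E)`. -/
def generator (Θ : Matrix (Fin d) (Fin d) ℝ) : M.L2E →ₗ.[ℂ] M.L2E :=
  (M.generatorGraph Θ).toLinearPMap

theorem generator_graph (Θ : Matrix (Fin d) (Fin d) ℝ) :
    (M.generator Θ).graph = M.generatorGraph Θ :=
  Submodule.toLinearPMap_graph_eq _ (M.generatorGraph_single Θ)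

end HighContrastModel

end

/-!
# The spectrum of the homogenised high-contrast nonlocal operator

Up to a rescaling of the second component, `-L` is a symmetric block operator
`(f, g) ↦ (P f + β f - J_b^* g, 𝐀 g - J_c f)`. Here `P = -Θ · ∇∇` on `H²`, the operator `𝐀` acts as
`A = Φ - K` on almost every fibre `g (x, ·)`, `J_u f = f ⊗ u`, and the coupling vectors are
`c = c̃ = A 1` and `b = b̃ = |Y|⁻¹ c̃`. This structure is isolated in `BlockData`, and
`HighContrastModel.IsBlockData.mem_neg_generator_graph` identifies `-L` with it; operators are handled
through their graphs.

*The spectrum.* If `z ∉ σ(A)`, elimination of the second component leaves the Schur complement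
`P - z (1 + ⟨b, (A - z)⁻¹ 1⟩)`, because `A 1 = c`. As `σ(P) = [0, ∞)`, the point `z` is in the
spectrum exactly when the dispersion function `BlockData.disp` takes a value in `[0, ∞)` at `z`: if
not, the Schur complement gives a resolvent (`BlockData.notMem_opSpectrum`), and if so, Weyl sequences
of `P` lift (`BlockData.mem_essSpectrum_of_disp`). The formula of Herglotz type
`BlockData.IsRes.disp_formula` shows that this can happen only for `z ≥ 0` with
`1 + ⟨b, (A - z)⁻¹ 1⟩ ≥ 0`. If `z ∈ σ(A)`, an approximate eigenvector `u` of `A` is combined with a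
vector of high energy of `P`: with `‖P f‖ = 1` and `f` small, `(⟨b, u⟩ f, P f ⊗ u)` is an approximate
eigenvector, as `P` applied to the first component cancels the coupling
(`BlockData.mem_essSpectrum_of_not_isRes`). So all of `σ(A)`, and with it the essential range of `Φ`,
belongs to the essential spectrum.

*The intervals.* `A` is invertible: it is a compact perturbation of multiplication by `Φ ≥ γ₁`, and a
null vector, extended by zero to the fast phase, has no jump energy and is therefore constant
(`HighContrastModel.phiSubK_injective`, `isUnit_mul_sub_compact`). Hence near zero the resolvent of `A`
exists, and the Herglotz formula makes the bracket non-negative (`BlockData.mem_of_lt_lower`); for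
large `t` this follows by comparing norms (`BlockData.mem_of_norm_lt`). Off `σ(A)` there are no
eigenvalues, since `P` has none (`BlockData.not_isEigenvalue`). Symmetry in the rescaled inner product
shows that the range of `-L - t` is dense unless `t` is an eigenvalue (`BlockData.mem_contSpectrum`).
Points of the essential range of `Φ` lie in `σ(A)` because functions supported on small sets where `Φ`
is nearly constant are almost annihilated by the compact operator `K`
(`IsPotentialSub.exists_approx`).

*The effective matrix.* The cell problem is solved by the Fredholm alternative on functions of mean
zero (`HighContrastModel.exists_isCorrector`). The quadratic form of `Θ` is the Dirichlet energy of
`p · (ξ + φ)` (`HighContrastModel.IsCorrector.matForm_effMatrix`); if it vanishes, this function is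
constant on the fast phase, because `Y` is connected by jumps (`exists_ae_eq_const_of_jump`), which
forces `p = 0`. Ellipticity makes `-Θ · ∇∇` on `H²` a Fourier multiplier with range `[0, ∞)` and null
level sets, and this yields all the properties of `P` used above (`isHalfLineGraph_ellipticGraph`).
The matrix `Θ` need not be symmetric, as only its quadratic form enters.
-/

noncomputable section

/-! ### Spectra of unbounded operators in terms of their graphs -/

section Graph

variable {H : Type*} [NormedAddCommGroup H] [InnerProductSpace ℂ H]

theorem isResolventAt_iff_graph (T : H →ₗ.[ℂ] H) (z : ℂ) (R : H →L[ℂ] H) :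
    IsResolventAt T z R ↔
      (∀ u, (R u, u + z • R u) ∈ T.graph) ∧ ∀ x y, (x, y) ∈ T.graph → R (y - z • x) = x := by
  constructor
  · rintro ⟨h1, h2⟩
    refine ⟨fun u => ?_, fun x y hxy => ?_⟩
    · obtain ⟨h, e⟩ := h1 u
      rw [LinearPMap.mem_graph_iff]
      exact ⟨⟨R u, h⟩, rfl, by rw [← sub_eq_iff_eq_add]; exact e⟩
    · obtain ⟨x', rfl, rfl⟩ := (LinearPMap.mem_graph_iff _).1 hxy
      exact h2 x'
  · rintro ⟨h1, h2⟩
    refine ⟨fun u => ?_, fun x => h2 _ _ (T.mem_graph x)⟩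
    obtain ⟨x', e1, e2⟩ := (LinearPMap.mem_graph_iff _).1 (h1 u)
    simp only at e1 e2
    refine ⟨e1 ▸ x'.2, ?_⟩
    rw [sub_eq_iff_eq_add, ← e2]
    congr 1
    exact Subtype.ext e1.symm

theorem isEigenvalue_iff_graph (T : H →ₗ.[ℂ] H) (z : ℂ) :
    IsEigenvalue T z ↔ ∃ x, x ≠ 0 ∧ (x, z • x) ∈ T.graph := by
  constructor
  · rintro ⟨x, hx, e⟩
    exact ⟨x, hx, e ▸ T.mem_graph x⟩
  · rintro ⟨x, hx, h⟩
    obtain ⟨x', e1, e2⟩ := (LinearPMap.mem_graph_iff _).1 h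
    simp only at e1 e2
    subst e1
    exact ⟨x', hx, e2⟩

/-- Weyl's criterion does not require normalisation: a weakly null sequence of approximate
eigenvectors bounded away from zero suffices. -/
theorem mem_essSpectrum_of_graph (T : H →ₗ.[ℂ] H) (z : ℂ) (x y : ℕ → H)
    (hxy : ∀ n, (x n, y n) ∈ T.graph) (hx : ∀ n, 1 ≤ ‖x n‖)
    (hw : ∀ v : H, Tendsto (fun n => inner ℂ v (x n)) atTop (𝓝 0))
    (h0 : Tendsto (fun n => y n - z • x n) atTop (𝓝 0)) : z ∈ essSpectrum T := by
  choose x' hx' hy' using fun n => (LinearPMap.mem_graph_iff _).1 (hxy n)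
  have hn : ∀ n, ‖((‖x n‖⁻¹ : ℝ) : ℂ)‖ ≤ 1 := fun n => by
    rw [Complex.norm_real, norm_inv, norm_norm]
    exact inv_le_one_of_one_le₀ (hx n)
  refine ⟨fun n => ((‖x n‖⁻¹ : ℝ) : ℂ) • x' n, fun n => ?_, fun v => ?_, ?_⟩
  · have : ‖x n‖ ≠ 0 := (zero_lt_one.trans_le (hx n)).ne'
    rw [Submodule.coe_smul, norm_smul, hx' n, Complex.norm_real, norm_inv, norm_norm,
      inv_mul_cancel₀ this]
  · refine squeeze_zero_norm (fun n => ?_) (tendsto_zero_iff_norm_tendsto_zero.1 (hw v))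
    rw [Submodule.coe_smul, hx' n, inner_smul_right, norm_mul]
    exact mul_le_of_le_one_left (norm_nonneg _) (hn n)
  · refine squeeze_zero_norm (fun n => ?_) (tendsto_zero_iff_norm_tendsto_zero.1 h0)
    have e : T (((‖x n‖⁻¹ : ℝ) : ℂ) • x' n) - z • ((((‖x n‖⁻¹ : ℝ) : ℂ) • x' n : T.domain) : H)
        = ((‖x n‖⁻¹ : ℝ) : ℂ) • (y n - z • x n) := by
      rw [LinearPMap.map_smul, Submodule.coe_smul, hx' n, hy' n, smul_sub, smul_comm z]
    rw [e, norm_smul]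
    exact mul_le_of_le_one_left (norm_nonneg _) (hn n)

theorem essSpectrum_subset_opSpectrum (T : H →ₗ.[ℂ] H) : essSpectrum T ⊆ opSpectrum T := by
  rintro z ⟨u, hu, -, h0⟩ ⟨R, -, hR⟩
  have h1 : Tendsto (fun n => R (T (u n) - z • (u n : H))) atTop (𝓝 (R 0)) :=
    (R.continuous.tendsto 0).comp h0
  simp only [hR, map_zero] at h1
  have h2 := h1.norm
  simp only [hu, norm_zero] at h2
  exact one_ne_zero (tendsto_nhds_unique tendsto_const_nhds h2)

/-- A spectral point that is not an eigenvalue lies in the continuous spectrum as soon as no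
non-zero vector is orthogonal to the range of `T - z`. -/
theorem mem_contSpectrum_of_orthogonal [CompleteSpace H] (T : H →ₗ.[ℂ] H) (z : ℂ)
    (hz : z ∈ opSpectrum T) (he : ¬ IsEigenvalue T z)
    (ho : ∀ h, (∀ x y, (x, y) ∈ T.graph → inner ℂ (y - z • x) h = 0) → h = 0) :
    z ∈ contSpectrum T := by
  refine ⟨hz, he, ?_⟩
  let S : Submodule ℂ H := LinearMap.range (T.toFun - z • T.domain.subtype)
  have hS : (Set.range fun x : T.domain => T x - z • (x : H)) = (S : Set H) := by
    ext y
    simp [S]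
  rw [hS, Submodule.dense_iff_topologicalClosure_eq_top, Submodule.topologicalClosure_eq_top_iff,
    Submodule.eq_bot_iff]
  intro h hh
  refine ho h fun x y hxy => ?_
  obtain ⟨x', rfl, rfl⟩ := (LinearPMap.mem_graph_iff _).1 hxy
  exact (Submodule.mem_orthogonal _ _).1 hh _ ⟨x', by simp⟩

end Graph

/-! ### Bounded self-adjoint operators -/

section Bounded

variable {H : Type*} [NormedAddCommGroup H] [InnerProductSpace ℂ H] [CompleteSpace H]

/-- For self-adjoint `T`, the operators `T - z` and `T - conj z` are equally large. -/
theorem norm_sub_smul_conj {T : H →L[ℂ] H} (hT : IsSelfAdjoint T) (z : ℂ) (u : H) :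
    ‖T u - z • u‖ = ‖T u - (starRingEnd ℂ z) • u‖ := by
  have hs : ∀ x y, inner ℂ (T x) y = inner ℂ x (T y) := fun x y =>
    ContinuousLinearMap.isSelfAdjoint_iff_isSymmetric.1 hT x y
  have : ‖T u - z • u‖ ^ 2 = ‖T u - (starRingEnd ℂ z) • u‖ ^ 2 := by
    rw [@norm_sub_sq ℂ, @norm_sub_sq ℂ, norm_smul, norm_smul, RCLike.norm_conj, inner_smul_right,
      inner_smul_right]
    have him : (inner ℂ (T u) u).im = 0 := by
      have h := inner_conj_symm (𝕜 := ℂ) (T u) u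
      rw [← hs] at h
      exact Complex.conj_eq_iff_im.1 h
    simp [him]
  exact (sq_eq_sq₀ (norm_nonneg _) (norm_nonneg _)).1 this

/-- A self-adjoint operator shifted by any complex number is invertible once it is bounded below. -/
theorem exists_inverse_of_bounded_below {T : H →L[ℂ] H} (hT : IsSelfAdjoint T) {z : ℂ} {c : ℝ}
    (hc : 0 < c) (hb : ∀ u, c * ‖u‖ ≤ ‖T u - z • u‖) :
    ∃ R : H →L[ℂ] H, (∀ u, T (R u) - z • R u = u) ∧ ∀ u, R (T u - z • u) = u := by
  let S : H →L[ℂ] H := T - z • ContinuousLinearMap.id ℂ H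
  have hS : ∀ u, S u = T u - z • u := fun u => by simp [S]
  have hanti : AntilipschitzWith (Real.toNNReal c⁻¹) S := by
    refine ContinuousLinearMap.antilipschitz_of_bound S fun x => ?_
    rw [hS, Real.coe_toNNReal _ (inv_nonneg.2 hc.le), ← div_eq_inv_mul, le_div_iff₀ hc, mul_comm]
    exact hb x
  have hker : LinearMap.ker (S : H →ₗ[ℂ] H) = ⊥ := LinearMap.ker_eq_bot.2 hanti.injective
  have hclosed : IsClosed ((LinearMap.range (S : H →ₗ[ℂ] H) : Submodule ℂ H) : Set H) := by
    rw [LinearMap.coe_range]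
    exact hanti.isClosed_range S.uniformContinuous
  have hran : LinearMap.range (S : H →ₗ[ℂ] H) = ⊤ := by
    rw [← hclosed.submodule_topologicalClosure_eq, Submodule.topologicalClosure_eq_top_iff,
      Submodule.eq_bot_iff]
    intro h hh
    have hs : ∀ x y, inner ℂ (T x) y = inner ℂ x (T y) := fun x y =>
      ContinuousLinearMap.isSelfAdjoint_iff_isSymmetric.1 hT x y
    have h1 : T h - (starRingEnd ℂ z) • h = 0 := by
      refine ext_inner_left ℂ fun v => ?_
      have := (Submodule.mem_orthogonal _ _).1 hh (S v) ⟨v, rfl⟩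
      rw [hS, inner_sub_left, hs, inner_smul_left] at this
      rw [inner_sub_right, inner_smul_right, this, inner_zero_right]
    have h2 := hb h
    rw [norm_sub_smul_conj hT, h1, norm_zero] at h2
    have : ‖h‖ ≤ 0 := by
      by_contra hpos
      exact absurd h2 (not_le.2 (mul_pos hc (not_le.1 hpos)))
    exact norm_le_zero_iff.1 this
  let e := ContinuousLinearEquiv.ofBijective S hker hran
  refine ⟨e.symm, fun u => ?_, fun u => ?_⟩
  · rw [← hS]
    exact ContinuousLinearEquiv.ofBijective_apply_symm_apply S hker hran u
  · rw [← hS]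
    exact ContinuousLinearEquiv.ofBijective_symm_apply_apply S hker hran u

/-- Orthonormal sequences are weakly null. -/
theorem Orthonormal.tendsto_inner_zero {H : Type*} [NormedAddCommGroup H] [InnerProductSpace ℂ H]
    {e : ℕ → H} (he : Orthonormal ℂ e) (v : H) :
    Tendsto (fun n => inner ℂ v (e n)) atTop (𝓝 0) := by
  have h := (he.inner_products_summable v).tendsto_atTop_zero
  rw [tendsto_zero_iff_norm_tendsto_zero]
  have h2 := h.sqrt
  simp only [Real.sqrt_zero, Real.sqrt_sq (norm_nonneg _)] at h2
  simpa only [norm_inner_symm v] using h2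

end Bounded

/-! ### Block operators built from a half-line operator and a bounded self-adjoint operator -/

section Block

set_option linter.unusedSectionVars false

variable {H₀ H HH : Type*} [NormedAddCommGroup H₀] [InnerProductSpace ℂ H₀] [CompleteSpace H₀]
  [NormedAddCommGroup H] [InnerProductSpace ℂ H] [CompleteSpace H]
  [NormedAddCommGroup HH] [InnerProductSpace ℂ HH] [CompleteSpace HH]

/-- `P` is the graph of a self-adjoint operator with spectrum `[0, ∞)` and without eigenvalues,
in the form needed for block operators: adjoint pairs belong to the graph, there are resolvents off
the half-line, orthonormal Weyl sequences on it, and high-energy vectors with orthonormal images. -/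
structure IsHalfLineGraph (P : Submodule ℂ (H₀ × H₀)) : Prop where
  maximal : ∀ h k, (∀ f u, (f, u) ∈ P → inner ℂ u h = inner ℂ f k) → (h, k) ∈ P
  resolvent : ∀ z : ℂ, (∀ t : ℝ, 0 ≤ t → z ≠ t) → ∃ R : H₀ →L[ℂ] H₀,
    (∀ h, (R h, h + z • R h) ∈ P) ∧ ∀ f u, (f, u) ∈ P → R (u - z • f) = f
  weyl : ∀ t : ℝ, 0 ≤ t → ∃ f u : ℕ → H₀, (∀ n, (f n, u n) ∈ P) ∧ Orthonormal ℂ f ∧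
    Tendsto (fun n => u n - (t : ℂ) • f n) atTop (𝓝 0)
  injective : ∀ (z : ℂ) f, (f, z • f) ∈ P → f = 0
  high : ∃ f u : ℕ → H₀, (∀ n, (f n, u n) ∈ P) ∧ Orthonormal ℂ u ∧ Tendsto f atTop (𝓝 0)

variable (H₀ H HH) in
/-- The ingredients of the operator `(f, g) ↦ (P f + β f - J_b^* g, 𝐀 g - J_c f)`, where `J_u f = f ⊗ u`,
`𝐀 (f ⊗ u) = f ⊗ A u`, `c = A e`, `b = κ⁻¹ c` and `β = ⟨b, e⟩`. -/
structure BlockData where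
  /-- the graph of the half-line operator -/
  P : Submodule ℂ (H₀ × H₀)
  /-- the operator on the small space -/
  A : H →L[ℂ] H
  /-- its amplification to the product space -/
  AA : HH →L[ℂ] HH
  /-- the tensor products `f ⊗ u` -/
  J : H →ₗ[ℂ] H₀ →L[ℂ] HH
  /-- the constant function -/
  e : H
  /-- the coupling weight -/
  κ : ℝ
  hP : IsHalfLineGraph P
  A_selfAdjoint : IsSelfAdjoint A
  AA_selfAdjoint : IsSelfAdjoint AA
  AA_J : ∀ u f, AA (J u f) = J (A u) f
  inner_J : ∀ u v f g, inner ℂ (J u f) (J v g) = inner ℂ u v * inner ℂ f g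
  lower : ∀ (z : ℂ) (r : ℝ), 0 < r → (∀ u, r * ‖u‖ ≤ ‖A u - z • u‖) →
    ∀ g, r * ‖g‖ ≤ ‖AA g - z • g‖
  κ_pos : 0 < κ
  A_nonneg : ∀ u, 0 ≤ (inner ℂ u (A u)).re

namespace BlockData

variable (D : BlockData H₀ H HH)

/-- The coupling vector `c = A e`. -/
def c : H := D.A D.e

/-- The coupling vector `b = κ⁻¹ c`. -/
def b : H := ((D.κ⁻¹ : ℝ) : ℂ) • D.c

/-- The constant `β = ⟨b, e⟩`. -/
def β : ℂ := inner ℂ D.b D.e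

/-- `F ↦ h` under the block operator. -/
def Gen (F h : WithLp 2 (H₀ × HH)) : Prop :=
  ∃ u, (F.fst, u) ∈ D.P ∧
    h.fst = u + D.β • F.fst - ContinuousLinearMap.adjoint (D.J D.b) F.snd ∧
    h.snd = D.AA F.snd - D.J D.c F.fst

theorem A_symm (u v : H) : inner ℂ (D.A u) v = inner ℂ u (D.A v) :=
  ContinuousLinearMap.isSelfAdjoint_iff_isSymmetric.1 D.A_selfAdjoint u v

theorem AA_symm (u v : HH) : inner ℂ (D.AA u) v = inner ℂ u (D.AA v) :=
  ContinuousLinearMap.isSelfAdjoint_iff_isSymmetric.1 D.AA_selfAdjoint u v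

theorem norm_J (u : H) (f : H₀) : ‖D.J u f‖ = ‖u‖ * ‖f‖ := by
  have h := D.inner_J u u f f
  rw [inner_self_eq_norm_sq_to_K, inner_self_eq_norm_sq_to_K, inner_self_eq_norm_sq_to_K] at h
  have h2 : ‖D.J u f‖ ^ 2 = (‖u‖ * ‖f‖) ^ 2 := by
    rw [mul_pow]
    exact_mod_cast h
  exact (sq_eq_sq₀ (norm_nonneg _) (by positivity)).1 h2

theorem adjoint_J (u v : H) (f : H₀) :
    ContinuousLinearMap.adjoint (D.J u) (D.J v f) = (inner ℂ u v : ℂ) • f := by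
  refine ext_inner_left ℂ fun g => ?_
  rw [ContinuousLinearMap.adjoint_inner_right, D.inner_J, inner_smul_right]

theorem β_eq : D.β = ((D.κ⁻¹ : ℝ) : ℂ) * inner ℂ D.c D.e := by
  rw [β, b, inner_smul_left, Complex.conj_ofReal]

theorem conj_β : starRingEnd ℂ D.β = D.β := by
  rw [β_eq, map_mul, Complex.conj_ofReal, c, inner_conj_symm, D.A_symm]

/-- `R` is the resolvent `(A - z)⁻¹`. -/
def IsRes (z : ℂ) (R : H →L[ℂ] H) : Prop :=
  (∀ u, D.A (R u) - z • R u = u) ∧ ∀ u, R (D.A u - z • u) = u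

theorem IsRes.lower {D : BlockData H₀ H HH} {z : ℂ} {R : H →L[ℂ] H} (hR : D.IsRes z R) :
    ∃ r : ℝ, 0 < r ∧ ∀ u, r * ‖u‖ ≤ ‖D.A u - z • u‖ := by
  refine ⟨(‖R‖ + 1)⁻¹, by positivity, fun u => ?_⟩
  rw [inv_mul_le_iff₀ (by positivity)]
  calc ‖u‖ = ‖R (D.A u - z • u)‖ := by rw [hR.2]
    _ ≤ ‖R‖ * ‖D.A u - z • u‖ := R.le_opNorm _
    _ ≤ (‖R‖ + 1) * ‖D.A u - z • u‖ := by gcongr; linarith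

/-- The resolvent of `A` extends to a resolvent of `𝐀` acting on the second factor. -/
theorem IsRes.amplify {D : BlockData H₀ H HH} {z : ℂ} {R : H →L[ℂ] H} (hR : D.IsRes z R) :
    ∃ RR : HH →L[ℂ] HH, (∀ u, D.AA (RR u) - z • RR u = u) ∧
      (∀ u, RR (D.AA u - z • u) = u) ∧ ∀ u f, RR (D.J u f) = D.J (R u) f := by
  obtain ⟨r, hr, hb⟩ := hR.lower
  obtain ⟨RR, h1, h2⟩ := exists_inverse_of_bounded_below D.AA_selfAdjoint hr (D.lower z r hr hb)
  refine ⟨RR, h1, h2, fun u f => ?_⟩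
  have h : D.AA (D.J (R u) f) - z • D.J (R u) f = D.J u f := by
    rw [D.AA_J, ← _root_.smul_apply, ← map_smul, ← _root_.sub_apply,
      ← map_sub, hR.1]
  rw [← h, h2]

/-- The dispersion function `z (1 + ⟨b, (A - z)⁻¹ e⟩)`, with `R = (A - z)⁻¹`: the Schur complement
of `𝐀 - z` in the block operator shifted by `z` is `P` minus this number. -/
def disp (z : ℂ) (R : H →L[ℂ] H) : ℂ := z * (1 + inner ℂ D.b (R D.e))

theorem IsRes.apply_c {D : BlockData H₀ H HH} {z : ℂ} {R : H →L[ℂ] H} (hR : D.IsRes z R) :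
    R D.c = D.e + z • R D.e := by
  have h := hR.2 D.e
  rw [map_sub, map_smul, sub_eq_iff_eq_add] at h
  exact h

theorem IsRes.disp_eq {D : BlockData H₀ H HH} {z : ℂ} {R : H →L[ℂ] H} (hR : D.IsRes z R) :
    D.disp z R = z - D.β + inner ℂ D.b (R D.c) := by
  rw [hR.apply_c, inner_add_right, inner_smul_right, disp, β]
  ring

/-- The Herglotz-type formula for the dispersion function, with `w = (A - z)⁻¹ e`. -/
theorem IsRes.disp_formula {D : BlockData H₀ H HH} {z : ℂ} {R : H →L[ℂ] H} (hR : D.IsRes z R) :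
    D.disp z R = z + ((D.κ⁻¹ : ℝ) : ℂ) * (z * ((‖D.A (R D.e)‖ ^ 2 : ℝ) : ℂ)
      - ((‖z‖ ^ 2 * (inner ℂ (R D.e) (D.A (R D.e))).re : ℝ) : ℂ)) := by
  set w := R D.e with hw
  have hre : inner ℂ w (D.A w) = (((inner ℂ w (D.A w)).re : ℝ) : ℂ) := by
    have h := inner_conj_symm (𝕜 := ℂ) w (D.A w)
    rw [D.A_symm] at h
    exact (Complex.conj_eq_iff_re.1 h).symm
  have he : D.A w - z • w = D.e := hR.1 D.e
  have h1 : inner ℂ D.b w = ((D.κ⁻¹ : ℝ) : ℂ) * (((‖D.A w‖ ^ 2 : ℝ) : ℂ)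
      - starRingEnd ℂ z * (((inner ℂ w (D.A w)).re : ℝ) : ℂ)) := by
    rw [b, inner_smul_left, Complex.conj_ofReal, c, D.A_symm]
    congr 1
    nth_rewrite 1 [← he]
    rw [inner_sub_left, inner_smul_left, inner_self_eq_norm_sq_to_K, ← hre]
    push_cast
    rfl
  have hzz : z * starRingEnd ℂ z = ((‖z‖ ^ 2 : ℝ) : ℂ) := by
    rw [Complex.mul_conj, Complex.normSq_eq_norm_sq]
  rw [disp, ← hw, h1]
  push_cast at hzz ⊢
  linear_combination (-(↑D.κ)⁻¹ * (((inner ℂ w (D.A w)).re : ℝ) : ℂ)) * hzz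

theorem κ_inv_pos : 0 < D.κ⁻¹ := inv_pos.2 D.κ_pos

/-- For a real spectral parameter `t` the bracket `1 + ⟨b, (A - t)⁻¹ e⟩` is real, and it is
non-negative if `t` does not exceed some lower bound `r` of `A`. -/
theorem IsRes.disp_ofReal {D : BlockData H₀ H HH} {t : ℝ} {R : H →L[ℂ] H} (hR : D.IsRes t R) :
    ∃ s : ℝ, (1 + inner ℂ D.b (R D.e) : ℂ) = s ∧ D.disp t R = ((t * s : ℝ) : ℂ) ∧
      (∀ r, t ≤ r → (∀ u, r * ‖u‖ ≤ ‖D.A u‖) → 0 ≤ r → 0 ≤ s) := by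
  have hre : inner ℂ (R D.e) (D.A (R D.e)) = (((inner ℂ (R D.e) (D.A (R D.e))).re : ℝ) : ℂ) := by
    have h := inner_conj_symm (𝕜 := ℂ) (R D.e) (D.A (R D.e))
    rw [D.A_symm] at h
    exact (Complex.conj_eq_iff_re.1 h).symm
  have he : D.A (R D.e) - (t : ℂ) • R D.e = D.e := hR.1 D.e
  have h1 : (1 + inner ℂ D.b (R D.e) : ℂ) =
      ((1 + D.κ⁻¹ * (‖D.A (R D.e)‖ ^ 2 - t * (inner ℂ (R D.e) (D.A (R D.e))).re) : ℝ) : ℂ) := by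
    rw [b, inner_smul_left, Complex.conj_ofReal, c, D.A_symm]
    nth_rewrite 1 [← he]
    rw [inner_sub_left, inner_smul_left, inner_self_eq_norm_sq_to_K, hre, Complex.conj_ofReal]
    push_cast
    rfl
  refine ⟨_, h1, ?_, fun r htr hr hr0 => ?_⟩
  · rw [disp, h1, ← Complex.ofReal_mul]
  · have h2 := hr (R D.e)
    have h3 : (inner ℂ (R D.e) (D.A (R D.e))).re ≤ ‖R D.e‖ * ‖D.A (R D.e)‖ :=
      (Complex.re_le_norm _).trans (norm_inner_le_norm _ _)
    have h4 := D.A_nonneg (R D.e)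
    have h5 : t * (inner ℂ (R D.e) (D.A (R D.e))).re ≤ ‖D.A (R D.e)‖ ^ 2 :=
      calc t * (inner ℂ (R D.e) (D.A (R D.e))).re
          ≤ r * (inner ℂ (R D.e) (D.A (R D.e))).re := by gcongr
        _ ≤ r * (‖R D.e‖ * ‖D.A (R D.e)‖) := by gcongr
        _ = (r * ‖R D.e‖) * ‖D.A (R D.e)‖ := by ring
        _ ≤ ‖D.A (R D.e)‖ * ‖D.A (R D.e)‖ := by gcongr
        _ = _ := by ring
    have := mul_nonneg D.κ_inv_pos.le (sub_nonneg.2 h5)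
    linarith

/-- The dispersion function takes values in `[0, ∞)` only at points `z ≥ 0` with a non-negative
bracket: its imaginary part has the sign of `im z`, and it is negative for `z < 0`. -/
theorem IsRes.disp_ne {D : BlockData H₀ H HH} {z : ℂ} {R : H →L[ℂ] H} (hR : D.IsRes z R)
    (hz : ∀ t : ℝ, 0 ≤ t → z = t → (1 + inner ℂ D.b (R D.e) : ℂ).re < 0) :
    ∀ t : ℝ, 0 ≤ t → D.disp z R ≠ t := by
  intro s hs heq
  by_cases him : z.im = 0
  · have hzr : z = ((z.re : ℝ) : ℂ) := Complex.ext rfl (by simpa using him)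
    generalize z.re = t at hzr
    subst hzr
    obtain ⟨r, h1, h2, h3⟩ := hR.disp_ofReal
    rw [h2] at heq
    have heq' : t * r = s := by exact_mod_cast heq
    rcases lt_or_ge 0 t with ht | ht
    · have := hz t ht.le rfl
      rw [h1, Complex.ofReal_re] at this
      nlinarith [mul_neg_of_pos_of_neg ht this]
    · have hr := h3 0 ht (fun u => by simp) le_rfl
      rcases eq_or_lt_of_le ht with h0 | h0
      · have := hz t h0.ge rfl
        rw [h1, Complex.ofReal_re] at this
        linarith
      · -- for negative `t` the bracket is at least one, so that the product is negative
        have h4 := hR.disp_formula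
        rw [h2] at h4
        have h5 : t * r = t + D.κ⁻¹ * (t * ‖D.A (R D.e)‖ ^ 2
            - t ^ 2 * (inner ℂ (R D.e) (D.A (R D.e))).re) := by
          rw [Complex.norm_real, Real.norm_eq_abs, sq_abs] at h4
          exact_mod_cast h4
        have h6 : t * ‖D.A (R D.e)‖ ^ 2 ≤ 0 :=
          mul_nonpos_of_nonpos_of_nonneg ht (by positivity)
        have h7 := mul_nonneg (sq_nonneg t) (D.A_nonneg (R D.e))
        have h8 := mul_nonneg D.κ_inv_pos.le (by linarith : 0 ≤ -(t * ‖D.A (R D.e)‖ ^ 2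
            - t ^ 2 * (inner ℂ (R D.e) (D.A (R D.e))).re))
        linarith
  · -- off the real axis, the imaginary part is a positive multiple of `im z`
    have h1 := congrArg Complex.im (hR.disp_formula)
    rw [heq] at h1
    have h2 : (0 : ℝ) = z.im * (1 + D.κ⁻¹ * ‖D.A (R D.e)‖ ^ 2) := by
      rw [Complex.ofReal_im, Complex.add_im, Complex.im_ofReal_mul, Complex.sub_im,
        Complex.im_mul_ofReal, Complex.ofReal_im] at h1
      rw [h1]
      ring
    have h3 : 0 < 1 + D.κ⁻¹ * ‖D.A (R D.e)‖ ^ 2 := by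
      have := mul_nonneg D.κ_inv_pos.le (sq_nonneg ‖D.A (R D.e)‖)
      linarith
    rcases mul_eq_zero.1 h2.symm with h | h
    · exact him h
    · exact h3.ne' h

/-- Every point of `σ(A)` lies in the essential spectrum of the block operator: approximate
eigenvectors `u` of `A` are tensored with high-energy vectors `P f`, and the first component
`⟨b, u⟩ f` removes the coupling term. -/
theorem mem_essSpectrum_of_not_isRes {T : WithLp 2 (H₀ × HH) →ₗ.[ℂ] WithLp 2 (H₀ × HH)}
    (hT : ∀ F h, (F, h) ∈ T.graph ↔ D.Gen F h) {z : ℂ} (hz : ¬ ∃ R, D.IsRes z R) :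
    z ∈ essSpectrum T := by
  have happ : ∀ n : ℕ, ∃ u : H, ‖u‖ = 1 ∧ ‖D.A u - z • u‖ < 1 / ((n : ℝ) + 1) := by
    intro n
    by_contra hcon
    push Not at hcon
    refine hz (exists_inverse_of_bounded_below D.A_selfAdjoint (c := 1 / ((n : ℝ) + 1))
      (by positivity) fun u => ?_)
    rcases eq_or_ne u 0 with rfl | hu
    · simp
    have hu' : ‖u‖ ≠ 0 := norm_ne_zero_iff.2 hu
    have h := hcon (((‖u‖⁻¹ : ℝ) : ℂ) • u) (by
      rw [norm_smul, Complex.norm_real, norm_inv, norm_norm, inv_mul_cancel₀ hu'])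
    rw [map_smul, smul_comm z, ← smul_sub, norm_smul, Complex.norm_real, norm_inv, norm_norm,
      le_inv_mul_iff₀ (norm_pos_iff.2 hu)] at h
    linarith
  choose u hu hAu using happ
  obtain ⟨f, θ, hfθ, hθ, hf⟩ := D.hP.high
  have hu0 : Tendsto (fun n => D.A (u n) - z • u n) atTop (𝓝 0) :=
    squeeze_zero_norm (fun n => (hAu n).le) tendsto_one_div_add_atTop_nhds_zero_nat
  have hbu : ∀ n, ‖(inner ℂ D.b (u n) : ℂ)‖ ≤ ‖D.b‖ := fun n => by
    simpa [hu n] using norm_inner_le_norm (𝕜 := ℂ) D.b (u n)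
  have hbf : ∀ C : ℂ, Tendsto (fun n => C • ((inner ℂ D.b (u n) : ℂ) • f n)) atTop (𝓝 0) := by
    intro C
    have h1 : Tendsto (fun n => ‖C‖ * (‖D.b‖ * ‖f n‖)) atTop (𝓝 0) := by
      simpa using (hf.norm.const_mul ‖D.b‖).const_mul ‖C‖
    refine squeeze_zero_norm (fun n => ?_) h1
    rw [norm_smul, norm_smul]
    gcongr
    exact hbu n
  -- orthonormality in the first factor makes the tensors weakly null, whatever the `u n` are
  have hon : Orthonormal ℂ fun n => D.J (u n) (θ n) := by
    refine ⟨fun n => by rw [D.norm_J, hu n, hθ.1 n, one_mul], fun m n hmn => ?_⟩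
    change inner ℂ _ _ = (0 : ℂ)
    rw [D.inner_J, hθ.2 hmn, mul_zero]
  let x : ℕ → WithLp 2 (H₀ × HH) := fun n =>
    WithLp.toLp 2 ((inner ℂ D.b (u n) : ℂ) • f n, D.J (u n) (θ n))
  let y : ℕ → WithLp 2 (H₀ × HH) := fun n =>
    WithLp.toLp 2 ((inner ℂ D.b (u n) : ℂ) • θ n + D.β • ((inner ℂ D.b (u n) : ℂ) • f n)
        - ContinuousLinearMap.adjoint (D.J D.b) (D.J (u n) (θ n)),
      D.AA (D.J (u n) (θ n)) - D.J D.c ((inner ℂ D.b (u n) : ℂ) • f n))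
  refine mem_essSpectrum_of_graph T z x y (fun n => ?_) (fun n => ?_) (fun v => ?_) ?_
  · exact (hT _ _).2 ⟨_, D.P.smul_mem (inner ℂ D.b (u n)) (hfθ n), rfl, rfl⟩
  · have h1 : ‖x n‖ ^ 2 = ‖(inner ℂ D.b (u n) : ℂ) • f n‖ ^ 2 + ‖D.J (u n) (θ n)‖ ^ 2 :=
      WithLp.prod_norm_sq_eq_of_L2 _
    rw [hon.1 n] at h1
    nlinarith [norm_nonneg (x n), sq_nonneg ‖(inner ℂ D.b (u n) : ℂ) • f n‖]
  · have h1 : Tendsto (fun n => inner ℂ v.fst ((inner ℂ D.b (u n) : ℂ) • f n)) atTop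
        (𝓝 (0 : ℂ)) := by
      have h2 := hbf 1
      simp only [one_smul] at h2
      have h3 := (tendsto_const_nhds (x := v.fst)).inner (𝕜 := ℂ) h2
      rwa [inner_zero_right] at h3
    have h4 := h1.add (hon.tendsto_inner_zero v.snd)
    rw [add_zero] at h4
    exact h4.congr fun n => (WithLp.prod_inner_apply (𝕜 := ℂ) v (x n)).symm
  · -- in the first component, `P (⟨b, u⟩ f) = ⟨b, u⟩ θ` cancels `J_b^* (θ ⊗ u)`
    have e : ∀ n, y n - z • x n = WithLp.toLp 2 ((D.β - z) • ((inner ℂ D.b (u n) : ℂ) • f n),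
        D.J (D.A (u n) - z • u n) (θ n) - D.J D.c ((inner ℂ D.b (u n) : ℂ) • f n)) := by
      intro n
      apply WithLp.ofLp_injective
      refine Prod.ext ?_ ?_
      · simp only [x, y, WithLp.ofLp_sub, WithLp.ofLp_smul, Prod.fst_sub, Prod.smul_fst,
          D.adjoint_J]
        module
      · simp only [x, y, WithLp.ofLp_sub, WithLp.ofLp_smul, Prod.snd_sub, Prod.smul_snd,
          D.AA_J, map_sub, map_smul, _root_.sub_apply, _root_.smul_apply]
        module
    simp only [e]
    have h2 : Tendsto (fun n => D.J (D.A (u n) - z • u n) (θ n)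
        - D.J D.c ((inner ℂ D.b (u n) : ℂ) • f n)) atTop (𝓝 0) := by
      have h3 : Tendsto (fun n => D.J (D.A (u n) - z • u n) (θ n)) atTop (𝓝 0) := by
        rw [tendsto_zero_iff_norm_tendsto_zero] at hu0 ⊢
        simpa only [D.norm_J, hθ.1, mul_one] using hu0
      have h4 := hbf 1
      simp only [one_smul] at h4
      have h5 := ((D.J D.c).continuous.tendsto 0).comp h4
      rw [map_zero] at h5
      simpa using h3.sub h5
    have h6 := (hbf (D.β - z)).prodMk_nhds h2
    exact ((WithLp.prod_continuous_toLp 2 H₀ HH).tendsto (0, 0)).comp h6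

/-- Off `σ(A)`, points where the dispersion function is non-negative lie in the essential
spectrum: Weyl sequences `f` of `P` lift to `(f, f ⊗ (A - z)⁻¹ c)`. -/
theorem mem_essSpectrum_of_disp {T : WithLp 2 (H₀ × HH) →ₗ.[ℂ] WithLp 2 (H₀ × HH)}
    (hT : ∀ F h, (F, h) ∈ T.graph ↔ D.Gen F h) {z : ℂ} {R : H →L[ℂ] H} (hR : D.IsRes z R)
    {t : ℝ} (ht : 0 ≤ t) (hd : D.disp z R = t) : z ∈ essSpectrum T := by
  obtain ⟨f, u, hfu, hf, h0⟩ := D.hP.weyl t ht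
  let x : ℕ → WithLp 2 (H₀ × HH) := fun n => WithLp.toLp 2 (f n, D.J (R D.c) (f n))
  let y : ℕ → WithLp 2 (H₀ × HH) := fun n =>
    WithLp.toLp 2 (u n + D.β • f n - ContinuousLinearMap.adjoint (D.J D.b) (D.J (R D.c) (f n)),
      D.AA (D.J (R D.c) (f n)) - D.J D.c (f n))
  refine mem_essSpectrum_of_graph T z x y (fun n => ?_) (fun n => ?_) (fun v => ?_) ?_
  · exact (hT _ _).2 ⟨_, hfu n, rfl, rfl⟩
  · have h1 : ‖x n‖ ^ 2 = ‖f n‖ ^ 2 + ‖D.J (R D.c) (f n)‖ ^ 2 :=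
      WithLp.prod_norm_sq_eq_of_L2 _
    rw [hf.1 n] at h1
    nlinarith [norm_nonneg (x n), sq_nonneg ‖D.J (R D.c) (f n)‖]
  · have h1 := hf.tendsto_inner_zero v.fst
    have h2 := hf.tendsto_inner_zero (ContinuousLinearMap.adjoint (D.J (R D.c)) v.snd)
    simp only [ContinuousLinearMap.adjoint_inner_left] at h2
    simpa [x, WithLp.prod_inner_apply] using h1.add h2
  · have e : ∀ n, y n - z • x n = WithLp.toLp 2 (u n - (t : ℂ) • f n, 0) := by
      intro n
      apply WithLp.ofLp_injective
      refine Prod.ext ?_ ?_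
      · simp only [x, y, WithLp.ofLp_sub, WithLp.ofLp_smul, Prod.fst_sub, Prod.smul_fst,
          D.adjoint_J, ← hd, hR.disp_eq]
        module
      · simp only [x, y, WithLp.ofLp_sub, WithLp.ofLp_smul, Prod.snd_sub, Prod.smul_snd, D.AA_J]
        have h := hR.1 D.c
        rw [sub_eq_iff_eq_add] at h
        rw [h, map_add, map_smul, _root_.add_apply, _root_.smul_apply]
        module
    simp only [e]
    exact ((WithLp.prod_continuous_toLp 2 H₀ HH).tendsto (0, 0)).comp
      (h0.prodMk_nhds tendsto_const_nhds)

/-- Where the dispersion function avoids `[0, ∞)`, the block operator has a resolvent, given by the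
Schur complement. -/
theorem notMem_opSpectrum {T : WithLp 2 (H₀ × HH) →ₗ.[ℂ] WithLp 2 (H₀ × HH)}
    (hT : ∀ F h, (F, h) ∈ T.graph ↔ D.Gen F h) {z : ℂ} {R : H →L[ℂ] H} (hR : D.IsRes z R)
    (hd : ∀ t : ℝ, 0 ≤ t → D.disp z R ≠ t) : z ∉ opSpectrum T := by
  obtain ⟨RR, hRR1, hRR2, hRRJ⟩ := hR.amplify
  obtain ⟨Q, hQ1, hQ2⟩ := D.hP.resolvent _ hd
  let B := ContinuousLinearMap.adjoint (D.J D.b)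
  let pf : WithLp 2 (H₀ × HH) →L[ℂ] H₀ :=
    (ContinuousLinearMap.fst ℂ H₀ HH).comp
      (WithLp.prodContinuousLinearEquiv 2 ℂ H₀ HH : WithLp 2 (H₀ × HH) →L[ℂ] H₀ × HH)
  let ps : WithLp 2 (H₀ × HH) →L[ℂ] HH :=
    (ContinuousLinearMap.snd ℂ H₀ HH).comp
      (WithLp.prodContinuousLinearEquiv 2 ℂ H₀ HH : WithLp 2 (H₀ × HH) →L[ℂ] H₀ × HH)
  -- elimination of the second component: `S₀` and `S₁` are the components of the resolvent, and `Q`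
  -- is the resolvent of `P` at the value of the dispersion function
  let S₀ : WithLp 2 (H₀ × HH) →L[ℂ] H₀ := Q.comp (pf + (B.comp RR).comp ps)
  let S₁ : WithLp 2 (H₀ × HH) →L[ℂ] HH := RR.comp (ps + (D.J D.c).comp S₀)
  let S : WithLp 2 (H₀ × HH) →L[ℂ] WithLp 2 (H₀ × HH) :=
    ((WithLp.prodContinuousLinearEquiv 2 ℂ H₀ HH).symm : H₀ × HH →L[ℂ] WithLp 2 (H₀ × HH)).comp
      (S₀.prod S₁)
  have e₀ : ∀ h, S₀ h = Q (h.fst + B (RR h.snd)) := fun h => rfl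
  have e₁ : ∀ h, S₁ h = RR (h.snd + D.J D.c (S₀ h)) := fun h => rfl
  have eS : ∀ h, S h = WithLp.toLp 2 (S₀ h, S₁ h) := fun h => rfl
  have hB : ∀ f, B (RR (D.J D.c f)) = (inner ℂ D.b (R D.c) : ℂ) • f := fun f => by
    rw [hRRJ, D.adjoint_J]
  simp only [opSpectrum, Set.mem_ofPred_eq, not_not]
  refine ⟨S, (isResolventAt_iff_graph T z S).2 ⟨fun h => (hT _ _).2 ?_, fun F h hFh => ?_⟩⟩
  · refine ⟨_, hQ1 (h.fst + B (RR h.snd)), ?_, ?_⟩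
    · have h1 : B (S₁ h) = B (RR h.snd) + (inner ℂ D.b (R D.c) : ℂ) • S₀ h := by
        rw [e₁, map_add, map_add, hB]
      rw [eS]
      change h.fst + z • S₀ h = _ + D.β • S₀ h - B (S₁ h)
      rw [h1, hR.disp_eq, e₀]
      module
    · have h1 := hRR1 (h.snd + D.J D.c (S₀ h))
      rw [eS]
      change h.snd + z • S₁ h = D.AA (S₁ h) - D.J D.c (S₀ h)
      rw [e₁]
      rw [sub_eq_iff_eq_add] at h1
      rw [h1]
      module
  · obtain ⟨u, hu, h0, h1⟩ := (hT _ _).1 hFh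
    have a1 : RR (h.snd - z • F.snd) = F.snd - RR (D.J D.c F.fst) := by
      rw [h1, sub_right_comm, map_sub, hRR2]
    have a2 : S₀ (h - z • F) = F.fst := by
      rw [e₀, ← hQ2 _ _ hu]
      congr 1
      change (h.fst - z • F.fst) + B (RR (h.snd - z • F.snd)) = _
      rw [a1, map_sub, hB, h0, hR.disp_eq]
      module
    have a3 : S₁ (h - z • F) = F.snd := by
      rw [e₁, a2, map_add]
      change RR (h.snd - z • F.snd) + _ = _
      rw [a1]
      abel
    rw [eS, a2, a3]
    rfl

/-- Off `σ(A)` the block operator has no eigenvalues. -/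
theorem not_isEigenvalue {T : WithLp 2 (H₀ × HH) →ₗ.[ℂ] WithLp 2 (H₀ × HH)}
    (hT : ∀ F h, (F, h) ∈ T.graph ↔ D.Gen F h) {z : ℂ} {R : H →L[ℂ] H} (hR : D.IsRes z R) :
    ¬ IsEigenvalue T z := by
  rw [isEigenvalue_iff_graph]
  rintro ⟨F, hF, hFz⟩
  obtain ⟨RR, -, hRR2, hRRJ⟩ := hR.amplify
  obtain ⟨u, hu, h0, h1⟩ := (hT _ _).1 hFz
  replace h0 : z • F.fst = u + D.β • F.fst - ContinuousLinearMap.adjoint (D.J D.b) F.snd := h0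
  replace h1 : z • F.snd = D.AA F.snd - D.J D.c F.fst := h1
  have h2 : F.snd = D.J (R D.c) F.fst := by
    rw [← hRRJ, ← hRR2 F.snd]
    congr 1
    rw [h1]
    abel
  rw [h2, D.adjoint_J] at h0
  have h3 : u = D.disp z R • F.fst := by
    rw [hR.disp_eq, add_smul, sub_smul, h0]
    abel
  have h4 : F.fst = 0 := D.hP.injective _ _ (h3 ▸ hu)
  rw [h4, map_zero] at h2
  exact hF (WithLp.ofLp_injective 2 (Prod.ext h4 h2))

/-- Essential spectral points on the real axis belong to the continuous spectrum unless they are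
eigenvalues: the block operator is symmetric for the inner product weighted by `κ`. -/
theorem mem_contSpectrum {T : WithLp 2 (H₀ × HH) →ₗ.[ℂ] WithLp 2 (H₀ × HH)}
    (hT : ∀ F h, (F, h) ∈ T.graph ↔ D.Gen F h) {t : ℝ} (ht : (t : ℂ) ∈ essSpectrum T)
    (he : ¬ IsEigenvalue T t) : (t : ℂ) ∈ contSpectrum T := by
  refine mem_contSpectrum_of_orthogonal T _ (essSpectrum_subset_opSpectrum T ht) he fun h hh => ?_
  have hκ : ((D.κ : ℝ) : ℂ) ≠ 0 := Complex.ofReal_ne_zero.2 D.κ_pos.ne'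
  have hJ : ∀ f, D.J D.c f = (D.κ : ℂ) • D.J D.b f := fun f => by
    rw [b, map_smul, _root_.smul_apply, smul_smul, Complex.ofReal_inv, mul_inv_cancel₀ hκ, one_smul]
  have hJ' : ∀ g, ContinuousLinearMap.adjoint (D.J D.b) ((D.κ : ℂ) • g) =
      ContinuousLinearMap.adjoint (D.J D.c) g := fun g => by
    refine ext_inner_right ℂ fun f => ?_
    rw [ContinuousLinearMap.adjoint_inner_left, ContinuousLinearMap.adjoint_inner_left, hJ,
      inner_smul_left, inner_smul_right, Complex.conj_ofReal]
  -- orthogonality to the images of `(0, g)` and of `(f, 0)`: the adjoint eigenvalue equations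
  have h1 : D.AA h.snd - (t : ℂ) • h.snd = D.J D.b h.fst := by
    refine ext_inner_left ℂ fun g => ?_
    have h2 := hh (WithLp.toLp 2 (0, g)) (WithLp.toLp 2
      (0 + D.β • (0 : H₀) - ContinuousLinearMap.adjoint (D.J D.b) g, D.AA g - D.J D.c 0))
      ((hT _ _).2 ⟨0, D.P.zero_mem, rfl, rfl⟩)
    rw [WithLp.prod_inner_apply] at h2
    simp only [WithLp.ofLp_sub, WithLp.ofLp_smul, Prod.fst_sub, Prod.smul_fst, Prod.snd_sub,
      Prod.smul_snd, smul_zero, map_zero, sub_zero, add_zero, zero_sub, inner_neg_left,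
      ContinuousLinearMap.adjoint_inner_left] at h2
    rw [inner_sub_left, D.AA_symm, inner_smul_left, Complex.conj_ofReal] at h2
    rw [inner_sub_right, inner_smul_right]
    exact (neg_add_eq_zero.1 h2).symm
  have h2 : (h.fst, ((t : ℂ) - D.β) • h.fst + ContinuousLinearMap.adjoint (D.J D.c) h.snd)
      ∈ D.P := by
    refine D.hP.maximal _ _ fun f u hfu => ?_
    have h3 := hh (WithLp.toLp 2 (f, 0)) (WithLp.toLp 2
      (u + D.β • f - ContinuousLinearMap.adjoint (D.J D.b) 0, D.AA 0 - D.J D.c f))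
      ((hT _ _).2 ⟨u, hfu, rfl, rfl⟩)
    rw [WithLp.prod_inner_apply] at h3
    simp only [WithLp.ofLp_sub, WithLp.ofLp_smul, Prod.fst_sub, Prod.smul_fst, Prod.snd_sub,
      Prod.smul_snd, smul_zero, map_zero, sub_zero, zero_sub, inner_neg_left, inner_sub_left,
      inner_add_left, inner_smul_left, D.conj_β, Complex.conj_ofReal] at h3
    rw [inner_add_right, inner_smul_right, ContinuousLinearMap.adjoint_inner_right]
    change inner ℂ u h.fst + D.β * inner ℂ f h.fst - (t : ℂ) * inner ℂ f h.fst +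
      -inner ℂ ((D.J D.c) f) h.snd = 0 at h3
    linear_combination h3
  by_contra hne
  -- since `c = κ b`, rescaling the second component by `κ` turns `h` into an eigenvector
  refine he ((isEigenvalue_iff_graph _ _).2 ⟨WithLp.toLp 2 (h.fst, (D.κ : ℂ) • h.snd), ?_,
    (hT _ _).2 ⟨_, h2, ?_, ?_⟩⟩)
  · intro h0
    have h3 := congrArg WithLp.ofLp h0
    have h4 : h.fst = 0 := congrArg Prod.fst h3
    have h5 : (D.κ : ℂ) • h.snd = 0 := congrArg Prod.snd h3
    exact hne (WithLp.ofLp_injective 2 (Prod.ext h4 ((smul_eq_zero.1 h5).resolve_left hκ)))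
  · change (t : ℂ) • h.fst = _ + D.β • h.fst -
      ContinuousLinearMap.adjoint (D.J D.b) ((D.κ : ℂ) • h.snd)
    rw [hJ']
    module
  · change (t : ℂ) • (D.κ : ℂ) • h.snd = D.AA ((D.κ : ℂ) • h.snd) - D.J D.c h.fst
    rw [map_smul, hJ, ← smul_sub, ← h1, smul_comm]
    congr 1
    abel

/-- At points of `[0, r)`, where `r` is a lower bound of `A`, the resolvent of `A` exists and the
dispersion function is real and non-negative. -/
theorem mem_of_lt_lower {r : ℝ} (hr : ∀ u, r * ‖u‖ ≤ ‖D.A u‖) {t : ℝ} (h0 : 0 ≤ t) (htr : t < r) :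
    ∃ R, D.IsRes t R ∧ ∃ s : ℝ, 0 ≤ s ∧ D.disp t R = s := by
  obtain ⟨R, hR⟩ := exists_inverse_of_bounded_below D.A_selfAdjoint (z := (t : ℂ))
    (sub_pos.2 htr) (fun u => by
      have h1 := norm_sub_norm_le (D.A u) ((t : ℂ) • u)
      rw [norm_smul, Complex.norm_real, Real.norm_of_nonneg h0] at h1
      linarith [hr u])
  obtain ⟨s, -, h2, h3⟩ := IsRes.disp_ofReal (D := D) hR
  exact ⟨R, hR, _, mul_nonneg h0 (h3 r htr.le hr (h0.trans htr.le)), h2⟩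

/-- Far to the right of the spectrum of `A`, the dispersion function is real and non-negative:
there `|⟨b, (A - t)⁻¹ e⟩| ≤ ‖b‖ ‖e‖ / (t - ‖A‖) ≤ 1`. -/
theorem mem_of_norm_lt {t : ℝ} (ht : ‖D.A‖ + ‖D.b‖ * ‖D.e‖ + 1 ≤ t) :
    ∃ R, D.IsRes t R ∧ ∃ s : ℝ, 0 ≤ s ∧ D.disp t R = s := by
  have hbe : 0 ≤ ‖D.b‖ * ‖D.e‖ := by positivity
  have h0 : 0 ≤ t := by linarith [norm_nonneg D.A]
  have hpos : 0 < t - ‖D.A‖ := by linarith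
  have hlow : ∀ u, (t - ‖D.A‖) * ‖u‖ ≤ ‖D.A u - (t : ℂ) • u‖ := fun u => by
    have h1 := norm_sub_norm_le ((t : ℂ) • u) (D.A u)
    rw [norm_smul, Complex.norm_real, Real.norm_of_nonneg h0, norm_sub_rev] at h1
    linarith [D.A.le_opNorm u]
  obtain ⟨R, hR⟩ := exists_inverse_of_bounded_below D.A_selfAdjoint (z := (t : ℂ)) hpos hlow
  obtain ⟨s, h1, h2, -⟩ := IsRes.disp_ofReal (D := D) hR
  refine ⟨R, hR, _, mul_nonneg h0 ?_, h2⟩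
  have h3 := hlow (R D.e)
  rw [hR.1] at h3
  have h4 : ‖(inner ℂ D.b (R D.e) : ℂ)‖ ≤ 1 := by
    refine (norm_inner_le_norm _ _).trans ?_
    by_contra hcon
    push Not at hcon
    have h5 : t - ‖D.A‖ < (t - ‖D.A‖) * (‖D.b‖ * ‖R D.e‖) := by nlinarith
    have h6 := mul_le_mul_of_nonneg_left h3 (norm_nonneg D.b)
    linarith
  have h7 := congrArg Complex.re h1
  rw [Complex.add_re, Complex.one_re, Complex.ofReal_re] at h7
  linarith [neg_le_of_abs_le ((Complex.abs_re_le_norm _).trans h4)]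

end BlockData
end Block

/-! ### Bounded operators on `L²` given by formulas almost everywhere -/

section LpMaps

variable {X Y : Type*} [MeasurableSpace X] [MeasurableSpace Y] {μ : Measure X} {ν : Measure Y}

theorem eLpNorm_two_sq (f : X → ℂ) : eLpNorm f 2 μ ^ 2 = ∫⁻ x, ‖f x‖ₑ ^ 2 ∂μ := by
  have h := eLpNorm_nnreal_pow_eq_lintegral (μ := μ) (f := f) (p := 2) two_ne_zero
  simpa using h

theorem memLp_two_of_lintegral {f : X → ℂ} (hf : AEStronglyMeasurable f μ)
    (h : ∫⁻ x, ‖f x‖ₑ ^ 2 ∂μ < ∞) : MemLp f 2 μ := by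
  refine ⟨hf, ?_⟩
  rw [← eLpNorm_two_sq] at h
  by_contra hcon
  rw [not_lt, top_le_iff] at hcon
  rw [hcon] at h
  simp at h

theorem MeasureTheory.MemLp.lintegral_sq_lt_top {f : X → ℂ} (hf : MemLp f 2 μ) :
    ∫⁻ x, ‖f x‖ₑ ^ 2 ∂μ < ∞ := by
  rw [← eLpNorm_two_sq]
  exact ENNReal.pow_lt_top hf.2

theorem eLpNorm_two_le_of_lintegral {f : X → ℂ} {g : Y → ℂ} {C : NNReal}
    (h : ∫⁻ x, ‖f x‖ₑ ^ 2 ∂μ ≤ (C : ℝ≥0∞) ^ 2 * ∫⁻ y, ‖g y‖ₑ ^ 2 ∂ν) :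
    eLpNorm f 2 μ ≤ C * eLpNorm g 2 ν := by
  rw [← eLpNorm_two_sq, ← eLpNorm_two_sq, ← mul_pow] at h
  exact (ENNReal.pow_le_pow_left_iff two_ne_zero).1 h

theorem Lp_norm_sq (u : Lp ℂ 2 μ) : ENNReal.ofReal (‖u‖ ^ 2) = ∫⁻ x, ‖u x‖ₑ ^ 2 ∂μ := by
  rw [← eLpNorm_two_sq, Lp.norm_def, ENNReal.ofReal_pow ENNReal.toReal_nonneg,
    ENNReal.ofReal_toReal (Lp.memLp u).2.ne]

/-- A map on functions that respects almost everywhere equality, is linear on `L²` and bounded in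
`L²` norm induces a bounded operator. -/
theorem exists_clm_of_ae (F : (X → ℂ) → Y → ℂ) (C : NNReal)
    (hcongr : ∀ u u', MemLp u 2 μ → u =ᵐ[μ] u' → F u =ᵐ[ν] F u')
    (hadd : ∀ u u', MemLp u 2 μ → MemLp u' 2 μ → F (u + u') =ᵐ[ν] F u + F u')
    (hsmul : ∀ (c : ℂ) u, MemLp u 2 μ → F (c • u) =ᵐ[ν] c • F u)
    (hmeas : ∀ u, MemLp u 2 μ → AEStronglyMeasurable (F u) ν)
    (hbd : ∀ u, MemLp u 2 μ → eLpNorm (F u) 2 ν ≤ C * eLpNorm u 2 μ) :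
    ∃ T : Lp ℂ 2 μ →L[ℂ] Lp ℂ 2 ν, (∀ u : Lp ℂ 2 μ, T u =ᵐ[ν] F u) ∧ ‖T‖ ≤ C := by
  have hm : ∀ u : Lp ℂ 2 μ, MemLp (F u) 2 ν := fun u =>
    ⟨hmeas u (Lp.memLp u),
      (hbd u (Lp.memLp u)).trans_lt (ENNReal.mul_lt_top (by simp) (Lp.memLp u).2)⟩
  let T₀ : Lp ℂ 2 μ →ₗ[ℂ] Lp ℂ 2 ν :=
    { toFun := fun u => (hm u).toLp
      map_add' := fun u u' => by
        refine Lp.ext ?_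
        filter_upwards [(hm (u + u')).coeFn_toLp, (hm u).coeFn_toLp, (hm u').coeFn_toLp,
          Lp.coeFn_add (hm u).toLp (hm u').toLp, hadd u u' (Lp.memLp u) (Lp.memLp u'),
          hcongr _ _ (Lp.memLp (u + u')) (Lp.coeFn_add u u')] with y h1 h2 h3 h4 h5 h6
        rw [h1, h4, Pi.add_apply, h2, h3, h6, h5, Pi.add_apply]
      map_smul' := fun c u => by
        refine Lp.ext ?_
        filter_upwards [(hm (c • u)).coeFn_toLp, (hm u).coeFn_toLp,
          Lp.coeFn_smul c (hm u).toLp, hsmul c u (Lp.memLp u),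
          hcongr _ _ (Lp.memLp (c • u)) (Lp.coeFn_smul c u)] with y h1 h2 h4 h5 h6
        rw [h1, RingHom.id_apply, h4, Pi.smul_apply, h2, h6, h5, Pi.smul_apply] }
  have hT₀ : ∀ u, ‖T₀ u‖ ≤ C * ‖u‖ := fun u => by
    change ‖(hm u).toLp‖ ≤ _
    rw [Lp.norm_toLp, Lp.norm_def, ← ENNReal.coe_toReal, ← ENNReal.toReal_mul]
    exact ENNReal.toReal_mono (ENNReal.mul_ne_top (by simp) (Lp.memLp u).2.ne)
      (hbd u (Lp.memLp u))
  exact ⟨T₀.mkContinuous C hT₀, fun u => (hm u).coeFn_toLp,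
    LinearMap.mkContinuous_norm_le _ C.2 hT₀⟩

/-- Multiplication by a bounded measurable function. -/
theorem exists_mul_clm {m : X → ℂ} (hm : AEStronglyMeasurable m μ) {C : NNReal}
    (hC : ∀ᵐ x ∂μ, ‖m x‖ ≤ C) :
    ∃ T : Lp ℂ 2 μ →L[ℂ] Lp ℂ 2 μ, ∀ u : Lp ℂ 2 μ, T u =ᵐ[μ] fun x => m x * u x := by
  obtain ⟨T, hT, -⟩ := exists_clm_of_ae (μ := μ) (ν := μ) (fun u x => m x * u x) C
    (fun u u' _ h => by filter_upwards [h] with x hx; rw [hx])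
    (fun u u' _ _ => Eventually.of_forall fun x => by simp [mul_add])
    (fun c u _ => Eventually.of_forall fun x => by simp [mul_left_comm])
    (fun u hu => hm.mul hu.1)
    (fun u hu => by
      have := eLpNorm_le_mul_eLpNorm_of_ae_le_mul (μ := μ) (f := fun x => m x * u x) (g := u)
        (c := C) (by
          filter_upwards [hC] with x hx
          rw [norm_mul]
          gcongr) 2
      simpa using this)
  exact ⟨T, hT⟩

theorem inner_eq_integral_of_ae {u v : Lp ℂ 2 μ} (f : X → ℂ) (hf : ∀ᵐ x ∂μ, v x = f x) :
    inner ℂ u v = ∫ x, starRingEnd ℂ (u x) * f x ∂μ := by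
  rw [L2.inner_def]
  refine integral_congr_ae ?_
  filter_upwards [hf] with x hx
  rw [RCLike.inner_apply, hx, mul_comm]

end LpMaps

/-! ### Schur's test and integral operators -/

section Schur

set_option linter.unusedSectionVars false

variable {X : Type*} [MeasurableSpace X] {μ : Measure X} [IsFiniteMeasure μ]

/-- A non-negative symmetric kernel whose marginals are bounded by `C`. -/
structure IsSchurKernel (k : X → X → ℝ) (μ : Measure X) (C : NNReal) : Prop where
  meas : Measurable (Function.uncurry k)
  nonneg : ∀ x y, 0 ≤ k x y
  symm : ∀ x y, k x y = k y x
  bound : ∀ x, ∫⁻ y, ENNReal.ofReal (k x y) ∂μ ≤ C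

/-- The integral operator with kernel `k`, on functions. -/
def kerInt (k : X → X → ℝ) (μ : Measure X) (u : X → ℂ) (x : X) : ℂ := ∫ y, (k x y : ℂ) * u y ∂μ

namespace IsSchurKernel

variable {k : X → X → ℝ} {C : NNReal}

theorem enorm_mul (hk : IsSchurKernel k μ C) (x y : X) (z : ℂ) :
    ‖(k x y : ℂ) * z‖ₑ = ENNReal.ofReal (k x y) * ‖z‖ₑ := by
  rw [_root_.enorm_mul, ← ofReal_norm (k x y : ℂ),
    Complex.norm_real, Real.norm_of_nonneg (hk.nonneg x y)]

theorem measurable_ofReal (hk : IsSchurKernel k μ C) :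
    Measurable fun p : X × X => ENNReal.ofReal (k p.1 p.2) :=
  ENNReal.measurable_ofReal.comp hk.meas

theorem lintegral_symm (hk : IsSchurKernel k μ C) (y : X) :
    ∫⁻ x, ENNReal.ofReal (k x y) ∂μ ≤ C := by
  simpa only [hk.symm _ y] using hk.bound y

/-- Schur's test: Cauchy–Schwarz for the measure `k x y dy`, and then Tonelli. -/
theorem schur (hk : IsSchurKernel k μ C) {g : X → ℝ≥0∞} (hg : AEMeasurable g μ) :
    ∫⁻ x, (∫⁻ y, ENNReal.ofReal (k x y) * g y ∂μ) ^ 2 ∂μ ≤ (C : ℝ≥0∞) ^ 2 * ∫⁻ y, g y ^ 2 ∂μ := by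
  have h1 : ∀ x, (∫⁻ y, ENNReal.ofReal (k x y) * g y ∂μ) ^ 2 ≤
      C * ∫⁻ y, ENNReal.ofReal (k x y) * g y ^ 2 ∂μ := by
    intro x
    have hkx : AEMeasurable (fun y => ENNReal.ofReal (k x y)) μ :=
      (hk.measurable_ofReal.comp measurable_prodMk_left).aemeasurable
    have h := ENNReal.lintegral_mul_norm_pow_le hkx (hkx.mul (hg.pow_const 2))
      (p := 1 / 2) (q := 1 / 2) (by norm_num) (by norm_num) (by norm_num)
    have e : ∀ y, ENNReal.ofReal (k x y) ^ (1 / 2 : ℝ) *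
        (ENNReal.ofReal (k x y) * g y ^ 2) ^ (1 / 2 : ℝ) = ENNReal.ofReal (k x y) * g y := by
      intro y
      rw [ENNReal.mul_rpow_of_nonneg _ _ (by norm_num), ← mul_assoc,
        ← ENNReal.rpow_add_of_nonneg _ _ (by norm_num) (by norm_num), ← ENNReal.rpow_natCast,
        ← ENNReal.rpow_mul]
      norm_num
    simp only [Pi.mul_apply, e] at h
    calc _ ≤ ((∫⁻ y, ENNReal.ofReal (k x y) ∂μ) ^ (1 / 2 : ℝ) *
          (∫⁻ y, ENNReal.ofReal (k x y) * g y ^ 2 ∂μ) ^ (1 / 2 : ℝ)) ^ 2 := by gcongr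
      _ = (∫⁻ y, ENNReal.ofReal (k x y) ∂μ) * ∫⁻ y, ENNReal.ofReal (k x y) * g y ^ 2 ∂μ := by
          rw [mul_pow, ← ENNReal.rpow_natCast, ← ENNReal.rpow_natCast, ← ENNReal.rpow_mul,
            ← ENNReal.rpow_mul]
          norm_num
      _ ≤ _ := by
          gcongr
          exact hk.bound x
  calc _ ≤ ∫⁻ x, C * ∫⁻ y, ENNReal.ofReal (k x y) * g y ^ 2 ∂μ ∂μ := lintegral_mono h1
    _ = C * ∫⁻ y, ∫⁻ x, ENNReal.ofReal (k x y) * g y ^ 2 ∂μ ∂μ := by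
        rw [lintegral_const_mul' _ _ (by simp), lintegral_lintegral_swap]
        exact hk.measurable_ofReal.aemeasurable.mul (hg.pow_const 2).comp_snd
    _ ≤ C * ∫⁻ y, C * g y ^ 2 ∂μ := by
        gcongr with y
        rw [lintegral_mul_const'' (f := fun x => ENNReal.ofReal (k x y)) _
          (hk.measurable_ofReal.comp measurable_prodMk_right).aemeasurable]
        gcongr
        exact hk.lintegral_symm y
    _ = _ := by rw [lintegral_const_mul' _ _ (by simp), ← mul_assoc, sq]

theorem ae_integrable (hk : IsSchurKernel k μ C) {u : X → ℂ} (hu : MemLp u 2 μ) :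
    ∀ᵐ x ∂μ, Integrable (fun y => (k x y : ℂ) * u y) μ := by
  have hme : AEMeasurable (fun x => (∫⁻ y, ENNReal.ofReal (k x y) * ‖u y‖ₑ ∂μ) ^ 2) μ :=
    (AEMeasurable.lintegral_prod_right'
      (f := fun p : X × X => ENNReal.ofReal (k p.1 p.2) * ‖u p.2‖ₑ)
      (hk.measurable_ofReal.aemeasurable.mul hu.1.enorm.comp_snd)).pow_const 2
  have h := ae_lt_top' hme (((hk.schur hu.1.enorm).trans_lt
    (ENNReal.mul_lt_top (by simp) hu.lintegral_sq_lt_top)).ne)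
  filter_upwards [h] with x hx
  refine ⟨((Complex.measurable_ofReal.comp
    (hk.meas.comp measurable_prodMk_left)).aestronglyMeasurable).mul hu.1, ?_⟩
  rw [HasFiniteIntegral]
  simp only [hk.enorm_mul]
  by_contra hcon
  rw [not_lt, top_le_iff] at hcon
  simp [hcon] at hx

theorem lintegral_kerInt_le (hk : IsSchurKernel k μ C) {u : X → ℂ} (hu : AEStronglyMeasurable u μ) :
    ∫⁻ x, ‖kerInt k μ u x‖ₑ ^ 2 ∂μ ≤ (C : ℝ≥0∞) ^ 2 * ∫⁻ y, ‖u y‖ₑ ^ 2 ∂μ := by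
  refine (lintegral_mono fun x => ?_).trans (hk.schur hu.enorm)
  gcongr
  refine (enorm_integral_le_lintegral_enorm _).trans (le_of_eq ?_)
  simp only [hk.enorm_mul]

theorem measurable_ofReal_complex (hk : IsSchurKernel k μ C) :
    Measurable fun p : X × X => (k p.1 p.2 : ℂ) := Complex.measurable_ofReal.comp hk.meas

theorem aestronglyMeasurable_kerInt (hk : IsSchurKernel k μ C) {u : X → ℂ}
    (hu : AEStronglyMeasurable u μ) : AEStronglyMeasurable (kerInt k μ u) μ :=
  AEStronglyMeasurable.integral_prod_right' (f := fun p : X × X => (k p.1 p.2 : ℂ) * u p.2)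
    (hk.measurable_ofReal_complex.aestronglyMeasurable.mul hu.comp_snd)

theorem memLp_kerInt (hk : IsSchurKernel k μ C) {u : X → ℂ} (hu : MemLp u 2 μ) :
    MemLp (kerInt k μ u) 2 μ :=
  memLp_two_of_lintegral (hk.aestronglyMeasurable_kerInt hu.1)
    ((hk.lintegral_kerInt_le hu.1).trans_lt
      (ENNReal.mul_lt_top (by simp) hu.lintegral_sq_lt_top))

theorem _root_.kerInt_congr {u u' : X → ℂ} (h : u =ᵐ[μ] u') : kerInt k μ u = kerInt k μ u' := by
  funext x
  refine integral_congr_ae ?_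
  filter_upwards [h] with y hy
  rw [hy]

/-- The bounded operator on `L²` with kernel `k`. -/
theorem exists_clm (hk : IsSchurKernel k μ C) : ∃ K : Lp ℂ 2 μ →L[ℂ] Lp ℂ 2 μ,
    (∀ u : Lp ℂ 2 μ, K u =ᵐ[μ] kerInt k μ u) ∧ ‖K‖ ≤ C :=
  exists_clm_of_ae (kerInt k μ) C
    (fun u u' _ h => by rw [kerInt_congr h])
    (fun u u' hu hu' => by
      filter_upwards [hk.ae_integrable hu, hk.ae_integrable hu'] with x h1 h2
      rw [Pi.add_apply, kerInt, kerInt, kerInt, ← integral_add h1 h2]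
      simp only [Pi.add_apply, mul_add])
    (fun c u hu => Eventually.of_forall fun x => by
      rw [Pi.smul_apply, kerInt, kerInt, smul_eq_mul, ← integral_const_mul]
      simp only [Pi.smul_apply, smul_eq_mul, mul_left_comm])
    (fun u hu => hk.aestronglyMeasurable_kerInt hu.1)
    (fun u hu => eLpNorm_two_le_of_lintegral (hk.lintegral_kerInt_le hu.1))

/-- The double integrand of the quadratic form is integrable. -/
theorem integrable_form (hk : IsSchurKernel k μ C) {u v : X → ℂ} (hu : MemLp u 2 μ)
    (hv : MemLp v 2 μ) :
    Integrable (fun p : X × X => (k p.1 p.2 : ℂ) * (u p.2 * v p.1)) (μ.prod μ) := by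
  refine ⟨hk.measurable_ofReal_complex.aestronglyMeasurable.mul
    (hu.1.comp_snd.mul hv.1.comp_fst), ?_⟩
  rw [HasFiniteIntegral]
  have hme : AEMeasurable (fun p : X × X => ENNReal.ofReal (k p.1 p.2) * ‖u p.2‖ₑ) (μ.prod μ) :=
    hk.measurable_ofReal.aemeasurable.mul hu.1.enorm.comp_snd
  have e : ∀ p : X × X, ‖(k p.1 p.2 : ℂ) * (u p.2 * v p.1)‖ₑ =
      (ENNReal.ofReal (k p.1 p.2) * ‖u p.2‖ₑ) * ‖v p.1‖ₑ := fun p => by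
    rw [hk.enorm_mul, _root_.enorm_mul, mul_assoc]
  simp only [e]
  rw [lintegral_prod (fun p : X × X => ENNReal.ofReal (k p.1 p.2) * ‖u p.2‖ₑ * ‖v p.1‖ₑ)
    (hme.mul hv.1.enorm.comp_fst)]
  have hle : ∀ a b : ℝ≥0∞, a * b ≤ a ^ 2 + b ^ 2 := fun a b => by
    rcases le_total a b with h | h
    · calc a * b ≤ b * b := by gcongr
        _ = b ^ 2 := (sq b).symm
        _ ≤ _ := le_add_self
    · calc a * b ≤ a * a := by gcongr
        _ = a ^ 2 := (sq a).symm
        _ ≤ _ := le_self_add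
  calc ∫⁻ x, ∫⁻ y, ENNReal.ofReal (k x y) * ‖u y‖ₑ * ‖v x‖ₑ ∂μ ∂μ
      ≤ ∫⁻ x, ((∫⁻ y, ENNReal.ofReal (k x y) * ‖u y‖ₑ ∂μ) ^ 2 + ‖v x‖ₑ ^ 2) ∂μ := by
        refine lintegral_mono fun x => ?_
        rw [lintegral_mul_const' _ _ (by simp)]
        exact hle _ _
    _ = ∫⁻ x, (∫⁻ y, ENNReal.ofReal (k x y) * ‖u y‖ₑ ∂μ) ^ 2 ∂μ + ∫⁻ x, ‖v x‖ₑ ^ 2 ∂μ :=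
        lintegral_add_right' _ (hv.1.enorm.pow_const 2)
    _ < ∞ := ENNReal.add_lt_top.2 ⟨(hk.schur hu.1.enorm).trans_lt
        (ENNReal.mul_lt_top (by simp) hu.lintegral_sq_lt_top), hv.lintegral_sq_lt_top⟩

/-- Symmetry of the integral operator for the bilinear pairing, by Fubini. -/
theorem integral_kerInt_symm (hk : IsSchurKernel k μ C) {u v : X → ℂ} (hu : MemLp u 2 μ)
    (hv : MemLp v 2 μ) : ∫ x, kerInt k μ u x * v x ∂μ = ∫ x, u x * kerInt k μ v x ∂μ := by
  have h := integral_integral_swap (f := fun x y => (k x y : ℂ) * (u y * v x))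
    (hk.integrable_form hu hv)
  calc _ = ∫ x, ∫ y, (k x y : ℂ) * (u y * v x) ∂μ ∂μ := by
        refine integral_congr_ae (Eventually.of_forall fun x => ?_)
        simp only [kerInt]
        rw [← integral_mul_const]
        simp only [mul_assoc]
    _ = _ := by
        rw [h]
        refine integral_congr_ae (Eventually.of_forall fun y => ?_)
        simp only [kerInt]
        rw [← integral_const_mul]
        refine integral_congr_ae (Eventually.of_forall fun x => ?_)
        simp only [hk.symm x y]
        ring

theorem conj_kerInt (u : X → ℂ) (x : X) :
    starRingEnd ℂ (kerInt k μ u x) = kerInt k μ (fun y => starRingEnd ℂ (u y)) x := by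
  simp only [kerInt]
  rw [← integral_conj]
  simp

end IsSchurKernel

end Schur

/-! ### Operators `V - K` with a potential and an integral kernel -/

section Potential

set_option linter.unusedSectionVars false

variable {X : Type*} [MeasurableSpace X] {μ : Measure X} [IsFiniteMeasure μ]

variable {k : X → X → ℝ} {C : NNReal} {V : X → ℝ} {A : Lp ℂ 2 μ →L[ℂ] Lp ℂ 2 μ}

/-- `A` is the operator `V - K`, where `V` acts by multiplication and `K` has kernel `k`. -/
def IsPotentialSub (V : X → ℝ) (k : X → X → ℝ) (A : Lp ℂ 2 μ →L[ℂ] Lp ℂ 2 μ) : Prop :=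
  ∀ u : Lp ℂ 2 μ, A u =ᵐ[μ] fun x => (V x : ℂ) * u x - kerInt k μ u x

theorem memLp_bounded_mul {V : X → ℝ} (hV : Measurable V) {B : ℝ} (hB : ∀ x, |V x| ≤ B)
    {u : X → ℂ} (hu : MemLp u 2 μ) : MemLp (fun x => (V x : ℂ) * u x) 2 μ := by
  refine MemLp.of_le_mul (c := B) hu
    ((Complex.measurable_ofReal.comp hV).aestronglyMeasurable.mul hu.1)
    (Eventually.of_forall fun x => ?_)
  rw [norm_mul, Complex.norm_real]
  gcongr
  exact hB x

theorem memLp_conj {u : X → ℂ} (hu : MemLp u 2 μ) : MemLp (fun x => starRingEnd ℂ (u x)) 2 μ :=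
  hu.star

theorem integrable_mul_of_memLp {u v : X → ℂ} (hu : MemLp u 2 μ) (hv : MemLp v 2 μ) :
    Integrable (fun x => u x * v x) μ := hu.integrable_mul hv

theorem exists_isPotentialSub (hk : IsSchurKernel k μ C) (hV : Measurable V) {B : ℝ}
    (hB : ∀ x, |V x| ≤ B) : ∃ A : Lp ℂ 2 μ →L[ℂ] Lp ℂ 2 μ, IsPotentialSub V k A := by
  obtain ⟨M, hM⟩ := exists_mul_clm (μ := μ) (m := fun x => (V x : ℂ)) (C := B.toNNReal)
    (Complex.measurable_ofReal.comp hV).aestronglyMeasurable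
    (Eventually.of_forall fun x => by
      rw [Complex.norm_real]
      exact (hB x).trans (Real.le_coe_toNNReal B))
  obtain ⟨K, hK, -⟩ := hk.exists_clm
  refine ⟨M - K, fun u => ?_⟩
  filter_upwards [Lp.coeFn_sub (M u) (K u), hM u, hK u] with x h1 h2 h3
  rw [_root_.sub_apply, h1, Pi.sub_apply, h2, h3]

theorem IsPotentialSub.isSelfAdjoint (hA : IsPotentialSub V k A) (hk : IsSchurKernel k μ C)
    (hV : Measurable V) {B : ℝ} (hB : ∀ x, |V x| ≤ B) : IsSelfAdjoint A := by
  rw [ContinuousLinearMap.isSelfAdjoint_iff_isSymmetric]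
  intro u v
  have hu := Lp.memLp u
  have hv := Lp.memLp v
  have hu' := memLp_conj hu
  change inner ℂ (A u) v = inner ℂ u (A v)
  rw [← inner_conj_symm, inner_eq_integral_of_ae _ (hA u), inner_eq_integral_of_ae _ (hA v),
    ← integral_conj]
  simp only [map_mul, map_sub, Complex.conj_conj, Complex.conj_ofReal,
    IsSchurKernel.conj_kerInt, mul_sub]
  rw [integral_sub (integrable_mul_of_memLp hv (memLp_bounded_mul hV hB hu'))
      (integrable_mul_of_memLp hv (hk.memLp_kerInt hu')),
    integral_sub (integrable_mul_of_memLp hu' (memLp_bounded_mul hV hB hv))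
      (integrable_mul_of_memLp hu' (hk.memLp_kerInt hv)), hk.integral_kerInt_symm hv hu' |>.symm]
  congr 1
  · refine integral_congr_ae (Eventually.of_forall fun x => ?_)
    simp only
    ring
  · rw [hk.integral_kerInt_symm hv hu', ← hk.integral_kerInt_symm hu' hv]
    refine integral_congr_ae (Eventually.of_forall fun x => ?_)
    simp only
    ring

/-- The total mass of the kernel at `x`. -/
def kerMass (k : X → X → ℝ) (μ : Measure X) (x : X) : ℝ := ∫ y, k x y ∂μ

theorem IsSchurKernel.integrable (hk : IsSchurKernel k μ C) (x : X) :
    Integrable (fun y => k x y) μ := by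
  refine ⟨(hk.meas.comp measurable_prodMk_left).aestronglyMeasurable, ?_⟩
  rw [hasFiniteIntegral_iff_ofReal (Eventually.of_forall (hk.nonneg x))]
  exact (hk.bound x).trans_lt (by simp)

theorem IsSchurKernel.measurable_kerMass (hk : IsSchurKernel k μ C) :
    Measurable (kerMass k μ) :=
  (hk.meas.stronglyMeasurable.integral_prod_right (ν := μ)).measurable

theorem IsSchurKernel.kerMass_nonneg (hk : IsSchurKernel k μ C) (x : X) : 0 ≤ kerMass k μ x :=
  integral_nonneg (hk.nonneg x)

theorem IsSchurKernel.kerMass_le (hk : IsSchurKernel k μ C) (x : X) : kerMass k μ x ≤ C := by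
  rw [kerMass, integral_eq_lintegral_of_nonneg_ae (Eventually.of_forall (hk.nonneg x))
    (hk.meas.comp measurable_prodMk_left).aestronglyMeasurable]
  exact ENNReal.toReal_le_coe_of_le_coe (hk.bound x)

theorem integrable_norm_sq {u : X → ℂ} (hu : MemLp u 2 μ) : Integrable (fun x => ‖u x‖ ^ 2) μ :=
  (memLp_two_iff_integrable_sq_norm hu.1).1 hu

theorem IsSchurKernel.integrable_sq_fst (hk : IsSchurKernel k μ C) {u : X → ℂ}
    (hu : MemLp u 2 μ) : Integrable (fun p : X × X => k p.1 p.2 * ‖u p.1‖ ^ 2) (μ.prod μ) := by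
  have hm : AEStronglyMeasurable (fun p : X × X => k p.1 p.2 * ‖u p.1‖ ^ 2) (μ.prod μ) :=
    hk.meas.aestronglyMeasurable.mul (hu.1.norm.comp_fst.pow 2)
  rw [integrable_prod_iff hm]
  refine ⟨Eventually.of_forall fun x => (hk.integrable x).mul_const (‖u x‖ ^ 2), ?_⟩
  have e : ∀ x, ∫ y, ‖k x y * ‖u x‖ ^ 2‖ ∂μ = kerMass k μ x * ‖u x‖ ^ 2 := fun x => by
    rw [kerMass, ← integral_mul_const]
    refine integral_congr_ae (Eventually.of_forall fun y => ?_)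
    exact Real.norm_of_nonneg (mul_nonneg (hk.nonneg x y) (by positivity))
  simp only [e]
  refine ((integrable_norm_sq hu).const_mul (C : ℝ)).mono'
    (hk.measurable_kerMass.aestronglyMeasurable.mul (hu.1.norm.pow 2))
    (Eventually.of_forall fun x => ?_)
  rw [Real.norm_of_nonneg (mul_nonneg (hk.kerMass_nonneg x) (by positivity))]
  gcongr
  exact hk.kerMass_le x

theorem IsSchurKernel.integrable_sq_snd (hk : IsSchurKernel k μ C) {u : X → ℂ}
    (hu : MemLp u 2 μ) : Integrable (fun p : X × X => k p.1 p.2 * ‖u p.2‖ ^ 2) (μ.prod μ) := by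
  have h := (hk.integrable_sq_fst hu).swap
  refine h.congr (Eventually.of_forall fun p => ?_)
  simp [hk.symm p.2 p.1]

theorem norm_sub_sq_complex (z w : ℂ) :
    ‖z - w‖ ^ 2 = ‖z‖ ^ 2 + ‖w‖ ^ 2 - 2 * (w * starRingEnd ℂ z).re := by
  rw [← Complex.normSq_eq_norm_sq, ← Complex.normSq_eq_norm_sq, ← Complex.normSq_eq_norm_sq]
  simp only [Complex.normSq_apply, Complex.sub_re, Complex.sub_im, Complex.mul_re, Complex.conj_re,
    Complex.conj_im]
  ring

theorem IsSchurKernel.integrable_energy (hk : IsSchurKernel k μ C) {u : X → ℂ}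
    (hu : MemLp u 2 μ) :
    Integrable (fun p : X × X => k p.1 p.2 * ‖u p.1 - u p.2‖ ^ 2) (μ.prod μ) := by
  have h3 := (hk.integrable_form hu (memLp_conj hu)).re.const_mul 2
  refine (((hk.integrable_sq_fst hu).add (hk.integrable_sq_snd hu)).sub h3).congr
    (Eventually.of_forall fun p => ?_)
  simp only [Pi.sub_apply, Pi.add_apply, norm_sub_sq_complex, RCLike.re_eq_complex_re,
    Complex.re_ofReal_mul]
  ring

/-- The quadratic form of `V - K` is the sum of the jump energy of the kernel and of a potential
term with the excess of `V` over the mass of the kernel. -/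
theorem IsPotentialSub.form (hA : IsPotentialSub V k A) (hk : IsSchurKernel k μ C)
    (hV : Measurable V) {B : ℝ} (hB : ∀ x, |V x| ≤ B) (u : Lp ℂ 2 μ) :
    (inner ℂ u (A u)).re = 2⁻¹ * ∫ p, k p.1 p.2 * ‖u p.1 - u p.2‖ ^ 2 ∂(μ.prod μ)
      + ∫ x, (V x - kerMass k μ x) * ‖u x‖ ^ 2 ∂μ := by
  have hu := Lp.memLp u
  have hu' := memLp_conj hu
  have hform := hk.integrable_form hu hu'
  have i1 : Integrable (fun x => V x * ‖u x‖ ^ 2) μ := by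
    refine ((integrable_norm_sq hu).const_mul B).mono'
      (hV.aestronglyMeasurable.mul (hu.1.norm.pow 2)) (Eventually.of_forall fun x => ?_)
    rw [norm_mul, Real.norm_of_nonneg (by positivity : 0 ≤ ‖u x‖ ^ 2)]
    gcongr
    exact hB x
  have i2 : Integrable (fun x => kerMass k μ x * ‖u x‖ ^ 2) μ := by
    have h := (hk.integrable_sq_fst hu).integral_prod_left
    refine h.congr (Eventually.of_forall fun x => ?_)
    simp only [kerMass, integral_mul_const]
  have e1 : ∫ p, k p.1 p.2 * ‖u p.1‖ ^ 2 ∂(μ.prod μ) = ∫ x, kerMass k μ x * ‖u x‖ ^ 2 ∂μ := by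
    rw [integral_prod _ (hk.integrable_sq_fst hu)]
    simp only [kerMass, integral_mul_const]
  have e2 : ∫ p, k p.1 p.2 * ‖u p.2‖ ^ 2 ∂(μ.prod μ) = ∫ x, kerMass k μ x * ‖u x‖ ^ 2 ∂μ := by
    rw [← e1, ← integral_prod_swap]
    refine integral_congr_ae (Eventually.of_forall fun p => ?_)
    simp [hk.symm p.2 p.1]
  have e3 : ∫ p, ((k p.1 p.2 : ℂ) * (u p.2 * starRingEnd ℂ (u p.1))).re ∂(μ.prod μ)
      = (∫ x, kerInt k μ u x * starRingEnd ℂ (u x) ∂μ).re := by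
    have h1 := integral_re (𝕜 := ℂ) hform
    simp only [RCLike.re_eq_complex_re] at h1
    rw [h1, integral_prod _ hform]
    congr 2
    funext x
    rw [kerInt, ← integral_mul_const]
    simp only [mul_assoc]
  have e4 : ∫ p, k p.1 p.2 * ‖u p.1 - u p.2‖ ^ 2 ∂(μ.prod μ) =
      2 * ∫ x, kerMass k μ x * ‖u x‖ ^ 2 ∂μ
        - 2 * (∫ x, kerInt k μ u x * starRingEnd ℂ (u x) ∂μ).re := by
    have h3 : Integrable (fun p : X × X =>
        2 * ((k p.1 p.2 : ℂ) * (u p.2 * starRingEnd ℂ (u p.1))).re) (μ.prod μ) :=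
      hform.re.const_mul 2
    have h4 := integral_sub ((hk.integrable_sq_fst hu).add (hk.integrable_sq_snd hu)) h3
    have h5 := integral_add (hk.integrable_sq_fst hu) (hk.integrable_sq_snd hu)
    simp only [Pi.add_apply] at h4
    rw [h5, e1, e2, integral_const_mul, e3] at h4
    rw [two_mul, ← h4]
    refine integral_congr_ae (Eventually.of_forall fun p => ?_)
    simp only [norm_sub_sq_complex, Complex.re_ofReal_mul]
    ring
  have e5 : (inner ℂ u (A u)).re = ∫ x, V x * ‖u x‖ ^ 2 ∂μ
      - (∫ x, kerInt k μ u x * starRingEnd ℂ (u x) ∂μ).re := by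
    rw [inner_eq_integral_of_ae _ (hA u)]
    simp only [mul_sub]
    rw [integral_sub (integrable_mul_of_memLp hu' (memLp_bounded_mul hV hB hu))
      (integrable_mul_of_memLp hu' (hk.memLp_kerInt hu)), Complex.sub_re]
    congr 1
    · rw [← Complex.ofReal_re (∫ x, V x * ‖u x‖ ^ 2 ∂μ), ← integral_complex_ofReal]
      congr 2
      funext x
      push_cast
      rw [← Complex.conj_mul']
      ring
    · simp only [mul_comm]
  rw [e5, e4]
  simp only [sub_mul]
  rw [integral_sub i1 i2]
  ring

theorem IsPotentialSub.form_nonneg (hA : IsPotentialSub V k A) (hk : IsSchurKernel k μ C)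
    (hV : Measurable V) {B : ℝ} (hB : ∀ x, |V x| ≤ B) (hm : ∀ᵐ x ∂μ, kerMass k μ x ≤ V x)
    (u : Lp ℂ 2 μ) : 0 ≤ (inner ℂ u (A u)).re := by
  rw [hA.form hk hV hB]
  have h1 : 0 ≤ ∫ p, k p.1 p.2 * ‖u p.1 - u p.2‖ ^ 2 ∂(μ.prod μ) :=
    integral_nonneg fun p => mul_nonneg (hk.nonneg _ _) (by positivity)
  have h2 : 0 ≤ ∫ x, (V x - kerMass k μ x) * ‖u x‖ ^ 2 ∂μ :=
    integral_nonneg_of_ae (by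
      filter_upwards [hm] with x hx
      exact mul_nonneg (sub_nonneg.2 hx) (by positivity))
  positivity

/-- Elements of the kernel of `V - K` are constant along jumps and vanish where `V` exceeds the
mass of the kernel. -/
theorem IsPotentialSub.of_apply_eq_zero (hA : IsPotentialSub V k A) (hk : IsSchurKernel k μ C)
    (hV : Measurable V) {B : ℝ} (hB : ∀ x, |V x| ≤ B) (hm : ∀ᵐ x ∂μ, kerMass k μ x ≤ V x)
    {u : Lp ℂ 2 μ} (hu : A u = 0) :
    (∀ᵐ p ∂(μ.prod μ), k p.1 p.2 = 0 ∨ u p.1 = u p.2) ∧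
      ∀ᵐ x ∂μ, V x = kerMass k μ x ∨ u x = 0 := by
  have hf := hA.form hk hV hB u
  rw [hu, inner_zero_right, Complex.zero_re] at hf
  have n1 : ∀ p : X × X, 0 ≤ k p.1 p.2 * ‖u p.1 - u p.2‖ ^ 2 :=
    fun p => mul_nonneg (hk.nonneg _ _) (by positivity)
  have n2 : ∀ᵐ x ∂μ, 0 ≤ (V x - kerMass k μ x) * ‖u x‖ ^ 2 := by
    filter_upwards [hm] with x hx
    exact mul_nonneg (sub_nonneg.2 hx) (by positivity)
  have h1 : 0 ≤ ∫ p, k p.1 p.2 * ‖u p.1 - u p.2‖ ^ 2 ∂(μ.prod μ) := integral_nonneg n1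
  have h2 : 0 ≤ ∫ x, (V x - kerMass k μ x) * ‖u x‖ ^ 2 ∂μ := integral_nonneg_of_ae n2
  have hu2 := Lp.memLp u
  constructor
  · have z : ∫ p, k p.1 p.2 * ‖u p.1 - u p.2‖ ^ 2 ∂(μ.prod μ) = 0 := by linarith
    rw [integral_eq_zero_iff_of_nonneg n1 (hk.integrable_energy hu2)] at z
    filter_upwards [z] with p hp
    simpa [sub_eq_zero] using hp
  · have z : ∫ x, (V x - kerMass k μ x) * ‖u x‖ ^ 2 ∂μ = 0 := by linarith
    have hi : Integrable (fun x => (V x - kerMass k μ x) * ‖u x‖ ^ 2) μ := by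
      refine ((integrable_norm_sq hu2).const_mul (B + C)).mono'
        ((hV.sub hk.measurable_kerMass).aestronglyMeasurable.mul (hu2.1.norm.pow 2))
        (Eventually.of_forall fun x => ?_)
      rw [norm_mul, Real.norm_of_nonneg (by positivity : 0 ≤ ‖u x‖ ^ 2)]
      gcongr
      refine (norm_sub_le _ _).trans (add_le_add (hB x) ?_)
      rw [Real.norm_of_nonneg (hk.kerMass_nonneg x)]
      exact hk.kerMass_le x
    rw [integral_eq_zero_iff_of_nonneg_ae n2 hi] at z
    filter_upwards [z] with x hx
    simpa [sub_eq_zero] using hx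

end Potential

/-! ### Compactness of integral operators and the Fredholm alternative -/

section Compact

set_option linter.unusedSectionVars false

variable {X : Type*} [MeasurableSpace X] {μ : Measure X} [IsFiniteMeasure μ]

theorem isCompactOperator_rankOne {H H' : Type*} [NormedAddCommGroup H] [InnerProductSpace ℂ H]
    [NormedAddCommGroup H'] [InnerProductSpace ℂ H'] (v : H) (w : H') :
    IsCompactOperator ((innerSL ℂ v).smulRight w : H →L[ℂ] H') := by
  have h1 : IsCompactOperator (ContinuousLinearMap.toSpanSingleton ℂ w : ℂ →L[ℂ] H') :=
    isCompactOperator_of_locallyCompactSpace_rng _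
  exact h1.comp_clm (innerSL ℂ v)

theorem isCompactOperator_sum {ι H H' : Type*} [NormedAddCommGroup H] [InnerProductSpace ℂ H]
    [NormedAddCommGroup H'] [InnerProductSpace ℂ H'] (s : Finset ι) (T : ι → H →L[ℂ] H')
    (hT : ∀ i ∈ s, IsCompactOperator (T i)) : IsCompactOperator (∑ i ∈ s, T i : H →L[ℂ] H') := by
  classical
  induction s using Finset.induction_on with
  | empty => simpa using isCompactOperator_zero
  | insert i s hi ih =>
    rw [Finset.sum_insert hi]
    exact (hT i (by simp)).add (ih fun j hj => hT j (by simp [hj]))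

variable {k : X → X → ℝ} {C : NNReal}

/-- Integral operators with bounded kernels on a finite measure space are compact, as limits of
their compositions with the finite-dimensional projections of a Hilbert basis. -/
theorem IsSchurKernel.isCompactOperator_of_le [IsSeparable μ] (hk : IsSchurKernel k μ C) {N : ℝ}
    (hN : ∀ x y, k x y ≤ N) {K : Lp ℂ 2 μ →L[ℂ] Lp ℂ 2 μ}
    (hK : ∀ u : Lp ℂ 2 μ, K u =ᵐ[μ] kerInt k μ u) : IsCompactOperator K := by
  have : Fact ((2 : ℝ≥0∞) ≠ ∞) := ⟨by norm_num⟩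
  obtain ⟨w, b, hb⟩ := exists_hilbertBasis ℂ (Lp ℂ 2 μ)
  have hbo : Orthonormal ℂ b := b.orthonormal
  -- a Hilbert basis of a separable space is countable: the balls of radius `1/2` around its members
  -- are disjoint; countability is what dominated convergence along finite subsets of it requires
  have hcount : Countable w := by
    have hsep : TopologicalSpace.IsSeparable (Set.univ : Set (Lp ℂ 2 μ)) :=
      TopologicalSpace.isSeparable_univ_iff.2 inferInstance
    refine Set.Countable.to_subtype ?_
    refine Set.PairwiseDisjoint.countable_of_isOpen (s := fun x : Lp ℂ 2 μ => Metric.ball x (1 / 2))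
      (fun x hx y hy hxy => ?_) (fun x _ => Metric.isOpen_ball)
      (fun x _ => ⟨x, Metric.mem_ball_self (by norm_num)⟩)
    have h1 : ‖x - y‖ ^ 2 = 2 := by
      have := hbo.2 (i := ⟨x, hx⟩) (j := ⟨y, hy⟩) (by simpa using hxy)
      simp only [hb] at this
      have n1 := hbo.1 ⟨x, hx⟩
      have n2 := hbo.1 ⟨y, hy⟩
      simp only [hb] at n1 n2
      rw [@norm_sub_sq ℂ, this, n1, n2]
      norm_num
    refine Metric.ball_disjoint_ball ?_
    rw [dist_eq_norm]
    nlinarith [norm_nonneg (x - y)]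
  have hκm : ∀ x, MemLp (fun y => (k x y : ℂ)) 2 μ := fun x =>
    MemLp.of_bound (hk.measurable_ofReal_complex.comp measurable_prodMk_left).aestronglyMeasurable N
      (Eventually.of_forall fun y => by
        rw [Complex.norm_real, Real.norm_of_nonneg (hk.nonneg x y)]
        exact hN x y)
  -- the rows of the kernel, which represent `K` as `K u x = ⟨κ x, u⟩`
  let κ : X → Lp ℂ 2 μ := fun x => (hκm x).toLp
  have hκ : ∀ (x : X) (u : Lp ℂ 2 μ), inner ℂ (κ x) u = kerInt k μ u x := fun x u => by
    rw [L2.inner_def, kerInt]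
    refine integral_congr_ae ?_
    filter_upwards [(hκm x).coeFn_toLp] with y hy
    rw [hy, RCLike.inner_apply, Complex.conj_ofReal, mul_comm]
  let P : Finset w → Lp ℂ 2 μ →L[ℂ] Lp ℂ 2 μ := fun s =>
    ∑ i ∈ s, (innerSL ℂ (b i)).smulRight (b i)
  have hP : ∀ s u, P s u = ∑ i ∈ s, (inner ℂ (b i) u : ℂ) • b i := fun s u => by
    simp [P]
  have hPsymm : ∀ s u v, inner ℂ (P s u) v = inner ℂ u (P s v) := fun s u v => by
    rw [hP, hP, sum_inner, inner_sum]
    refine Finset.sum_congr rfl fun i _ => ?_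
    rw [inner_smul_left, inner_smul_right, inner_conj_symm, mul_comm]
  have hPt : ∀ u, Tendsto (fun s => ‖u - P s u‖ₑ ^ 2) atTop (𝓝 0) := fun u => by
    have h1 : HasSum (fun i => (inner ℂ (b i) u : ℂ) • b i) u := by
      simpa [b.repr_apply_apply] using b.hasSum_repr u
    have h2 : Tendsto (fun s => u - P s u) atTop (𝓝 (u - u)) := by
      simp only [hP]
      exact tendsto_const_nhds.sub h1
    rw [sub_self] at h2
    have h3 := ENNReal.Tendsto.pow (n := 2) h2.enorm
    simpa using h3
  have hPle : ∀ s u, ‖u - P s u‖ ≤ ‖u‖ := fun s u => by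
    have h1 : inner ℂ (P s u) (u - P s u) = (0 : ℂ) := by
      rw [inner_sub_right, hPsymm s u (P s u)]
      have : P s (P s u) = P s u := by
        rw [hP s (P s u), hP s u]
        refine Finset.sum_congr rfl fun i hi => ?_
        rw [hbo.inner_right_sum _ hi]
      rw [this, hPsymm, sub_self]
    have h2 : ‖u‖ ^ 2 = ‖P s u‖ ^ 2 + ‖u - P s u‖ ^ 2 := by
      conv_lhs => rw [← add_sub_cancel (P s u) u]
      rw [@norm_add_sq ℂ, h1]
      simp
    nlinarith [norm_nonneg u, norm_nonneg (u - P s u), sq_nonneg ‖P s u‖]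
  have hκle : ∀ x, ‖κ x‖ₑ ^ 2 ≤ ENNReal.ofReal N ^ 2 * μ Set.univ := fun x => by
    rw [← ofReal_norm, ← ENNReal.ofReal_pow (norm_nonneg _), Lp_norm_sq]
    calc ∫⁻ y, ‖κ x y‖ₑ ^ 2 ∂μ ≤ ∫⁻ _y, ENNReal.ofReal N ^ 2 ∂μ := by
          refine lintegral_mono_ae ?_
          filter_upwards [(hκm x).coeFn_toLp] with y hy
          rw [hy, ← ofReal_norm, Complex.norm_real, Real.norm_of_nonneg (hk.nonneg x y)]
          gcongr
          exact hN x y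
      _ = _ := by rw [lintegral_const]
  have hinner_meas : ∀ u : Lp ℂ 2 μ, AEStronglyMeasurable (fun x => (inner ℂ (κ x) u : ℂ)) μ :=
    fun u => by
      simp only [hκ]
      exact hk.aestronglyMeasurable_kerInt (Lp.memLp u).1
  -- `κ` is not known to be measurable as a map into `L²`, but `‖κ x - P s (κ x)‖²` is a combination
  -- of integrals that are measurable in `x`
  have hρm : ∀ s, AEMeasurable (fun x => ‖κ x - P s (κ x)‖ₑ ^ 2) μ := fun s => by
    have e : ∀ x, ‖κ x - P s (κ x)‖ₑ ^ 2 = ENNReal.ofReal ((∫ y, k x y ^ 2 ∂μ)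
        - ∑ i ∈ s, ‖(inner ℂ (κ x) (b i) : ℂ)‖ ^ 2) := fun x => by
      rw [← ofReal_norm, ← ENNReal.ofReal_pow (norm_nonneg _)]
      congr 1
      have h1 : inner ℂ (κ x) (P s (κ x)) =
          ((∑ i ∈ s, ‖(inner ℂ (κ x) (b i) : ℂ)‖ ^ 2 : ℝ) : ℂ) := by
        rw [hP, inner_sum, Complex.ofReal_sum]
        refine Finset.sum_congr rfl fun i _ => ?_
        rw [inner_smul_right, ← inner_conj_symm (b i) (κ x), Complex.conj_mul']
        push_cast
        rfl
      have h2 : ‖P s (κ x)‖ ^ 2 = ∑ i ∈ s, ‖(inner ℂ (κ x) (b i) : ℂ)‖ ^ 2 := by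
        have : P s (P s (κ x)) = P s (κ x) := by
          rw [hP s (P s (κ x)), hP s (κ x)]
          refine Finset.sum_congr rfl fun i hi => ?_
          rw [hbo.inner_right_sum _ hi]
        have h3 : inner ℂ (P s (κ x)) (P s (κ x)) = inner ℂ (κ x) (P s (κ x)) := by
          rw [hPsymm, this]
        have h4 := congrArg RCLike.re h3
        rw [inner_self_eq_norm_sq, h1, RCLike.re_eq_complex_re, Complex.ofReal_re] at h4
        exact h4
      have h4 : ‖κ x‖ ^ 2 = ∫ y, k x y ^ 2 ∂μ := by
        have h5 : inner ℂ (κ x) (κ x) = ((∫ y, k x y ^ 2 ∂μ : ℝ) : ℂ) := by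
          rw [hκ, kerInt, ← integral_complex_ofReal]
          refine integral_congr_ae ?_
          filter_upwards [(hκm x).coeFn_toLp] with y hy
          rw [hy]
          push_cast
          ring
        have h6 := congrArg RCLike.re h5
        rw [inner_self_eq_norm_sq, RCLike.re_eq_complex_re, Complex.ofReal_re] at h6
        exact h6
      rw [@norm_sub_sq ℂ, h1, h2, h4]
      simp only [RCLike.re_eq_complex_re, Complex.ofReal_re]
      ring
    simp only [e]
    refine ENNReal.measurable_ofReal.comp_aemeasurable (AEMeasurable.sub ?_ ?_)
    · exact ((hk.meas.pow_const 2).stronglyMeasurable.integral_prod_right'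
        (ν := μ)).measurable.aemeasurable
    · exact Finset.aemeasurable_fun_sum _ fun i _ => ((hinner_meas (b i)).norm.pow 2).aemeasurable
  have hρt : Tendsto (fun s => ∫⁻ x, ‖κ x - P s (κ x)‖ₑ ^ 2 ∂μ) atTop (𝓝 0) := by
    have h := tendsto_lintegral_filter_of_dominated_convergence' (μ := μ) (l := atTop)
      (F := fun s x => ‖κ x - P s (κ x)‖ₑ ^ 2) (f := fun _ => 0)
      (fun _ => ENNReal.ofReal N ^ 2 * μ Set.univ)
      (Eventually.of_forall hρm)
      (Eventually.of_forall fun s => Eventually.of_forall fun x => by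
        refine le_trans ?_ (hκle x)
        gcongr
        rw [← ofReal_norm, ← ofReal_norm]
        exact ENNReal.ofReal_le_ofReal (hPle s (κ x)))
      (by
        rw [lintegral_const]
        exact ENNReal.mul_ne_top (ENNReal.mul_ne_top (by simp) (measure_ne_top _ _))
          (measure_ne_top _ _))
      (Eventually.of_forall fun x => hPt (κ x))
    simpa using h
  -- the Hilbert–Schmidt norm of `K - K P s`, the square root of the last integral, bounds its norm
  refine isCompactOperator_of_tendsto (l := (atTop : Filter (Finset w)))
    (F := fun s => K.comp (P s)) (f := K) ?_ (Eventually.of_forall fun s => ?_)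
  · rw [tendsto_iff_norm_sub_tendsto_zero]
    have h1 : Tendsto (fun s => ((∫⁻ x, ‖κ x - P s (κ x)‖ₑ ^ 2 ∂μ).toReal).sqrt) atTop (𝓝 0) := by
      have := ((ENNReal.tendsto_toReal ENNReal.zero_ne_top).comp hρt).sqrt
      simpa using this
    have hfin : ∀ s, ∫⁻ x, ‖κ x - P s (κ x)‖ₑ ^ 2 ∂μ ≠ ∞ := fun s => by
      refine ((lintegral_mono (g := fun _ => ENNReal.ofReal N ^ 2 * μ Set.univ)
        fun x => ?_).trans_lt ?_).ne
      · refine le_trans ?_ (hκle x)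
        gcongr
        rw [← ofReal_norm, ← ofReal_norm]
        exact ENNReal.ofReal_le_ofReal (hPle s (κ x))
      · rw [lintegral_const]
        exact ENNReal.mul_lt_top (ENNReal.mul_lt_top (by simp) (measure_lt_top _ _))
          (measure_lt_top _ _)
    refine squeeze_zero (fun _ => norm_nonneg _) (fun s => ?_) h1
    refine ContinuousLinearMap.opNorm_le_bound _ (Real.sqrt_nonneg _) fun u => ?_
    rw [show (K.comp (P s) - K) u = -(K (u - P s u)) by simp, norm_neg]
    have h2 : ENNReal.ofReal (‖K (u - P s u)‖ ^ 2) ≤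
        (∫⁻ x, ‖κ x - P s (κ x)‖ₑ ^ 2 ∂μ) * ‖u‖ₑ ^ 2 := by
      rw [Lp_norm_sq, ← lintegral_mul_const' _ _ (by simp)]
      refine lintegral_mono_ae ?_
      filter_upwards [hK (u - P s u)] with x hx
      rw [hx, ← hκ, inner_sub_right, ← hPsymm, ← inner_sub_left, ← mul_pow]
      gcongr
      rw [← ofReal_norm, ← ofReal_norm, ← ofReal_norm, ← ENNReal.ofReal_mul (norm_nonneg _)]
      exact ENNReal.ofReal_le_ofReal (norm_inner_le_norm _ _)
    have h3 := ENNReal.toReal_mono (ENNReal.mul_ne_top (hfin s) (by simp)) h2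
    rw [ENNReal.toReal_ofReal (by positivity), ENNReal.toReal_mul, ENNReal.toReal_pow,
      toReal_enorm] at h3
    refine (sq_le_sq₀ (norm_nonneg _) (by positivity)).1 ?_
    rw [mul_pow, Real.sq_sqrt ENNReal.toReal_nonneg]
    exact h3
  · exact (isCompactOperator_sum s _ fun i _ => isCompactOperator_rankOne (b i) (b i)).clm_comp K

end Compact

/-! ### Truncation of kernels, the Fredholm alternative and approximate eigenfunctions -/

section Truncation

set_option linter.unusedSectionVars false

variable {X : Type*} [MeasurableSpace X] {μ : Measure X} [IsFiniteMeasure μ]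
  {k : X → X → ℝ} {C : NNReal}

/-- The part of the kernel above a high level has uniformly small marginals. -/
def IsTruncatable (k : X → X → ℝ) (μ : Measure X) : Prop :=
  ∀ ε : NNReal, 0 < ε → ∃ N : ℝ, 0 ≤ N ∧ ∀ x, ∫⁻ y, ENNReal.ofReal (k x y - N) ∂μ ≤ ε

/-- A truncatable kernel splits into a bounded kernel and one of small operator norm. -/
theorem IsSchurKernel.exists_split (hk : IsSchurKernel k μ C) (ht : IsTruncatable k μ)
    {K : Lp ℂ 2 μ →L[ℂ] Lp ℂ 2 μ} (hK : ∀ u : Lp ℂ 2 μ, K u =ᵐ[μ] kerInt k μ u)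
    {ε : NNReal} (hε : 0 < ε) : ∃ (N : ℝ) (k' : X → X → ℝ) (K' : Lp ℂ 2 μ →L[ℂ] Lp ℂ 2 μ),
      0 ≤ N ∧ IsSchurKernel k' μ C ∧ (∀ x y, k' x y ≤ N) ∧
      (∀ u : Lp ℂ 2 μ, K' u =ᵐ[μ] kerInt k' μ u) ∧ ‖K - K'‖ ≤ ε := by
  obtain ⟨N, hN, hNb⟩ := ht ε hε
  have h1 : IsSchurKernel (fun x y => min (k x y) N) μ C :=
    { meas := hk.meas.min measurable_const
      nonneg := fun x y => le_min (hk.nonneg x y) hN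
      symm := fun x y => by rw [hk.symm]
      bound := fun x => (lintegral_mono fun y =>
        ENNReal.ofReal_le_ofReal (min_le_left _ _)).trans (hk.bound x) }
  have h2 : IsSchurKernel (fun x y => k x y - min (k x y) N) μ ε :=
    { meas := hk.meas.sub (hk.meas.min measurable_const)
      nonneg := fun x y => sub_nonneg.2 (min_le_left _ _)
      symm := fun x y => by rw [hk.symm]
      bound := fun x => by
        refine (lintegral_mono fun y => ?_).trans (hNb x)
        rcases le_total (k x y) N with h | h
        · simp [min_eq_left h]
        · rw [min_eq_right h] }
  obtain ⟨K', hK', -⟩ := h1.exists_clm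
  obtain ⟨D, hD, hDn⟩ := h2.exists_clm
  refine ⟨N, _, K', hN, h1, fun x y => min_le_right _ _, hK', ?_⟩
  have e : K - K' = D := by
    ext1 u
    refine Lp.ext ?_
    filter_upwards [Lp.coeFn_sub (K u) (K' u), hK u, hK' u, hD u,
      hk.ae_integrable (Lp.memLp u), h1.ae_integrable (Lp.memLp u)] with x e1 e2 e3 e4 e5 e6
    rw [_root_.sub_apply, e1, Pi.sub_apply, e2, e3, e4, kerInt, kerInt, kerInt,
      ← integral_sub e5 e6]
    refine integral_congr_ae (Eventually.of_forall fun y => ?_)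
    push_cast
    ring
  rw [e]
  exact hDn

/-- Integral operators with truncatable kernels are norm limits of operators with bounded kernels,
hence compact. -/
theorem IsSchurKernel.isCompactOperator [IsSeparable μ] (hk : IsSchurKernel k μ C)
    (ht : IsTruncatable k μ) {K : Lp ℂ 2 μ →L[ℂ] Lp ℂ 2 μ}
    (hK : ∀ u : Lp ℂ 2 μ, K u =ᵐ[μ] kerInt k μ u) : IsCompactOperator K := by
  have hpos : ∀ n : ℕ, (0 : NNReal) < 1 / ((n : NNReal) + 1) := fun n => by positivity
  choose N k' K' hN h1 h2 h3 h4 using fun n => hk.exists_split ht hK (hpos n)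
  refine isCompactOperator_of_tendsto (l := atTop) (F := K') (f := K) ?_
    (Eventually.of_forall fun n => (h1 n).isCompactOperator_of_le (h2 n) (h3 n))
  rw [tendsto_iff_norm_sub_tendsto_zero]
  refine squeeze_zero (fun _ => norm_nonneg _) (fun n => ?_)
    (tendsto_one_div_add_atTop_nhds_zero_nat (𝕜 := ℝ))
  rw [norm_sub_rev]
  simpa using h4 n

/-- Fredholm alternative for a compact perturbation of an invertible multiplication operator. -/
theorem isUnit_mul_sub_compact {V : X → ℝ} (hV : Measurable V) {v₀ B : ℝ} (hv₀ : 0 < v₀)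
    (hB : ∀ x, |V x| ≤ B) (hl : ∀ᵐ x ∂μ, v₀ ≤ V x) {K A : Lp ℂ 2 μ →L[ℂ] Lp ℂ 2 μ}
    (hK : IsCompactOperator K)
    (hA : ∀ u : Lp ℂ 2 μ, A u =ᵐ[μ] fun x => (V x : ℂ) * u x - K u x)
    (hinj : ∀ u, A u = 0 → u = 0) : IsUnit A := by
  obtain ⟨M, hM⟩ := exists_mul_clm (μ := μ) (m := fun x => (V x : ℂ)) (C := B.toNNReal)
    (Complex.measurable_ofReal.comp hV).aestronglyMeasurable
    (Eventually.of_forall fun x => by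
      rw [Complex.norm_real]
      exact (hB x).trans (Real.le_coe_toNNReal B))
  obtain ⟨M', hM'⟩ := exists_mul_clm (μ := μ) (m := fun x => ((V x)⁻¹ : ℂ)) (C := v₀⁻¹.toNNReal)
    (Complex.measurable_ofReal.comp hV).inv.aestronglyMeasurable
    (by
      filter_upwards [hl] with x hx
      rw [norm_inv, Complex.norm_real, Real.norm_of_nonneg (hv₀.le.trans hx)]
      exact (inv_anti₀ hv₀ hx).trans (Real.le_coe_toNNReal _))
  have hMM' : M * M' = 1 := by
    ext1 u
    refine Lp.ext ?_
    filter_upwards [hM (M' u), hM' u, hl] with x h1 h2 h3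
    have : (V x : ℂ) ≠ 0 := Complex.ofReal_ne_zero.2 (hv₀.trans_le h3).ne'
    change M (M' u) x = u x
    rw [h1, h2, mul_inv_cancel_left₀ this]
  have hM'M : M' * M = 1 := by
    ext1 u
    refine Lp.ext ?_
    filter_upwards [hM' (M u), hM u, hl] with x h1 h2 h3
    have : (V x : ℂ) ≠ 0 := Complex.ofReal_ne_zero.2 (hv₀.trans_le h3).ne'
    change M' (M u) x = u x
    rw [h1, h2, inv_mul_cancel_left₀ this]
  have hAM : A = M - K := by
    ext1 u
    refine Lp.ext ?_
    filter_upwards [hA u, hM u, Lp.coeFn_sub (M u) (K u)] with x h1 h2 h3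
    rw [h1, _root_.sub_apply, h3, Pi.sub_apply, h2]
  have hfac : A = M * (1 - M' * K) := by
    rw [mul_sub, mul_one, ← mul_assoc, hMM', one_mul, hAM]
  have hcomp : IsCompactOperator (M' * K : Lp ℂ 2 μ →L[ℂ] Lp ℂ 2 μ) := hK.clm_comp M'
  have hMu : IsUnit M := ⟨⟨M, M', hMM', hM'M⟩, rfl⟩
  rcases hcomp.hasEigenvalue_or_mem_resolventSet one_ne_zero with h | h
  · exfalso
    obtain ⟨u, hu⟩ := h.exists_hasEigenvector
    have h1 : (M' * K) u = u := by simpa using hu.apply_eq_smul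
    refine hu.2 (hinj u ?_)
    rw [hfac]
    change M (u - (M' * K) u) = 0
    rw [h1, sub_self, map_zero]
  · rw [spectrum.mem_resolventSet_iff, map_one] at h
    rw [hfac]
    exact hMu.mul h

theorem exists_lower_bound_of_isUnit {H : Type*} [NormedAddCommGroup H] [InnerProductSpace ℂ H]
    {A : H →L[ℂ] H} (hA : IsUnit A) : ∃ r : ℝ, 0 < r ∧ ∀ u, r * ‖u‖ ≤ ‖A u‖ := by
  obtain ⟨⟨A, R, h1, h2⟩, rfl⟩ := hA
  refine ⟨(‖R‖ + 1)⁻¹, by positivity, fun u => ?_⟩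
  rw [inv_mul_le_iff₀ (by positivity)]
  calc ‖u‖ = ‖R (A u)‖ := by
        change _ = ‖(R * A) u‖
        rw [h2]
        rfl
    _ ≤ ‖R‖ * ‖A u‖ := R.le_opNorm _
    _ ≤ (‖R‖ + 1) * ‖A u‖ := by gcongr; linarith

/-- The essential range of the potential belongs to the spectrum of `V - K`: normalised indicators
of small sets are almost annihilated by `K`. -/
theorem IsPotentialSub.exists_approx {V : X → ℝ} {A : Lp ℂ 2 μ →L[ℂ] Lp ℂ 2 μ}
    (hA : IsPotentialSub V k A) (hk : IsSchurKernel k μ C) (ht : IsTruncatable k μ)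
    (hV : Measurable V)
    (hsmall : ∀ S : Set X, MeasurableSet S → 0 < μ S → ∀ η : ℝ≥0∞, 0 < η →
      ∃ S' ⊆ S, MeasurableSet S' ∧ 0 < μ S' ∧ μ S' < η)
    {r : ℝ} (hr : ∀ ε > 0, 0 < μ {x | |V x - r| < ε}) {δ : ℝ} (hδ : 0 < δ) :
    ∃ u : Lp ℂ 2 μ, u ≠ 0 ∧ ‖A u - (r : ℂ) • u‖ ≤ δ * ‖u‖ := by
  obtain ⟨K, hK, -⟩ := hk.exists_clm
  obtain ⟨N, k', K', hN, h1, h2, h3, h4⟩ := hk.exists_split ht hK (ε := (δ / 3).toNNReal)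
    (Real.toNNReal_pos.2 (by positivity))
  rw [Real.coe_toNNReal _ (by positivity)] at h4
  have hTm : MeasurableSet {x | |V x - r| < δ / 3} :=
    measurableSet_lt ((hV.sub measurable_const).abs) measurable_const
  set c := (N * Real.sqrt (μ.real Set.univ) + 1) with hc
  have hcpos : 0 < c := by positivity
  obtain ⟨S, hST, hSm, hS0, hSη⟩ := hsmall _ hTm (hr (δ / 3) (by positivity))
    (ENNReal.ofReal ((δ / 3 / c) ^ 2)) (ENNReal.ofReal_pos.2 (by positivity))
  have hSfin : μ S ≠ ∞ := measure_ne_top _ _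
  have hSr : 0 < μ.real S := ENNReal.toReal_pos hS0.ne' hSfin
  have hSsq : Real.sqrt (μ.real S) ≤ δ / 3 / c := by
    rw [Real.sqrt_le_left (by positivity)]
    have := (ENNReal.toReal_mono (by simp) hSη.le)
    rwa [ENNReal.toReal_ofReal (by positivity)] at this
  let u : Lp ℂ 2 μ := indicatorConstLp 2 hSm hSfin (1 : ℂ)
  have hu : u =ᵐ[μ] S.indicator fun _ => (1 : ℂ) := indicatorConstLp_coeFn
  have hun : ‖u‖ = Real.sqrt (μ.real S) := by
    rw [norm_indicatorConstLp (by norm_num) (by norm_num), Real.sqrt_eq_rpow]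
    norm_num
  have hune : 0 < ‖u‖ := by rw [hun]; exact Real.sqrt_pos.2 hSr
  refine ⟨u, norm_pos_iff.1 hune, ?_⟩
  -- the multiplication part: `V` is close to `r` on the support of `u`
  have b1 : ‖A u + K u - (r : ℂ) • u‖ ≤ δ / 3 * ‖u‖ := by
    refine Lp.norm_le_mul_norm_of_ae_le_mul ?_
    filter_upwards [Lp.coeFn_sub (A u + K u) ((r : ℂ) • u), Lp.coeFn_add (A u) (K u),
      Lp.coeFn_smul (r : ℂ) u, hA u, hK u, hu] with x e1 e2 e3 e4 e5 e6
    rw [e1, Pi.sub_apply, e2, Pi.add_apply, e3, Pi.smul_apply, e4, e5, sub_add_cancel, smul_eq_mul,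
      ← sub_mul, norm_mul, ← Complex.ofReal_sub, Complex.norm_real, e6]
    by_cases hx : x ∈ S
    · gcongr
      exact (hST hx).le
    · simp [hx]
  -- the unbounded part of the kernel has small norm
  have b2 : ‖(K - K') u‖ ≤ δ / 3 * ‖u‖ :=
    ((K - K').le_opNorm u).trans (by gcongr)
  -- the bounded part maps `u` to a function of size `N μ(S)`, where `‖u‖² = μ(S)` is small
  have b3 : ‖K' u‖ ≤ δ / 3 * ‖u‖ := by
    have hbd : ∀ᵐ x ∂μ, ‖K' u x‖ ≤ N * μ.real S := by
      filter_upwards [h3 u] with x hx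
      rw [hx, kerInt_congr hu, kerInt]
      refine (norm_integral_le_of_norm_le (g := S.indicator fun _ => N)
        ((integrable_const N).indicator hSm) (Eventually.of_forall fun y => ?_)).trans ?_
      · by_cases hy : y ∈ S
        · simp only [hy, Set.indicator_of_mem, mul_one, Complex.norm_real]
          rw [Real.norm_of_nonneg (h1.nonneg x y)]
          exact h2 x y
        · simp [hy]
      · rw [integral_indicator hSm, setIntegral_const, smul_eq_mul, mul_comm]
    have := Lp.norm_le_of_ae_bound (by positivity) hbd
    refine this.trans ?_
    have e : measureUnivNNReal μ ^ (2 : ℝ≥0∞).toReal⁻¹ = Real.sqrt (μ.real Set.univ) := by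
      rw [Real.sqrt_eq_rpow]
      simp [measureUnivNNReal, Measure.real]
      rfl
    have h5 : N * Real.sqrt (μ.real Set.univ) ≤ c := by linarith
    have h6 : c * Real.sqrt (μ.real S) ≤ δ / 3 := by
      rw [← le_div_iff₀' hcpos]
      exact hSsq
    have h7 : μ.real S = Real.sqrt (μ.real S) * ‖u‖ := by
      rw [hun, Real.mul_self_sqrt hSr.le]
    calc _ = (N * Real.sqrt (μ.real Set.univ)) * μ.real S := by rw [e]; ring
      _ ≤ c * μ.real S := by gcongr
      _ = c * Real.sqrt (μ.real S) * ‖u‖ := by rw [mul_assoc, ← h7]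
      _ ≤ _ := by gcongr
  have e : A u - (r : ℂ) • u = (A u + K u - (r : ℂ) • u) - (K - K') u - K' u := by
    rw [_root_.sub_apply]
    abel
  rw [e]
  calc _ ≤ ‖A u + K u - (r : ℂ) • u‖ + ‖(K - K') u‖ + ‖K' u‖ :=
        (norm_sub_le _ _).trans (add_le_add_left (norm_sub_le _ _) _)
    _ ≤ δ / 3 * ‖u‖ + δ / 3 * ‖u‖ + δ / 3 * ‖u‖ := by gcongr
    _ = _ := by ring

end Truncation

/-! ### Operators acting on the second variable of `L²` of a product -/

section Fibre

set_option linter.unusedSectionVars false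

variable {W X : Type*} [MeasurableSpace W] [MeasurableSpace X] {ν : Measure W} [SFinite ν]
  {μ : Measure X} [IsFiniteMeasure μ]

theorem ae_eq_of_ae_ae {f g : W × X → ℂ} (hf : AEStronglyMeasurable f (ν.prod μ))
    (hg : AEStronglyMeasurable g (ν.prod μ)) (h : ∀ᵐ w ∂ν, ∀ᵐ x ∂μ, f (w, x) = g (w, x)) :
    f =ᵐ[ν.prod μ] g := by
  have h1 : hf.mk f =ᵐ[ν.prod μ] hg.mk g := by
    refine (Measure.ae_prod_iff_ae_ae
      (hf.stronglyMeasurable_mk.measurableSet_eq_fun hg.stronglyMeasurable_mk)).2 ?_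
    filter_upwards [h, Measure.ae_ae_of_ae_prod hf.ae_eq_mk, Measure.ae_ae_of_ae_prod hg.ae_eq_mk]
      with w e1 e2 e3
    filter_upwards [e1, e2, e3] with x e4 e5 e6
    rw [← e5, ← e6, e4]
  exact hf.ae_eq_mk.trans (h1.trans hg.ae_eq_mk.symm)

theorem MeasureTheory.MemLp.ae_slice {u : W × X → ℂ} (hu : MemLp u 2 (ν.prod μ)) :
    ∀ᵐ w ∂ν, MemLp (fun x => u (w, x)) 2 μ := by
  have h1 := hu.lintegral_sq_lt_top
  have hm : AEMeasurable (fun p => ‖u p‖ₑ ^ 2) (ν.prod μ) := hu.1.enorm.pow_const 2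
  rw [lintegral_prod _ hm] at h1
  filter_upwards [ae_lt_top' hm.lintegral_prod_right' h1.ne, hu.1.prodMk_left] with w h2 h3
  exact memLp_two_of_lintegral h3 h2

/-- `T'` acts on almost every slice `u (w, ·)` as `T`. -/
def IsFibrewise (T : Lp ℂ 2 μ →L[ℂ] Lp ℂ 2 μ)
    (T' : Lp ℂ 2 (ν.prod μ) →L[ℂ] Lp ℂ 2 (ν.prod μ)) : Prop :=
  ∀ u : Lp ℂ 2 (ν.prod μ), ∀ᵐ w ∂ν, ∃ h : MemLp (fun x => u (w, x)) 2 μ,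
    (fun x => T' u (w, x)) =ᵐ[μ] T h.toLp

variable {k : X → X → ℝ} {C : NNReal} {V : X → ℝ}

/-- The fibrewise integral operator. -/
theorem IsSchurKernel.exists_fibre_clm (hk : IsSchurKernel k μ C) :
    ∃ K : Lp ℂ 2 (ν.prod μ) →L[ℂ] Lp ℂ 2 (ν.prod μ), ∀ u : Lp ℂ 2 (ν.prod μ),
      K u =ᵐ[ν.prod μ] fun p => kerInt k μ (fun y => u (p.1, y)) p.2 := by
  have hcongr : ∀ u u' : W × X → ℂ, u =ᵐ[ν.prod μ] u' →
      (fun p : W × X => kerInt k μ (fun y => u (p.1, y)) p.2) =ᵐ[ν.prod μ]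
        fun p => kerInt k μ (fun y => u' (p.1, y)) p.2 := fun u u' h => by
    filter_upwards [(Measure.quasiMeasurePreserving_fst (μ := ν) (ν := μ)).ae
      (Measure.ae_ae_of_ae_prod h)] with p hp
    rw [kerInt_congr (μ := μ) (k := k) (u' := fun y => u' (p.1, y)) hp]
  have hmeas : ∀ u : W × X → ℂ, MemLp u 2 (ν.prod μ) → AEStronglyMeasurable
      (fun p : W × X => kerInt k μ (fun y => u (p.1, y)) p.2) (ν.prod μ) := fun u hu => by
    refine AEStronglyMeasurable.congr ?_ (hcongr _ _ hu.1.ae_eq_mk.symm)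
    refine StronglyMeasurable.aestronglyMeasurable ?_
    exact StronglyMeasurable.integral_prod_right' (ν := μ)
      (f := fun q : (W × X) × X => (k q.1.2 q.2 : ℂ) * hu.1.mk u (q.1.1, q.2))
      ((hk.measurable_ofReal_complex.comp
        (by fun_prop : Measurable fun q : (W × X) × X => (q.1.2, q.2))).stronglyMeasurable.mul
        (hu.1.stronglyMeasurable_mk.comp_measurable
          (by fun_prop : Measurable fun q : (W × X) × X => (q.1.1, q.2))))
  obtain ⟨K, hK, -⟩ := exists_clm_of_ae (μ := ν.prod μ) (ν := ν.prod μ)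
    (fun u p => kerInt k μ (fun y => u (p.1, y)) p.2) C (fun u u' _ h => hcongr u u' h)
    (fun u u' hu hu' => by
      refine ae_eq_of_ae_ae (hmeas _ (hu.add hu')) ((hmeas _ hu).add (hmeas _ hu')) ?_
      filter_upwards [hu.ae_slice, hu'.ae_slice] with w h1 h2
      filter_upwards [hk.ae_integrable h1, hk.ae_integrable h2] with x h3 h4
      simp only [Pi.add_apply, kerInt]
      rw [← integral_add h3 h4]
      simp only [mul_add])
    (fun c u hu => Eventually.of_forall fun p => by
      simp only [Pi.smul_apply, kerInt, smul_eq_mul]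
      rw [← integral_const_mul]
      congr 1
      funext y
      ring)
    hmeas
    (fun u hu => eLpNorm_two_le_of_lintegral (by
      rw [lintegral_prod _ ((hmeas u hu).enorm.pow_const 2),
        lintegral_prod _ (hu.1.enorm.pow_const 2), ← lintegral_const_mul' _ _ (by simp)]
      refine lintegral_mono_ae ?_
      filter_upwards [hu.1.prodMk_left] with w hw
      exact hk.lintegral_kerInt_le hw))
  exact ⟨K, hK⟩

/-- The operator `V - K` extends to the product, acting on the second variable. -/
theorem IsPotentialSub.exists_fibrewise {A : Lp ℂ 2 μ →L[ℂ] Lp ℂ 2 μ} (hA : IsPotentialSub V k A)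
    (hk : IsSchurKernel k μ C) (hV : Measurable V) {B : ℝ} (hB : ∀ x, |V x| ≤ B) :
    ∃ A' : Lp ℂ 2 (ν.prod μ) →L[ℂ] Lp ℂ 2 (ν.prod μ), IsFibrewise A A' ∧
      ∀ u : Lp ℂ 2 (ν.prod μ), A' u =ᵐ[ν.prod μ] fun p =>
        (V p.2 : ℂ) * u p - kerInt k μ (fun y => u (p.1, y)) p.2 := by
  obtain ⟨M, hM⟩ := exists_mul_clm (μ := ν.prod μ) (m := fun p => (V p.2 : ℂ)) (C := B.toNNReal)
    (Complex.measurable_ofReal.comp (hV.comp measurable_snd)).aestronglyMeasurable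
    (Eventually.of_forall fun x => by
      rw [Complex.norm_real]
      exact (hB _).trans (Real.le_coe_toNNReal B))
  obtain ⟨K, hK⟩ := hk.exists_fibre_clm (ν := ν)
  have h : ∀ u : Lp ℂ 2 (ν.prod μ), (M - K) u =ᵐ[ν.prod μ] fun p =>
        (V p.2 : ℂ) * u p - kerInt k μ (fun y => u (p.1, y)) p.2 := fun u => by
    filter_upwards [Lp.coeFn_sub (M u) (K u), hM u, hK u] with x h1 h2 h3
    rw [_root_.sub_apply, h1, Pi.sub_apply, h2, h3]
  refine ⟨M - K, fun u => ?_, h⟩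
  filter_upwards [Measure.ae_ae_of_ae_prod (h u), (Lp.memLp u).ae_slice] with w h1 h2
  refine ⟨h2, ?_⟩
  filter_upwards [h1, hA h2.toLp, h2.coeFn_toLp] with x h3 h4 h5
  rw [h3, h4, h5, kerInt_congr h2.coeFn_toLp]

theorem inner_prod (u v : Lp ℂ 2 (ν.prod μ)) : inner ℂ u v =
    ∫ w, ∫ x, inner ℂ (u (w, x)) (v (w, x)) ∂μ ∂ν := by
  rw [L2.inner_def, integral_prod _ (L2.integrable_inner u v)]

theorem inner_toLp {f g : X → ℂ} (hf : MemLp f 2 μ) (v : Lp ℂ 2 μ) (hg : g =ᵐ[μ] v) :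
    inner ℂ (hf.toLp) v = ∫ x, inner ℂ (f x) (g x) ∂μ := by
  rw [L2.inner_def]
  refine integral_congr_ae ?_
  filter_upwards [hf.coeFn_toLp, hg] with x h1 h2
  rw [h1, h2]

variable {T : Lp ℂ 2 μ →L[ℂ] Lp ℂ 2 μ} {T' : Lp ℂ 2 (ν.prod μ) →L[ℂ] Lp ℂ 2 (ν.prod μ)}

theorem IsFibrewise.isSelfAdjoint (h : IsFibrewise T T') (hT : IsSelfAdjoint T) :
    IsSelfAdjoint T' := by
  rw [ContinuousLinearMap.isSelfAdjoint_iff_isSymmetric] at hT ⊢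
  intro u v
  change inner ℂ (T' u) v = inner ℂ u (T' v)
  rw [inner_prod, inner_prod]
  refine integral_congr_ae ?_
  filter_upwards [h u, h v] with w h1 h2
  obtain ⟨mu, eu⟩ := h1
  obtain ⟨mv, ev⟩ := h2
  have h3 : inner ℂ (T mu.toLp) mv.toLp = inner ℂ mu.toLp (T mv.toLp) := hT _ _
  rw [inner_toLp mu (T mv.toLp) ev, L2.inner_def] at h3
  rw [← h3]
  refine integral_congr_ae ?_
  filter_upwards [eu, mv.coeFn_toLp] with x e1 e2
  rw [e1, e2]

/-- Lower bounds for `T - z` are inherited by the fibrewise operator. -/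
theorem IsFibrewise.lower (h : IsFibrewise T T') {z : ℂ} {r : ℝ} (hr : 0 < r)
    (hb : ∀ u, r * ‖u‖ ≤ ‖T u - z • u‖) (g : Lp ℂ 2 (ν.prod μ)) :
    r * ‖g‖ ≤ ‖T' g - z • g‖ := by
  have h1 : ENNReal.ofReal ((r * ‖g‖) ^ 2) ≤ ENNReal.ofReal (‖T' g - z • g‖ ^ 2) := by
    rw [mul_pow, ENNReal.ofReal_mul (by positivity), Lp_norm_sq, Lp_norm_sq,
      lintegral_prod _ ((Lp.aestronglyMeasurable g).enorm.pow_const 2),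
      lintegral_prod _ ((Lp.aestronglyMeasurable (T' g - z • g)).enorm.pow_const 2),
      ← lintegral_const_mul' _ _ (by simp)]
    refine lintegral_mono_ae ?_
    filter_upwards [h g, Measure.ae_ae_of_ae_prod (Lp.coeFn_sub (T' g) (z • g)),
      Measure.ae_ae_of_ae_prod (Lp.coeFn_smul z g)] with w h1 h2 h3
    obtain ⟨mg, eg⟩ := h1
    have h4 := hb mg.toLp
    have h5 : ENNReal.ofReal ((r * ‖mg.toLp‖) ^ 2) ≤
        ENNReal.ofReal (‖T mg.toLp - z • mg.toLp‖ ^ 2) :=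
      ENNReal.ofReal_le_ofReal (by gcongr)
    rw [mul_pow, ENNReal.ofReal_mul (by positivity), Lp_norm_sq, Lp_norm_sq] at h5
    refine le_trans (le_of_eq ?_) (h5.trans (le_of_eq ?_))
    · congr 1
      refine lintegral_congr_ae ?_
      filter_upwards [mg.coeFn_toLp] with x e1
      rw [e1]
    · refine lintegral_congr_ae ?_
      filter_upwards [h2, h3, eg, mg.coeFn_toLp, Lp.coeFn_sub (T mg.toLp) (z • mg.toLp),
        Lp.coeFn_smul z mg.toLp] with x e1 e2 e3 e4 e5 e6
      rw [e1, e5, Pi.sub_apply, Pi.sub_apply, e2, e6, Pi.smul_apply, Pi.smul_apply, e3, e4]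
  exact (sq_le_sq₀ (by positivity) (norm_nonneg _)).1
    ((ENNReal.ofReal_le_ofReal_iff (by positivity)).1 h1)

theorem exists_tensor (u : Lp ℂ 2 μ) : ∃ J : Lp ℂ 2 ν →L[ℂ] Lp ℂ 2 (ν.prod μ),
    ∀ f : Lp ℂ 2 ν, J f =ᵐ[ν.prod μ] fun p => f p.1 * u p.2 := by
  obtain ⟨J, hJ, -⟩ := exists_clm_of_ae (μ := ν) (ν := ν.prod μ)
    (fun f p => f p.1 * u p.2) ‖u‖₊
    (fun f f' _ h => by
      filter_upwards [(Measure.quasiMeasurePreserving_fst (μ := ν) (ν := μ)).ae h] with p hp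
      rw [hp])
    (fun f f' _ _ => Eventually.of_forall fun p => by simp [add_mul])
    (fun c f _ => Eventually.of_forall fun p => by simp [mul_assoc])
    (fun f hf => hf.1.comp_fst.mul (Lp.aestronglyMeasurable u).comp_snd)
    (fun f hf => eLpNorm_two_le_of_lintegral (by
      rw [lintegral_prod (fun p : W × X => ‖f p.1 * u p.2‖ₑ ^ 2)
        ((hf.1.comp_fst.mul (Lp.aestronglyMeasurable u).comp_snd).enorm.pow_const 2)]
      simp only [_root_.enorm_mul, mul_pow]
      have e : ∫⁻ x, ‖u x‖ₑ ^ 2 ∂μ = (‖u‖₊ : ℝ≥0∞) ^ 2 := by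
        rw [← Lp_norm_sq, ENNReal.ofReal_pow (norm_nonneg _), ofReal_norm]
        rfl
      refine le_of_eq ?_
      rw [← lintegral_const_mul' _ _ (by simp)]
      refine lintegral_congr fun w => ?_
      rw [lintegral_const_mul' _ _ (by simp), e, mul_comm]))
  exact ⟨J, hJ⟩

/-- The tensor product `f ↦ f ⊗ u` as an operator, depending linearly on `u`. -/
def tensorL (ν : Measure W) [SFinite ν] (μ : Measure X) [IsFiniteMeasure μ] :
    Lp ℂ 2 μ →ₗ[ℂ] Lp ℂ 2 ν →L[ℂ] Lp ℂ 2 (ν.prod μ) where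
  toFun u := (exists_tensor u).choose
  map_add' u v := by
    ext1 f
    refine Lp.ext ?_
    filter_upwards [(exists_tensor (ν := ν) (u + v)).choose_spec f,
      (exists_tensor (ν := ν) u).choose_spec f, (exists_tensor (ν := ν) v).choose_spec f,
      Lp.coeFn_add ((exists_tensor (ν := ν) u).choose f) ((exists_tensor (ν := ν) v).choose f),
      (Measure.quasiMeasurePreserving_snd (μ := ν) (ν := μ)).ae (Lp.coeFn_add u v)]
      with p h1 h2 h3 h4 h5
    rw [h1, _root_.add_apply, h4, Pi.add_apply, h2, h3, h5, Pi.add_apply, mul_add]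
  map_smul' c u := by
    ext1 f
    refine Lp.ext ?_
    filter_upwards [(exists_tensor (ν := ν) (c • u)).choose_spec f,
      (exists_tensor (ν := ν) u).choose_spec f,
      Lp.coeFn_smul c ((exists_tensor (ν := ν) u).choose f),
      (Measure.quasiMeasurePreserving_snd (μ := ν) (ν := μ)).ae (Lp.coeFn_smul c u)]
      with p h1 h2 h4 h5
    rw [h1, RingHom.id_apply, _root_.smul_apply, h4, Pi.smul_apply, h2, h5, Pi.smul_apply,
      smul_eq_mul, smul_eq_mul, mul_left_comm]

theorem tensorL_ae (u : Lp ℂ 2 μ) (f : Lp ℂ 2 ν) :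
    tensorL ν μ u f =ᵐ[ν.prod μ] fun p => f p.1 * u p.2 :=
  (exists_tensor (ν := ν) u).choose_spec f

theorem inner_tensorL (u v : Lp ℂ 2 μ) (f g : Lp ℂ 2 ν) :
    inner ℂ (tensorL ν μ u f) (tensorL ν μ v g) = (inner ℂ u v : ℂ) * inner ℂ f g := by
  rw [L2.inner_def, L2.inner_def, L2.inner_def, mul_comm, ← integral_prod_mul]
  refine integral_congr_ae ?_
  filter_upwards [tensorL_ae (ν := ν) u f, tensorL_ae (ν := ν) v g] with p h1 h2
  rw [h1, h2]
  simp only [RCLike.inner_apply, map_mul]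
  ring

theorem IsFibrewise.apply_tensorL (h : IsFibrewise T T') (u : Lp ℂ 2 μ) (f : Lp ℂ 2 ν) :
    T' (tensorL ν μ u f) = tensorL ν μ (T u) f := by
  refine Lp.ext ?_
  refine ae_eq_of_ae_ae (Lp.aestronglyMeasurable _) (Lp.aestronglyMeasurable _) ?_
  filter_upwards [h (tensorL ν μ u f), Measure.ae_ae_of_ae_prod (tensorL_ae (ν := ν) u f),
    Measure.ae_ae_of_ae_prod (tensorL_ae (ν := ν) (T u) f)] with w h1 h2 h3
  obtain ⟨m, e⟩ := h1
  have h4 : m.toLp = f w • u := by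
    refine Lp.ext ?_
    filter_upwards [m.coeFn_toLp, h2, Lp.coeFn_smul (f w) u] with x e1 e2 e3
    rw [e1, e2, e3, Pi.smul_apply, smul_eq_mul]
  filter_upwards [e, h3, Lp.coeFn_smul (f w) (T u)] with x e1 e2 e3
  rw [e1, e2, h4, map_smul, e3, Pi.smul_apply, smul_eq_mul]

/-- The adjoint of `f ↦ f ⊗ u` integrates the second variable against `u`. -/
theorem adjoint_tensorL_ae (u : Lp ℂ 2 μ) (g : Lp ℂ 2 (ν.prod μ)) :
    ContinuousLinearMap.adjoint (tensorL ν μ u) g =ᵐ[ν]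
      fun w => ∫ x, starRingEnd ℂ (u x) * g (w, x) ∂μ := by
  have hm : AEStronglyMeasurable (fun p : W × X => starRingEnd ℂ (u p.2) * g p) (ν.prod μ) :=
    (Complex.continuous_conj.comp_aestronglyMeasurable
      (Lp.aestronglyMeasurable u).comp_snd).mul (Lp.aestronglyMeasurable g)
  have hinner : ∀ w (h : MemLp (fun x => g (w, x)) 2 μ),
      ∫ x, starRingEnd ℂ (u x) * g (w, x) ∂μ = inner ℂ u h.toLp := fun w h => by
    rw [inner_eq_integral_of_ae _ h.coeFn_toLp]
  have hG : MemLp (fun w => ∫ x, starRingEnd ℂ (u x) * g (w, x) ∂μ) 2 ν := by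
    refine memLp_two_of_lintegral hm.integral_prod_right' ?_
    calc _ ≤ ∫⁻ w, ‖u‖ₑ ^ 2 * ∫⁻ x, ‖g (w, x)‖ₑ ^ 2 ∂μ ∂ν := by
          refine lintegral_mono_ae ?_
          filter_upwards [(Lp.memLp g).ae_slice] with w hw
          rw [hinner w hw]
          have h1 : ∫⁻ x, ‖g (w, x)‖ₑ ^ 2 ∂μ = ‖hw.toLp‖ₑ ^ 2 := by
            rw [← ofReal_norm, ← ENNReal.ofReal_pow (norm_nonneg _), Lp_norm_sq]
            refine lintegral_congr_ae ?_
            filter_upwards [hw.coeFn_toLp] with x e1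
            rw [e1]
          rw [h1, ← mul_pow]
          gcongr
          rw [← ofReal_norm, ← ofReal_norm, ← ofReal_norm, ← ENNReal.ofReal_mul (norm_nonneg _)]
          exact ENNReal.ofReal_le_ofReal (norm_inner_le_norm _ _)
      _ = ‖u‖ₑ ^ 2 * ∫⁻ p, ‖g p‖ₑ ^ 2 ∂(ν.prod μ) := by
          rw [lintegral_const_mul' _ _ (by simp),
            lintegral_prod _ ((Lp.aestronglyMeasurable g).enorm.pow_const 2)]
      _ < ∞ := ENNReal.mul_lt_top (by simp) (Lp.memLp g).lintegral_sq_lt_top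
  have h : ContinuousLinearMap.adjoint (tensorL ν μ u) g = hG.toLp := by
    refine ext_inner_left ℂ fun f => ?_
    rw [ContinuousLinearMap.adjoint_inner_right, inner_prod,
      inner_eq_integral_of_ae _ hG.coeFn_toLp]
    refine integral_congr_ae ?_
    filter_upwards [Measure.ae_ae_of_ae_prod (tensorL_ae (ν := ν) u f)] with w h1
    rw [← integral_const_mul]
    refine integral_congr_ae ?_
    filter_upwards [h1] with x e1
    rw [e1, RCLike.inner_apply, map_mul]
    ring
  rw [h]
  exact hG.coeFn_toLp

end Fibre

/-! ### Multiplication operators with range `[0, ∞)` -/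

section Multiplication

set_option linter.unusedSectionVars false

variable {X : Type*} [MeasurableSpace X] {μ : Measure X}

theorem exists_Lp_mul {m : X → ℂ} (hm : AEStronglyMeasurable m μ) (u : Lp ℂ 2 μ) {C : ℝ}
    (hC : ∀ᵐ x ∂μ, ‖m x * u x‖ ≤ C * ‖u x‖) :
    ∃ w : Lp ℂ 2 μ, (w =ᵐ[μ] fun x => m x * u x) ∧ ‖w‖ ≤ C * ‖u‖ := by
  have h : MemLp (fun x => m x * u x) 2 μ :=
    (Lp.memLp u).of_le_mul (hm.mul (Lp.aestronglyMeasurable u)) hC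
  refine ⟨h.toLp _, h.coeFn_toLp, Lp.norm_le_mul_norm_of_ae_le_mul ?_⟩
  filter_upwards [h.coeFn_toLp, hC] with x h1 h2
  rwa [h1]

/-- Normalised indicators of disjoint sets form an orthonormal sequence. -/
theorem exists_orthonormal_of_disjoint {S : ℕ → Set X} (hS : ∀ n, MeasurableSet (S n))
    (hd : Pairwise fun i j => Disjoint (S i) (S j)) (h0 : ∀ n, 0 < μ (S n))
    (hfin : ∀ n, μ (S n) < ∞) :
    ∃ e : ℕ → Lp ℂ 2 μ, Orthonormal ℂ e ∧ ∀ n, ∀ᵐ x ∂μ, x ∉ S n → e n x = 0 := by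
  have hr : ∀ n, 0 < μ.real (S n) := fun n => ENNReal.toReal_pos (h0 n).ne' (hfin n).ne
  let e : ℕ → Lp ℂ 2 μ := fun n =>
    indicatorConstLp 2 (hS n) (hfin n).ne (((μ.real (S n)) ^ (-(1 / 2) : ℝ) : ℝ) : ℂ)
  have he : ∀ n, ∀ᵐ x ∂μ, x ∉ S n → e n x = 0 := by
    intro n
    filter_upwards [indicatorConstLp_coeFn (p := 2) (hs := hS n) (hμs := (hfin n).ne)
      (c := (((μ.real (S n)) ^ (-(1 / 2) : ℝ) : ℝ) : ℂ))] with x hx hxS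
    rw [hx, Set.indicator_of_notMem hxS]
  refine ⟨e, ⟨fun n => ?_, fun i j hij => ?_⟩, he⟩
  · rw [norm_indicatorConstLp two_ne_zero ENNReal.ofNat_ne_top, Complex.norm_real,
      Real.norm_of_nonneg (Real.rpow_nonneg (hr n).le _), ← Real.rpow_add (hr n)]
    norm_num
  · change inner ℂ (e i) (e j) = 0
    rw [L2.inner_def, ← integral_zero X ℂ (μ := μ)]
    refine integral_congr_ae ?_
    filter_upwards [he i, he j] with x hi hj
    by_cases hx : x ∈ S i
    · rw [hj fun h => (Set.disjoint_left.1 (hd hij)) hx h, inner_zero_right]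
    · rw [hi hx, inner_zero_left]

/-- The graph of multiplication by `q` in `L²`. -/
def mulGraph (q : X → ℝ) (μ : Measure X) : Submodule ℂ (Lp ℂ 2 μ × Lp ℂ 2 μ) where
  carrier := {p | p.2 =ᵐ[μ] fun x => (q x : ℂ) * p.1 x}
  add_mem' := by
    rintro ⟨f, u⟩ ⟨f', u'⟩ h h'
    have h : u =ᵐ[μ] fun x => (q x : ℂ) * f x := h
    have h' : u' =ᵐ[μ] fun x => (q x : ℂ) * f' x := h'
    change (u + u' : Lp ℂ 2 μ) =ᵐ[μ] fun x => (q x : ℂ) * (f + f' : Lp ℂ 2 μ) x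
    filter_upwards [h, h', Lp.coeFn_add f f', Lp.coeFn_add u u'] with x h1 h2 h3 h4
    rw [h4, h3, Pi.add_apply, Pi.add_apply, h1, h2, mul_add]
  zero_mem' := by
    change (0 : Lp ℂ 2 μ) =ᵐ[μ] fun x => (q x : ℂ) * (0 : Lp ℂ 2 μ) x
    filter_upwards [Lp.coeFn_zero ℂ 2 μ] with x h
    rw [h, Pi.zero_apply, mul_zero]
  smul_mem' := by
    rintro c ⟨f, u⟩ h
    have h : u =ᵐ[μ] fun x => (q x : ℂ) * f x := h
    change (c • u : Lp ℂ 2 μ) =ᵐ[μ] fun x => (q x : ℂ) * (c • f : Lp ℂ 2 μ) x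
    filter_upwards [h, Lp.coeFn_smul c f, Lp.coeFn_smul c u] with x h1 h3 h4
    rw [h4, h3, Pi.smul_apply, Pi.smul_apply, h1, smul_eq_mul, smul_eq_mul, mul_left_comm]

theorem mem_mulGraph {q : X → ℝ} {f u : Lp ℂ 2 μ} :
    (f, u) ∈ mulGraph q μ ↔ u =ᵐ[μ] fun x => (q x : ℂ) * f x := Iff.rfl

theorem exists_dist_halfLine {z : ℂ} (hz : ∀ t : ℝ, 0 ≤ t → z ≠ t) :
    ∃ δ > 0, ∀ t : ℝ, 0 ≤ t → δ ≤ ‖(t : ℂ) - z‖ := by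
  have hc : IsClosed ((fun t : ℝ => (t : ℂ)) '' Set.Ici 0) :=
    Complex.isometry_ofReal.isClosedEmbedding.isClosedMap _ isClosed_Ici
  have hne : ((fun t : ℝ => (t : ℂ)) '' Set.Ici 0).Nonempty := ⟨_, 0, le_refl (0 : ℝ), rfl⟩
  have hz' : z ∉ (fun t : ℝ => (t : ℂ)) '' Set.Ici 0 := by
    rintro ⟨t, ht, rfl⟩
    exact hz t ht rfl
  refine ⟨_, (hc.notMem_iff_infDist_pos hne).1 hz', fun t ht => ?_⟩
  rw [← dist_eq_norm, dist_comm]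
  exact Metric.infDist_le_dist_of_mem ⟨t, ht, rfl⟩

variable {q : X → ℝ}

theorem exists_mulGraph_resolvent (hq : Measurable q) (h0 : ∀ x, 0 ≤ q x) {z : ℂ}
    (hz : ∀ t : ℝ, 0 ≤ t → z ≠ t) :
    ∃ R : Lp ℂ 2 μ →L[ℂ] Lp ℂ 2 μ, ∀ u : Lp ℂ 2 μ, R u =ᵐ[μ] fun x => ((q x : ℂ) - z)⁻¹ * u x := by
  obtain ⟨δ, hδ, hb⟩ := exists_dist_halfLine hz
  refine exists_mul_clm (C := ⟨δ⁻¹, by positivity⟩)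
    ((Complex.measurable_ofReal.comp hq).sub_const z).inv.aestronglyMeasurable
    (Eventually.of_forall fun x => ?_)
  simp only [norm_inv]
  exact inv_anti₀ hδ (hb _ (h0 x))

/-- Multiplication by a non-negative function `q` is a half-line operator if the level sets of `q`
are null (no eigenvalues), `q` is close to each `t ≥ 0` on disjoint sets of positive measure (Weyl
sequences), and `q` is large on such sets (high-energy vectors). -/
theorem isHalfLineGraph_mulGraph (hq : Measurable q) (h0 : ∀ x, 0 ≤ q x)
    (hnull : ∀ t : ℝ, μ {x | q x = t} = 0)
    (hweyl : ∀ t : ℝ, 0 ≤ t → ∃ (S : ℕ → Set X) (ε : ℕ → ℝ), (∀ n, MeasurableSet (S n)) ∧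
      (Pairwise fun i j => Disjoint (S i) (S j)) ∧ (∀ n, 0 < μ (S n)) ∧ (∀ n, μ (S n) < ∞) ∧
      Tendsto ε atTop (𝓝 0) ∧ ∀ n, ∀ x ∈ S n, |q x - t| ≤ ε n)
    (hhigh : ∃ S : ℕ → Set X, (∀ n, MeasurableSet (S n)) ∧
      (Pairwise fun i j => Disjoint (S i) (S j)) ∧ (∀ n, 0 < μ (S n)) ∧ (∀ n, μ (S n) < ∞) ∧
      ∃ c > 0, ∀ n : ℕ, ∀ x ∈ S n, c * ((n : ℝ) + 1) ≤ q x) :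
    IsHalfLineGraph (mulGraph q μ) where
  maximal h k H := by
    -- the resolvents at `i` and `-i` are adjoint to each other, so that an adjoint pair `(h, k)`
    -- satisfies `h = (q + i)⁻¹ (k + i h)`
    have hI : ∀ t : ℝ, 0 ≤ t → Complex.I ≠ t := fun t _ hh => by simpa using congrArg Complex.im hh
    have hI' : ∀ t : ℝ, 0 ≤ t → -Complex.I ≠ t := fun t _ hh => by simpa using congrArg Complex.im hh
    obtain ⟨R, hR⟩ := exists_mulGraph_resolvent (μ := μ) hq h0 hI
    obtain ⟨R', hR'⟩ := exists_mulGraph_resolvent (μ := μ) hq h0 hI'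
    have hne : ∀ x, (q x : ℂ) - Complex.I ≠ 0 := fun x hh => hI _ (h0 x) (sub_eq_zero.1 hh).symm
    have hne' : ∀ x, (q x : ℂ) - -Complex.I ≠ 0 := fun x hh => hI' _ (h0 x) (sub_eq_zero.1 hh).symm
    have hadj : ∀ g w, inner ℂ (R g) w = inner ℂ g (R' w) := by
      intro g w
      rw [L2.inner_def, L2.inner_def]
      refine integral_congr_ae ?_
      filter_upwards [hR g, hR' w] with x h1 h2
      rw [RCLike.inner_apply, RCLike.inner_apply, h1, h2]
      simp only [map_mul, map_inv₀, map_sub, Complex.conj_ofReal, Complex.conj_I]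
      ring
    have key : h = R' (k + Complex.I • h) := by
      refine ext_inner_left ℂ fun g => ?_
      have hmem : (R g, g + Complex.I • R g) ∈ mulGraph q μ := by
        rw [mem_mulGraph]
        filter_upwards [hR g, Lp.coeFn_add g (Complex.I • R g), Lp.coeFn_smul Complex.I (R g)]
          with x h1 h2 h3
        rw [h2, Pi.add_apply, h3, Pi.smul_apply, h1, smul_eq_mul]
        field_simp [hne x]
        ring
      have h1 := H _ _ hmem
      rw [inner_add_left, inner_smul_left, Complex.conj_I] at h1
      rw [← hadj, inner_add_right, inner_smul_right]
      linear_combination h1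
    rw [mem_mulGraph]
    have h1 : (h : X → ℂ) =ᵐ[μ] (R' (k + Complex.I • h) : Lp ℂ 2 μ) := by rw [← key]
    filter_upwards [h1, hR' (k + Complex.I • h), Lp.coeFn_add k (Complex.I • h),
      Lp.coeFn_smul Complex.I h] with x h1 h2 h3 h4
    rw [h2, h3, Pi.add_apply, h4, Pi.smul_apply, smul_eq_mul] at h1
    have h5 : ((q x : ℂ) - -Complex.I) * h x = k x + Complex.I * h x := by
      rw [eq_comm, inv_mul_eq_iff_eq_mul₀ (hne' x)] at h1
      exact h1.symm
    linear_combination -h5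
  resolvent z hz := by
    obtain ⟨R, hR⟩ := exists_mulGraph_resolvent (μ := μ) hq h0 hz
    have hne : ∀ x, (q x : ℂ) - z ≠ 0 := fun x hh => hz _ (h0 x) (sub_eq_zero.1 hh).symm
    refine ⟨R, fun g => ?_, fun f u hfu => ?_⟩
    · rw [mem_mulGraph]
      filter_upwards [hR g, Lp.coeFn_add g (z • R g), Lp.coeFn_smul z (R g)] with x h1 h2 h3
      rw [h2, Pi.add_apply, h3, Pi.smul_apply, h1, smul_eq_mul]
      field_simp [hne x]
      ring
    · refine Lp.ext ?_
      rw [mem_mulGraph] at hfu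
      filter_upwards [hR (u - z • f), hfu, Lp.coeFn_sub u (z • f), Lp.coeFn_smul z f]
        with x h1 h2 h3 h4
      rw [h1, h3, Pi.sub_apply, h4, Pi.smul_apply, h2, smul_eq_mul]
      field_simp [hne x]
  weyl t ht := by
    obtain ⟨S, ε, hS, hd, hpos, hfin, hε, hb⟩ := hweyl t ht
    obtain ⟨e, he, hsupp⟩ := exists_orthonormal_of_disjoint hS hd hpos hfin
    have hw : ∀ n, ∃ w : Lp ℂ 2 μ, (w =ᵐ[μ] fun x => ((q x - t : ℝ) : ℂ) * e n x) ∧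
        ‖w‖ ≤ ε n * ‖e n‖ := by
      intro n
      refine exists_Lp_mul (Complex.measurable_ofReal.comp (hq.sub_const t)).aestronglyMeasurable
        (e n) ?_
      filter_upwards [hsupp n] with x hx
      by_cases hxS : x ∈ S n
      · rw [norm_mul, Function.comp_apply, Complex.norm_real, Real.norm_eq_abs]
        gcongr
        exact hb n x hxS
      · rw [hx hxS]
        simp
    choose w hw hwn using hw
    refine ⟨e, fun n => w n + (t : ℂ) • e n, fun n => ?_, he, ?_⟩
    · rw [mem_mulGraph]
      filter_upwards [hw n, Lp.coeFn_add (w n) ((t : ℂ) • e n), Lp.coeFn_smul (t : ℂ) (e n)]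
        with x h1 h2 h3
      rw [h2, Pi.add_apply, h3, Pi.smul_apply, h1, smul_eq_mul]
      push_cast
      ring
    · simp only [add_sub_cancel_right]
      refine squeeze_zero_norm (fun n => ?_) hε
      have := hwn n
      rwa [he.1 n, mul_one] at this
  injective z f hf := by
    rw [mem_mulGraph] at hf
    refine Lp.eq_zero_iff_ae_eq_zero.2 ?_
    have hn : ∀ᵐ x ∂μ, q x ≠ z.re := by
      rw [ae_iff]
      simpa using hnull z.re
    filter_upwards [hf, hn, Lp.coeFn_smul z f] with x h1 h2 h3
    rw [h3, Pi.smul_apply, smul_eq_mul] at h1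
    have h4 : (z - q x) * f x = 0 := by linear_combination h1
    rcases mul_eq_zero.1 h4 with h5 | h5
    · refine absurd ?_ h2
      rw [sub_eq_zero.1 h5, Complex.ofReal_re]
    · exact h5
  high := by
    obtain ⟨S, hS, hd, hpos, hfin, c, hc, hb⟩ := hhigh
    obtain ⟨e, he, hsupp⟩ := exists_orthonormal_of_disjoint hS hd hpos hfin
    have hqpos : ∀ n : ℕ, ∀ x ∈ S n, 0 < q x := fun n x hx =>
      lt_of_lt_of_le (by positivity) (hb n x hx)
    have hw : ∀ n : ℕ, ∃ w : Lp ℂ 2 μ, (w =ᵐ[μ] fun x => ((q x)⁻¹ : ℂ) * e n x) ∧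
        ‖w‖ ≤ c⁻¹ * (1 / ((n : ℝ) + 1)) * ‖e n‖ := by
      intro n
      refine exists_Lp_mul (Complex.measurable_ofReal.comp hq).inv.aestronglyMeasurable
        (e n) ?_
      filter_upwards [hsupp n] with x hx
      by_cases hxS : x ∈ S n
      · rw [norm_mul, Pi.inv_apply, Function.comp_apply, norm_inv, Complex.norm_real,
          Real.norm_of_nonneg (h0 x)]
        gcongr
        rw [one_div, ← mul_inv]
        exact inv_anti₀ (by positivity) (hb n x hxS)
      · rw [hx hxS]
        simp
    choose w hw hwn using hw
    refine ⟨w, e, fun n => ?_, he, ?_⟩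
    · rw [mem_mulGraph]
      filter_upwards [hw n, hsupp n] with x h1 h2
      by_cases hxS : x ∈ S n
      · rw [h1, mul_inv_cancel_left₀]
        exact_mod_cast (hqpos n x hxS).ne'
      · rw [h1, h2 hxS, mul_zero, mul_zero]
    · have hlim : Tendsto (fun n : ℕ => c⁻¹ * (1 / ((n : ℝ) + 1))) atTop (𝓝 0) := by
        simpa using (tendsto_one_div_add_atTop_nhds_zero_nat (𝕜 := ℝ)).const_mul c⁻¹
      refine squeeze_zero_norm (fun n => ?_) hlim
      have := hwn n
      rwa [he.1 n, mul_one] at this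

end Multiplication

section Transfer

variable {H H' : Type*} [NormedAddCommGroup H] [InnerProductSpace ℂ H]
  [NormedAddCommGroup H'] [InnerProductSpace ℂ H']

/-- A half-line graph pulled back along a unitary map is a half-line graph. -/
theorem IsHalfLineGraph.comap {P : Submodule ℂ (H × H)} (hP : IsHalfLineGraph P) (U : H' ≃ₗᵢ[ℂ] H)
    {P' : Submodule ℂ (H' × H')} (hP' : ∀ f u, (f, u) ∈ P' ↔ (U f, U u) ∈ P) :
    IsHalfLineGraph P' where
  maximal h k hk := by
    rw [hP']
    refine hP.maximal _ _ fun f u hfu => ?_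
    have := hk (U.symm f) (U.symm u) (by rw [hP']; simpa using hfu)
    rw [← U.inner_map_map, ← U.inner_map_map (U.symm f)] at this
    simpa using this
  resolvent z hz := by
    obtain ⟨R, h1, h2⟩ := hP.resolvent z hz
    refine ⟨(U.symm.toContinuousLinearEquiv : H →L[ℂ] H') ∘L R ∘L
      (U.toContinuousLinearEquiv : H' →L[ℂ] H), fun h => ?_, fun f u hfu => ?_⟩
    · rw [hP']
      simpa using h1 (U h)
    · have := h2 _ _ ((hP' f u).1 hfu)
      rw [← map_smul, ← map_sub] at this
      change U.symm (R (U (u - z • f))) = f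
      rw [this, U.symm_apply_apply]
  weyl t ht := by
    obtain ⟨f, u, h1, h2, h3⟩ := hP.weyl t ht
    refine ⟨fun n => U.symm (f n), fun n => U.symm (u n), fun n => ?_, ?_, ?_⟩
    · rw [hP']
      simpa using h1 n
    · exact h2.comp_linearIsometry U.symm.toLinearIsometry
    · have := (U.symm.continuous.tendsto 0).comp h3
      rw [map_zero] at this
      refine this.congr fun n => ?_
      rw [Function.comp_apply, map_sub, map_smul]
  injective z f hf := by
    rw [hP', map_smul] at hf
    simpa using hP.injective z _ hf
  high := by
    obtain ⟨f, u, h1, h2, h3⟩ := hP.high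
    refine ⟨fun n => U.symm (f n), fun n => U.symm (u n), fun n => ?_, ?_, ?_⟩
    · rw [hP']
      simpa using h1 n
    · exact h2.comp_linearIsometry U.symm.toLinearIsometry
    · have := (U.symm.continuous.tendsto 0).comp h3
      rwa [map_zero] at this

end Transfer

/-! ### Positive quadratic forms as Fourier multipliers -/

section Quadratic

open scoped Pointwise

variable {E : Type*} [NormedAddCommGroup E] [InnerProductSpace ℝ E] [FiniteDimensional ℝ E]
  [MeasurableSpace E] [BorelSpace E] [Nontrivial E] {Q : E → ℝ} {c : ℝ}

/-- Level sets of a positive definite homogeneous function of degree two are null: only countably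
many of them have positive measure, and all those at positive levels are dilations of each other. -/
theorem volume_level_eq_zero (hQ : Continuous Q) (hs : ∀ (s : ℝ) p, Q (s • p) = s ^ 2 * Q p)
    (hc : 0 < c) (hlow : ∀ p, c * ‖p‖ ^ 2 ≤ Q p) (t : ℝ) : volume {p : E | Q p = t} = 0 := by
  rcases le_or_gt t 0 with ht | ht
  · refine measure_mono_null (t := {0}) (fun p hp => ?_) (measure_singleton 0)
    have h1 : Q p = t := hp
    have h2 := hlow p
    have h3 : ‖p‖ ^ 2 ≤ 0 := by
      by_contra h
      have := mul_pos hc (not_le.1 h)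
      linarith
    have h4 : ‖p‖ = 0 := by nlinarith [norm_nonneg p]
    simpa using h4
  · obtain ⟨t', ht', hnull⟩ : ∃ t' : ℝ, 0 < t' ∧ volume {p : E | Q p = t'} = 0 := by
      by_contra! hcon
      have hcount := Measure.countable_meas_level_set_pos (μ := (volume : Measure E)) hQ.measurable
      have hIoi : (Set.Ioi (0 : ℝ)).Countable :=
        hcount.mono fun t' ht' => pos_iff_ne_zero.2 (hcon t' ht')
      simpa using hIoi.measure_zero volume
    have hsub : {p : E | Q p = t} ⊆ Real.sqrt (t / t') • {p : E | Q p = t'} := by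
      intro p hp
      have hp : Q p = t := hp
      have hr : 0 < Real.sqrt (t / t') := Real.sqrt_pos.2 (by positivity)
      refine Set.mem_smul_set.2 ⟨(Real.sqrt (t / t'))⁻¹ • p, ?_, smul_inv_smul₀ hr.ne' p⟩
      change Q _ = t'
      rw [hs, hp, inv_pow, Real.sq_sqrt (by positivity)]
      field_simp
    refine measure_mono_null hsub ?_
    rw [Measure.addHaar_smul, hnull, mul_zero]

/-- The spherical shells around `p₀` between consecutive members of a strictly monotone sequence of
radii are disjoint and have positive finite measure. -/
theorem exists_shells (p₀ : E) (r : ℕ → ℝ) (hr : StrictAnti r ∨ StrictMono r) (h0 : ∀ n, 0 ≤ r n) :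
    (∀ n, MeasurableSet {p : E | min (r n) (r (n + 1)) < ‖p - p₀‖ ∧
      ‖p - p₀‖ < max (r n) (r (n + 1))}) ∧
    (Pairwise fun i j => Disjoint
      {p : E | min (r i) (r (i + 1)) < ‖p - p₀‖ ∧ ‖p - p₀‖ < max (r i) (r (i + 1))}
      {p : E | min (r j) (r (j + 1)) < ‖p - p₀‖ ∧ ‖p - p₀‖ < max (r j) (r (j + 1))}) ∧
    (∀ n, 0 < volume {p : E | min (r n) (r (n + 1)) < ‖p - p₀‖ ∧
      ‖p - p₀‖ < max (r n) (r (n + 1))}) ∧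
    (∀ n, volume {p : E | min (r n) (r (n + 1)) < ‖p - p₀‖ ∧
      ‖p - p₀‖ < max (r n) (r (n + 1))} < ∞) := by
  have hopen : ∀ n, IsOpen {p : E | min (r n) (r (n + 1)) < ‖p - p₀‖ ∧
      ‖p - p₀‖ < max (r n) (r (n + 1))} := fun n =>
    (isOpen_lt continuous_const (continuous_id.sub continuous_const).norm).inter
      (isOpen_lt (continuous_id.sub continuous_const).norm continuous_const)
  have hlt : ∀ n, min (r n) (r (n + 1)) < max (r n) (r (n + 1)) := by
    intro n
    rcases hr with h | h
    · exact min_lt_max.2 (h n.lt_succ_self).ne'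
    · exact min_lt_max.2 (h n.lt_succ_self).ne
  refine ⟨fun n => (hopen n).measurableSet, ?_, fun n => ?_, fun n => ?_⟩
  · have key : ∀ i j, i < j → Disjoint
      {p : E | min (r i) (r (i + 1)) < ‖p - p₀‖ ∧ ‖p - p₀‖ < max (r i) (r (i + 1))}
      {p : E | min (r j) (r (j + 1)) < ‖p - p₀‖ ∧ ‖p - p₀‖ < max (r j) (r (j + 1))} := by
      intro i j hij
      rw [Set.disjoint_left]
      rintro p ⟨h1, h2⟩ ⟨h3, h4⟩
      rcases hr with h | h
      · rw [min_eq_right (h (Nat.lt_succ_self _)).le] at h1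
        rw [max_eq_left (h (Nat.lt_succ_self _)).le] at h4
        have := h.antitone (Nat.succ_le_of_lt hij)
        simp only [Nat.succ_eq_add_one] at this
        linarith
      · rw [max_eq_right (h (Nat.lt_succ_self _)).le] at h2
        rw [min_eq_left (h (Nat.lt_succ_self _)).le] at h3
        have := h.monotone (Nat.succ_le_of_lt hij)
        simp only [Nat.succ_eq_add_one] at this
        linarith
    intro i j hij
    rcases lt_or_gt_of_ne hij with h | h
    · exact key i j h
    · exact (key j i h).symm
  · refine (hopen n).measure_pos _ ?_
    obtain ⟨ρ, h1, h2⟩ := exists_between (hlt n)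
    obtain ⟨e, he⟩ := exists_norm_eq E ((le_min (h0 n) (h0 (n + 1))).trans h1.le)
    exact ⟨p₀ + e, by rwa [add_sub_cancel_left, he], by rwa [add_sub_cancel_left, he]⟩
  · refine (measure_mono (t := Metric.ball p₀ (max (r n) (r (n + 1)))) fun p hp => ?_).trans_lt
      measure_ball_lt_top
    rw [Metric.mem_ball, dist_eq_norm]
    exact hp.2

/-- The Weyl sequences live on shells shrinking to a point where `Q = t`, the high-energy vectors on
shells of growing radius. -/
theorem isHalfLineGraph_quadratic (hQ : Continuous Q) (hs : ∀ (s : ℝ) p, Q (s • p) = s ^ 2 * Q p)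
    (hc : 0 < c) (hlow : ∀ p, c * ‖p‖ ^ 2 ≤ Q p) :
    IsHalfLineGraph (mulGraph Q (volume : Measure E)) := by
  have h0 : ∀ p, 0 ≤ Q p := fun p => le_trans (by positivity) (hlow p)
  refine isHalfLineGraph_mulGraph hQ.measurable h0 (volume_level_eq_zero hQ hs hc hlow)
    (fun t ht => ?_) ?_
  · obtain ⟨p, hp⟩ := exists_ne (0 : E)
    have hQp : 0 < Q p := lt_of_lt_of_le (by have := norm_pos_iff.2 hp; positivity) (hlow p)
    obtain ⟨p₀, hp₀⟩ : ∃ p₀, Q p₀ = t := by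
      refine ⟨Real.sqrt (t / Q p) • p, ?_⟩
      rw [hs, Real.sq_sqrt (by positivity), div_mul_cancel₀ _ hQp.ne']
    have hanti : StrictAnti fun n : ℕ => 1 / ((n : ℝ) + 1) := by
      intro i j hij
      have : (i : ℝ) < j := by exact_mod_cast hij
      exact one_div_lt_one_div_of_lt (by positivity) (by linarith)
    obtain ⟨h1, h2, h3, h4⟩ := exists_shells p₀ _ (Or.inl hanti) fun n => by positivity
    have hmax : ∀ n : ℕ, ∃ x ∈ Metric.closedBall p₀ (1 / ((n : ℝ) + 1)),
        IsMaxOn (fun p => |Q p - t|) (Metric.closedBall p₀ (1 / ((n : ℝ) + 1))) x := fun n =>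
      (isCompact_closedBall p₀ _).exists_isMaxOn ⟨p₀, Metric.mem_closedBall_self (by positivity)⟩
        (by fun_prop)
    choose x hx hxmax using hmax
    refine ⟨_, fun n => |Q (x n) - t|, h1, h2, h3, h4, ?_, fun n p hp => ?_⟩
    · have hxlim : Tendsto x atTop (𝓝 p₀) := by
        rw [tendsto_iff_dist_tendsto_zero]
        exact squeeze_zero (fun _ => dist_nonneg) (fun n => hx n)
          tendsto_one_div_add_atTop_nhds_zero_nat
      have := (((hQ.tendsto p₀).comp hxlim).sub_const t).abs
      rwa [hp₀, sub_self, abs_zero] at this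
    · refine hxmax n ?_
      rw [Metric.mem_closedBall, dist_eq_norm]
      have := hp.2
      rw [max_eq_left (hanti (Nat.lt_succ_self _)).le] at this
      exact this.le
  · have hmono : StrictMono fun n : ℕ => (n : ℝ) + 1 := by
      intro i j hij
      have : (i : ℝ) < j := by exact_mod_cast hij
      change (i : ℝ) + 1 < j + 1
      linarith
    obtain ⟨h1, h2, h3, h4⟩ := exists_shells (0 : E) _ (Or.inr hmono) fun n => by positivity
    refine ⟨_, h1, h2, h3, h4, c, hc, fun n p hp => ?_⟩
    have h5 := hp.1
    rw [min_eq_left (hmono (Nat.lt_succ_self _)).le, sub_zero] at h5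
    refine le_trans ?_ (hlow p)
    have : (n : ℝ) + 1 ≤ ‖p‖ ^ 2 := by
      have : (0 : ℝ) ≤ n := Nat.cast_nonneg n
      nlinarith
    gcongr

end Quadratic

/-! ### The elliptic operator in Fourier space -/

section Fourier

open FourierTransform TemperedDistribution

variable {E : Type*} [NormedAddCommGroup E] [InnerProductSpace ℝ E] [FiniteDimensional ℝ E]
  [MeasurableSpace E] [BorelSpace E]

/-- The product of a tempered distribution in `L²` with a smooth function is given by an `L²`
function exactly when that function is the pointwise product. -/
theorem smulLeftCLM_Lp_eq_iff {g : E → ℂ} (hg : g.HasTemperateGrowth)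
    (F U : Lp ℂ 2 (volume : Measure E)) :
    smulLeftCLM ℂ g (F : 𝓢'(E, ℂ)) = (U : 𝓢'(E, ℂ)) ↔ U =ᵐ[volume] fun x => g x * F x := by
  constructor
  · intro h
    refine ae_eq_of_integral_contDiff_smul_eq ((Lp.memLp U).locallyIntegrable one_le_two) ?_ ?_
    · have := ((Lp.memLp F).locallyIntegrable one_le_two).continuous_smul hg.1.continuous
      simpa [Function.comp_def, smul_eq_mul] using this
    · intro φ hφ hc
      have hg₁ : HasCompactSupport (Complex.ofRealCLM ∘ φ) := hc.comp_left rfl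
      have hg₂ : ContDiff ℝ ((⊤ : ℕ∞) : WithTop ℕ∞) (Complex.ofRealCLM ∘ φ) := by fun_prop
      have h1 := congrArg (fun T : 𝓢'(E, ℂ) => T (hg₁.toSchwartzMap hg₂)) h
      simp only [smulLeftCLM_apply_apply, Lp.toTemperedDistribution_apply] at h1
      have e1 : ∀ x, (hg₁.toSchwartzMap hg₂) x = (φ x : ℂ) := fun x => rfl
      simp only [SchwartzMap.smulLeftCLM_apply_apply hg, e1, smul_eq_mul] at h1
      simp only [Complex.real_smul]
      rw [← h1]
      refine integral_congr_ae (Eventually.of_forall fun x => ?_)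
      simp only
      ring
  · intro h
    ext φ
    simp only [smulLeftCLM_apply_apply, Lp.toTemperedDistribution_apply]
    refine integral_congr_ae ?_
    filter_upwards [h] with x hx
    rw [SchwartzMap.smulLeftCLM_apply_apply hg, hx, smul_eq_mul, smul_eq_mul, smul_eq_mul]
    ring

/-- Membership of an `L²` function in `H²` as a weighted bound for its Fourier transform. -/
theorem memSobolev_two_iff (f : Lp ℂ 2 (volume : Measure E)) :
    MemSobolev 2 2 (f : 𝓢'(E, ℂ)) ↔ ∃ g : Lp ℂ 2 (volume : Measure E),
      g =ᵐ[volume] fun x => ((1 + ‖x‖ ^ 2 : ℝ) : ℂ) * (𝓕 f : Lp ℂ 2 (volume : Measure E)) x := by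
  rw [memSobolev_iff_exists_smulLeftCLM_fourier]
  refine exists_congr fun g => ?_
  rw [Lp.fourier_toTemperedDistribution_eq, smulLeftCLM_Lp_eq_iff (by fun_prop)]
  norm_num

end Fourier

section Elliptic

open FourierTransform TemperedDistribution

variable {d : ℕ}

/-- The quadratic form of a matrix. -/
def matForm (Θ : Matrix (Fin d) (Fin d) ℝ) (p : EuclideanSpace ℝ (Fin d)) : ℝ :=
  ∑ i, ∑ j, Θ i j * (p i * p j)

/-- The symbol of `-Θ · ∇∇`, for the Fourier transform with kernel `exp (-2 π i x · p)`. -/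
def matSymbol (Θ : Matrix (Fin d) (Fin d) ℝ) (p : EuclideanSpace ℝ (Fin d)) : ℝ :=
  (2 * Real.pi) ^ 2 * matForm Θ p

theorem continuous_matSymbol (Θ : Matrix (Fin d) (Fin d) ℝ) : Continuous (matSymbol Θ) := by
  unfold matSymbol matForm
  fun_prop

theorem matForm_smul (Θ : Matrix (Fin d) (Fin d) ℝ) (s : ℝ) (p : EuclideanSpace ℝ (Fin d)) :
    matForm Θ (s • p) = s ^ 2 * matForm Θ p := by
  simp only [matForm, PiLp.smul_apply, smul_eq_mul, Finset.mul_sum]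
  refine Finset.sum_congr rfl fun i _ => Finset.sum_congr rfl fun j _ => ?_
  ring

/-- The Fourier transform turns `Θ · ∇∇` into multiplication by minus the symbol of `-Θ · ∇∇`. -/
theorem fourier_ellipticPart (Θ : Matrix (Fin d) (Fin d) ℝ) (f : 𝓢'(EuclideanSpace ℝ (Fin d), ℂ)) :
    𝓕 (HighContrastModel.ellipticPart Θ f) =
      smulLeftCLM ℂ (fun p => ((-matSymbol Θ p : ℝ) : ℂ)) (𝓕 f) := by
  have hi : ∀ i : Fin d, (fun p : EuclideanSpace ℝ (Fin d) =>
      ((inner ℝ p (EuclideanSpace.single i (1 : ℝ)) : ℝ) : ℂ)).HasTemperateGrowth := fun i => by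
    fun_prop
  have hmul : ∀ i j : Fin d, ((fun p : EuclideanSpace ℝ (Fin d) =>
      ((inner ℝ p (EuclideanSpace.single j (1 : ℝ)) : ℝ) : ℂ)) * fun p =>
      ((inner ℝ p (EuclideanSpace.single i (1 : ℝ)) : ℝ) : ℂ)).HasTemperateGrowth := fun i j =>
    (hi j).mul (hi i)
  have h1 : ∀ i j : Fin d, 𝓕 (∂_{(EuclideanSpace.single i (1 : ℝ))}
      (∂_{(EuclideanSpace.single j (1 : ℝ))} f)) =
      (2 * Real.pi * Complex.I) ^ 2 • smulLeftCLM ℂ ((fun p : EuclideanSpace ℝ (Fin d) =>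
      ((inner ℝ p (EuclideanSpace.single j (1 : ℝ)) : ℝ) : ℂ)) * fun p =>
      ((inner ℝ p (EuclideanSpace.single i (1 : ℝ)) : ℝ) : ℂ)) (𝓕 f) := by
    intro i j
    rw [fourier_lineDerivOp_eq, fourier_lineDerivOp_eq, map_smul,
      smulLeftCLM_smulLeftCLM_apply (hi j) (hi i), smul_smul, sq]
  have h2 : 𝓕 (HighContrastModel.ellipticPart Θ f) = ∑ i, ∑ j, (Θ i j : ℂ) •
      𝓕 (∂_{(EuclideanSpace.single i (1 : ℝ))} (∂_{(EuclideanSpace.single j (1 : ℝ))} f)) := by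
    change fourierCLM ℂ 𝓢'(EuclideanSpace ℝ (Fin d), ℂ) _ = _
    simp only [HighContrastModel.ellipticPart, map_sum, map_smul]
    rfl
  have h3 : (fun p => ((-matSymbol Θ p : ℝ) : ℂ)) = fun p => ∑ i, ∑ j,
      (((Θ i j : ℂ) * (2 * Real.pi * Complex.I) ^ 2) • ((fun p : EuclideanSpace ℝ (Fin d) =>
      ((inner ℝ p (EuclideanSpace.single j (1 : ℝ)) : ℝ) : ℂ)) * fun p =>
      ((inner ℝ p (EuclideanSpace.single i (1 : ℝ)) : ℝ) : ℂ))) p := by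
    funext p
    simp only [matSymbol, matForm, Pi.smul_apply, Pi.mul_apply, EuclideanSpace.inner_single_right]
    push_cast
    rw [← neg_mul, Finset.mul_sum]
    refine Finset.sum_congr rfl fun i _ => ?_
    rw [Finset.mul_sum]
    refine Finset.sum_congr rfl fun j _ => ?_
    simp only [mul_pow, Complex.I_sq, smul_eq_mul, conj_trivial, one_mul]
    ring
  have hsm : ∀ i j : Fin d, ((((Θ i j : ℂ) * (2 * Real.pi * Complex.I) ^ 2) •
      ((fun p : EuclideanSpace ℝ (Fin d) =>
      ((inner ℝ p (EuclideanSpace.single j (1 : ℝ)) : ℝ) : ℂ)) * fun p =>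
      ((inner ℝ p (EuclideanSpace.single i (1 : ℝ)) : ℝ) : ℂ)))).HasTemperateGrowth := fun i j =>
    (Function.HasTemperateGrowth.const _).mul (hmul i j)
  rw [h2, h3, smulLeftCLM_sum fun i _ => Function.HasTemperateGrowth.sum fun j _ => hsm i j]
  simp only [h1, sum_apply]
  refine Finset.sum_congr rfl fun i _ => ?_
  rw [smulLeftCLM_sum fun j _ => hsm i j]
  simp only [sum_apply]
  refine Finset.sum_congr rfl fun j _ => ?_
  rw [smulLeftCLM_smul (hmul i j), smul_smul]
  rfl

/-- The graph of `-Θ · ∇∇` on `H²(ℝ^d)`, defined in Fourier space. -/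
def ellipticGraph (Θ : Matrix (Fin d) (Fin d) ℝ) :
    Submodule ℂ (Lp ℂ 2 (volume : Measure (EuclideanSpace ℝ (Fin d))) ×
      Lp ℂ 2 (volume : Measure (EuclideanSpace ℝ (Fin d)))) :=
  (mulGraph (matSymbol Θ) volume).comap
    (((Lp.fourierTransformₗᵢ (EuclideanSpace ℝ (Fin d)) ℂ).toLinearEquiv.toLinearMap).prodMap
      ((Lp.fourierTransformₗᵢ (EuclideanSpace ℝ (Fin d)) ℂ).toLinearEquiv.toLinearMap))

theorem mem_ellipticGraph {Θ : Matrix (Fin d) (Fin d) ℝ}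
    {f u : Lp ℂ 2 (volume : Measure (EuclideanSpace ℝ (Fin d)))} :
    (f, u) ∈ ellipticGraph Θ ↔
      (𝓕 f, 𝓕 u) ∈ mulGraph (matSymbol Θ) (volume : Measure (EuclideanSpace ℝ (Fin d))) :=
  Iff.rfl

variable {Θ : Matrix (Fin d) (Fin d) ℝ} {c : ℝ}

/-- For a positive definite matrix, `-Θ · ∇∇` on `H²` has spectrum `[0, ∞)` and no eigenvalues. -/
theorem isHalfLineGraph_ellipticGraph [Nonempty (Fin d)] (hc : 0 < c)
    (hlow : ∀ p, c * ‖p‖ ^ 2 ≤ matForm Θ p) : IsHalfLineGraph (ellipticGraph Θ) := by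
  have h := isHalfLineGraph_quadratic (continuous_matSymbol Θ)
    (fun s p => by rw [matSymbol, matSymbol, matForm_smul]; ring)
    (show 0 < (2 * Real.pi) ^ 2 * c by positivity)
    (fun p => by rw [matSymbol, mul_assoc]; gcongr; exact hlow p)
  exact h.comap (Lp.fourierTransformₗᵢ (EuclideanSpace ℝ (Fin d)) ℂ) fun f u => Iff.rfl

/-- For a positive definite matrix, the graph in Fourier space is the graph of `-Θ · ∇∇` on the
Sobolev space `H²`, derivatives being taken in the sense of distributions. -/
theorem mem_ellipticGraph_iff_memSobolev (hc : 0 < c) (hlow : ∀ p, c * ‖p‖ ^ 2 ≤ matForm Θ p)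
    (f u : Lp ℂ 2 (volume : Measure (EuclideanSpace ℝ (Fin d)))) :
    (f, -u) ∈ ellipticGraph Θ ↔
      MemSobolev 2 2 (f : 𝓢'(EuclideanSpace ℝ (Fin d), ℂ)) ∧
      (u : 𝓢'(EuclideanSpace ℝ (Fin d), ℂ)) =
        HighContrastModel.ellipticPart Θ (f : 𝓢'(EuclideanSpace ℝ (Fin d), ℂ)) := by
  have hg : (fun p : EuclideanSpace ℝ (Fin d) =>
      ((-matSymbol Θ p : ℝ) : ℂ)).HasTemperateGrowth := by
    have : (fun p : EuclideanSpace ℝ (Fin d) => -matSymbol Θ p) = fun p => ∑ i, ∑ j,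
        (-((2 * Real.pi) ^ 2 * Θ i j)) *
          ((inner ℝ p (EuclideanSpace.single i (1 : ℝ)) : ℝ) *
          (inner ℝ p (EuclideanSpace.single j (1 : ℝ)) : ℝ)) := by
      funext p
      simp only [matSymbol, matForm, EuclideanSpace.inner_single_right, Finset.mul_sum,
        ← Finset.sum_neg_distrib]
      refine Finset.sum_congr rfl fun i _ => Finset.sum_congr rfl fun j _ => ?_
      simp only [conj_trivial, one_mul]
      ring
    have h2 : (fun p : EuclideanSpace ℝ (Fin d) => -matSymbol Θ p).HasTemperateGrowth := by
      rw [this]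
      fun_prop
    fun_prop
  have e1 : (u : 𝓢'(EuclideanSpace ℝ (Fin d), ℂ)) =
        HighContrastModel.ellipticPart Θ (f : 𝓢'(EuclideanSpace ℝ (Fin d), ℂ)) ↔
      (f, -u) ∈ ellipticGraph Θ := by
    have hinj : (u : 𝓢'(EuclideanSpace ℝ (Fin d), ℂ)) =
        HighContrastModel.ellipticPart Θ (f : 𝓢'(EuclideanSpace ℝ (Fin d), ℂ)) ↔
        𝓕 (u : 𝓢'(EuclideanSpace ℝ (Fin d), ℂ)) =
        𝓕 (HighContrastModel.ellipticPart Θ (f : 𝓢'(EuclideanSpace ℝ (Fin d), ℂ))) :=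
      ⟨fun h => by rw [h], fun h => by
        have := congrArg FourierTransformInv.fourierInv h
        rwa [fourierInv_fourier_eq, fourierInv_fourier_eq] at this⟩
    rw [hinj, fourier_ellipticPart, Lp.fourier_toTemperedDistribution_eq,
      Lp.fourier_toTemperedDistribution_eq, eq_comm, smulLeftCLM_Lp_eq_iff hg, mem_ellipticGraph,
      mem_mulGraph]
    have hneg : (𝓕 (-u) : Lp ℂ 2 (volume : Measure (EuclideanSpace ℝ (Fin d)))) = -𝓕 u :=
      (Lp.fourierTransformₗᵢ (EuclideanSpace ℝ (Fin d)) ℂ).map_neg u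
    rw [hneg]
    have hco := Lp.coeFn_neg (𝓕 u : Lp ℂ 2 (volume : Measure (EuclideanSpace ℝ (Fin d))))
    constructor
    · intro h
      filter_upwards [h, hco] with x h1 h2
      rw [h2, Pi.neg_apply, h1]
      push_cast
      ring
    · intro h
      filter_upwards [h, hco] with x h1 h2
      rw [h2, Pi.neg_apply] at h1
      rw [← neg_neg ((𝓕 u : Lp ℂ 2 (volume : Measure (EuclideanSpace ℝ (Fin d)))) x), h1]
      push_cast
      ring
  rw [e1]
  -- ellipticity: the symbol controls `‖p‖²`, so the distributional equation alone forces `f ∈ H²`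
  refine ⟨fun h => ⟨?_, h⟩, fun h => h.2⟩
  rw [memSobolev_two_iff]
  rw [mem_ellipticGraph, mem_mulGraph] at h
  have hπ : 0 < (2 * Real.pi) ^ 2 * c := by positivity
  set F : Lp ℂ 2 (volume : Measure (EuclideanSpace ℝ (Fin d))) := 𝓕 f
  set U : Lp ℂ 2 (volume : Measure (EuclideanSpace ℝ (Fin d))) := 𝓕 (-u)
  have hcont : Continuous fun x : EuclideanSpace ℝ (Fin d) => ((‖x‖ ^ 2 : ℝ) : ℂ) := by fun_prop
  have hx : MemLp (fun x => ((‖x‖ ^ 2 : ℝ) : ℂ) * F x) 2 volume := by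
    refine (Lp.memLp U).of_le_mul (c := ((2 * Real.pi) ^ 2 * c)⁻¹)
      (hcont.aestronglyMeasurable.mul (Lp.aestronglyMeasurable F)) ?_
    filter_upwards [h] with x hx
    rw [hx, norm_mul, norm_mul, Complex.norm_real, Complex.norm_real,
      Real.norm_of_nonneg (by positivity), ← mul_assoc]
    gcongr
    rw [← div_eq_inv_mul, le_div_iff₀ hπ, matSymbol, Real.norm_of_nonneg]
    · have := hlow x
      calc _ = (2 * Real.pi) ^ 2 * (c * ‖x‖ ^ 2) := by ring
        _ ≤ _ := by gcongr
    · have : 0 ≤ matForm Θ x := le_trans (by positivity) (hlow x)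
      positivity
  have hs := (Lp.memLp F).add hx
  refine ⟨hs.toLp _, ?_⟩
  filter_upwards [hs.coeFn_toLp] with x hx
  rw [hx, Pi.add_apply]
  push_cast
  ring

end Elliptic

/-! ### The integer lattice and periodisation -/

section Lattice

variable {d : ℕ}

theorem latticeVec_apply (n : Fin d → ℤ) (i : Fin d) : latticeVec n i = n i := rfl

theorem latticeVec_add (m n : Fin d → ℤ) :
    latticeVec (m + n) = latticeVec m + latticeVec n := by
  ext i
  simp [latticeVec_apply]

theorem latticeVec_zero : latticeVec (0 : Fin d → ℤ) = 0 := by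
  ext i
  simp [latticeVec_apply]

theorem latticeVec_neg (n : Fin d → ℤ) : latticeVec (-n) = -latticeVec n := by
  ext i
  simp [latticeVec_apply]

/-- The integer lattice acts on `ℝ^d` by translations. -/
instance latticeAction : AddAction (Fin d → ℤ) (EuclideanSpace ℝ (Fin d)) where
  vadd n x := x + latticeVec n
  zero_vadd x := by
    change x + latticeVec 0 = x
    rw [latticeVec_zero, add_zero]
  add_vadd m n x := by
    change x + latticeVec (m + n) = x + latticeVec n + latticeVec m
    rw [latticeVec_add]
    abel

instance : MeasurableConstVAdd (Fin d → ℤ) (EuclideanSpace ℝ (Fin d)) where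
  measurable_const_vadd n := measurable_id.add_const (latticeVec n)

instance : VAddInvariantMeasure (Fin d → ℤ) (EuclideanSpace ℝ (Fin d)) volume where
  measure_preimage_vadd n s _ := by
    change volume ((fun x => x + latticeVec n) ⁻¹' s) = volume s
    rw [measure_preimage_add_right]

theorem measurableSet_unitCell : MeasurableSet (unitCell d) := by
  have : unitCell d = ⋂ i, (fun x : EuclideanSpace ℝ (Fin d) => x i) ⁻¹' Set.Ico (0 : ℝ) 1 := by
    ext x
    simp [unitCell]
  rw [this]
  exact MeasurableSet.iInter fun i =>
    (show Measurable fun x : EuclideanSpace ℝ (Fin d) => x i by fun_prop) measurableSet_Ico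

theorem existsUnique_add_latticeVec_mem (x : EuclideanSpace ℝ (Fin d)) :
    ∃! n : Fin d → ℤ, x + latticeVec n ∈ unitCell d := by
  refine ⟨fun i => -⌊x i⌋, fun i => ?_, fun m hm => ?_⟩
  · rw [PiLp.add_apply, latticeVec_apply]
    push_cast
    exact ⟨by linarith [Int.floor_le (x i)], by linarith [Int.lt_floor_add_one (x i)]⟩
  · funext i
    have h := hm i
    rw [PiLp.add_apply, latticeVec_apply] at h
    have : ⌊x i⌋ = -m i := by
      rw [Int.floor_eq_iff]
      push_cast
      exact ⟨by linarith [h.1], by linarith [h.2]⟩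
    omega

theorem isAddFundamentalDomain_unitCell :
    IsAddFundamentalDomain (Fin d → ℤ) (unitCell d) volume :=
  IsAddFundamentalDomain.mk' measurableSet_unitCell.nullMeasurableSet
    existsUnique_add_latticeVec_mem

/-- The reflected and translated cell is again a fundamental domain. -/
theorem isAddFundamentalDomain_sub_unitCell (ξ : EuclideanSpace ℝ (Fin d)) :
    IsAddFundamentalDomain (Fin d → ℤ) ((fun x => ξ - x) ⁻¹' unitCell d) volume := by
  refine IsAddFundamentalDomain.mk' ((show Measurable fun x => ξ - x by fun_prop)
    measurableSet_unitCell).nullMeasurableSet fun x => ?_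
  obtain ⟨n, hn, hu⟩ := existsUnique_add_latticeVec_mem (ξ - x)
  refine ⟨-n, ?_, fun m hm => ?_⟩
  · change ξ - (x + latticeVec (-n)) ∈ unitCell d
    rw [latticeVec_neg]
    convert! hn using 1
    abel
  · have hm : ξ - (x + latticeVec m) ∈ unitCell d := hm
    rw [← hu (-m) (by
      change ξ - x + latticeVec (-m) ∈ unitCell d
      rw [latticeVec_neg]
      convert! hm using 1
      abel), neg_neg]

theorem lintegral_eq_tsum_unitCell (F : EuclideanSpace ℝ (Fin d) → ℝ≥0∞) :
    ∫⁻ x, F x = ∑' n : Fin d → ℤ, ∫⁻ x in unitCell d, F (x + latticeVec n) :=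
  isAddFundamentalDomain_unitCell.lintegral_eq_tsum'' F

/-- The integral of a periodic function over a cell is invariant under reflection and translation. -/
theorem setLIntegral_unitCell_sub {F : EuclideanSpace ℝ (Fin d) → ℝ≥0∞}
    (hF : ∀ (n : Fin d → ℤ) x, F (x + latticeVec n) = F x) (ξ : EuclideanSpace ℝ (Fin d)) :
    ∫⁻ x in unitCell d, F (ξ - x) = ∫⁻ x in unitCell d, F x := by
  have h1 := isAddFundamentalDomain_unitCell.setLIntegral_eq
    (isAddFundamentalDomain_sub_unitCell ξ) F (fun n x => hF n x)
  have hmp : MeasurePreserving (fun x : EuclideanSpace ℝ (Fin d) => ξ - x) volume volume :=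
    Measure.measurePreserving_sub_left volume ξ
  rw [h1, ← hmp.setLIntegral_comp_preimage_emb (MeasurableEquiv.subLeft ξ).measurableEmbedding]
  simp only [sub_sub_cancel]

theorem isBounded_unitCell : Bornology.IsBounded (unitCell d) := by
  refine (Metric.isBounded_closedBall (x := 0) (r := Real.sqrt d)).subset ?_
  intro x hx
  rw [mem_closedBall_zero_iff, EuclideanSpace.norm_eq]
  apply Real.sqrt_le_sqrt
  calc ∑ i, ‖x i‖ ^ 2 ≤ ∑ _i : Fin d, (1 : ℝ) := by
        refine Finset.sum_le_sum fun i _ => ?_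
        rw [Real.norm_eq_abs, sq_abs]
        have h := hx i
        nlinarith [h.1, h.2]
    _ = d := by simp

theorem volume_unitCell_lt_top : volume (unitCell d) < ∞ :=
  isBounded_unitCell.measure_lt_top

/-- A property invariant under countably many translations that holds almost everywhere on a set
whose translates cover the space holds almost everywhere. -/
theorem ae_of_ae_translate {X ι : Type*} [AddGroup X] [MeasurableSpace X] [MeasurableAdd X]
    {μ : Measure X} [μ.IsAddRightInvariant] [Countable ι] (t : ι → X) {S : Set X} {P : X → Prop}
    (hP : ∀ᵐ x ∂μ, x ∈ S → P x) (hcov : ∀ x, ∃ i, x + t i ∈ S) (hper : ∀ i x, P (x + t i) → P x) :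
    ∀ᵐ x ∂μ, P x := by
  have h : ∀ᵐ x ∂μ, ∀ i, x + t i ∈ S → P (x + t i) := by
    rw [ae_all_iff]
    exact fun i => (measurePreserving_add_right μ (t i)).quasiMeasurePreserving.ae hP
  filter_upwards [h] with x hx
  obtain ⟨i, hi⟩ := hcov x
  exact hper i x (hx i hi)

/-- Properties of pairs that are invariant under independent lattice translations of the two points
need only be checked on one cell. -/
theorem ae_prod_of_ae_unitCell {P : EuclideanSpace ℝ (Fin d) × EuclideanSpace ℝ (Fin d) → Prop}
    (hP : ∀ᵐ p ∂(volume.prod volume), p.1 ∈ unitCell d → p.2 ∈ unitCell d → P p)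
    (hper : ∀ (m n : Fin d → ℤ) x y, P (x + latticeVec m, y + latticeVec n) → P (x, y)) :
    ∀ᵐ p ∂(volume.prod volume), P p := by
  refine ae_of_ae_translate (ι := (Fin d → ℤ) × (Fin d → ℤ))
    (fun i => (latticeVec i.1, latticeVec i.2)) (S := unitCell d ×ˢ unitCell d) ?_ ?_ ?_
  · filter_upwards [hP] with p hp h
    exact hp h.1 h.2
  · rintro ⟨x, y⟩
    obtain ⟨m, hm, -⟩ := existsUnique_add_latticeVec_mem x
    obtain ⟨n, hn, -⟩ := existsUnique_add_latticeVec_mem y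
    exact ⟨(m, n), hm, hn⟩
  · rintro ⟨m, n⟩ ⟨x, y⟩ h
    exact hper m n x y h

/-- Properties of pairs that are invariant under simultaneous lattice translations need only be
checked when the second point lies in one cell. -/
theorem ae_prod_of_ae_unitCell_diag
    {P : EuclideanSpace ℝ (Fin d) × EuclideanSpace ℝ (Fin d) → Prop}
    (hP : ∀ᵐ p ∂(volume.prod volume), p.2 ∈ unitCell d → P p)
    (hper : ∀ (n : Fin d → ℤ) x y, P (x + latticeVec n, y + latticeVec n) → P (x, y)) :
    ∀ᵐ p ∂(volume.prod volume), P p := by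
  refine ae_of_ae_translate (ι := Fin d → ℤ)
    (fun n => (latticeVec n, latticeVec n)) (S := {p | p.2 ∈ unitCell d}) hP ?_ ?_
  · rintro ⟨x, y⟩
    obtain ⟨n, hn, -⟩ := existsUnique_add_latticeVec_mem y
    exact ⟨n, hn⟩
  · rintro n ⟨x, y⟩ h
    exact hper n x y h

theorem ae_of_ae_unitCell {P : EuclideanSpace ℝ (Fin d) → Prop}
    (hP : ∀ᵐ x, x ∈ unitCell d → P x)
    (hper : ∀ (n : Fin d → ℤ) x, P (x + latticeVec n) → P x) : ∀ᵐ x, P x :=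
  ae_of_ae_translate (fun n : Fin d → ℤ => latticeVec n) hP
    (fun x => (existsUnique_add_latticeVec_mem x).exists) hper

/-- The integral over one cell times the whole space is symmetric in the two variables, for
functions invariant under diagonal lattice translations. -/
theorem lintegral_cell_swap
    {F : EuclideanSpace ℝ (Fin d) → EuclideanSpace ℝ (Fin d) → ℝ≥0∞}
    (hF : Measurable (Function.uncurry F))
    (hper : ∀ (n : Fin d → ℤ) x y, F (x + latticeVec n) (y + latticeVec n) = F x y) :
    ∫⁻ y in unitCell d, ∫⁻ x, F x y = ∫⁻ x in unitCell d, ∫⁻ y, F x y := by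
  have hsh : ∀ n : Fin d → ℤ, Measurable fun p : EuclideanSpace ℝ (Fin d) ×
      EuclideanSpace ℝ (Fin d) => F (p.2 + latticeVec n) p.1 := fun n =>
    hF.comp ((measurable_snd.add_const _).prodMk measurable_fst)
  have hsh' : ∀ n : Fin d → ℤ, Measurable fun p : EuclideanSpace ℝ (Fin d) ×
      EuclideanSpace ℝ (Fin d) => F p.1 (p.2 + latticeVec n) := fun n =>
    hF.comp (measurable_fst.prodMk (measurable_snd.add_const _))
  calc ∫⁻ y in unitCell d, ∫⁻ x, F x y
      = ∫⁻ y in unitCell d, ∑' n : Fin d → ℤ, ∫⁻ x in unitCell d, F (x + latticeVec n) y := by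
        simp only [lintegral_eq_tsum_unitCell]
    _ = ∑' n : Fin d → ℤ, ∫⁻ y in unitCell d, ∫⁻ x in unitCell d, F (x + latticeVec n) y :=
        lintegral_tsum fun n => (hsh n).lintegral_prod_right'.aemeasurable
    _ = ∑' n : Fin d → ℤ, ∫⁻ x in unitCell d, ∫⁻ y in unitCell d, F (x + latticeVec n) y := by
        refine tsum_congr fun n => lintegral_lintegral_swap (hsh n).aemeasurable
    _ = ∑' n : Fin d → ℤ, ∫⁻ x in unitCell d, ∫⁻ y in unitCell d, F x (y + latticeVec (-n)) := by
        refine tsum_congr fun n => ?_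
        refine lintegral_congr fun x => lintegral_congr fun y => ?_
        rw [← hper n x, latticeVec_neg, neg_add_cancel_right]
    _ = ∑' n : Fin d → ℤ, ∫⁻ x in unitCell d, ∫⁻ y in unitCell d, F x (y + latticeVec n) :=
        (Equiv.neg (Fin d → ℤ)).tsum_eq
          fun n => ∫⁻ x in unitCell d, ∫⁻ y in unitCell d, F x (y + latticeVec n)
    _ = ∫⁻ x in unitCell d, ∑' n : Fin d → ℤ, ∫⁻ y in unitCell d, F x (y + latticeVec n) :=
        (lintegral_tsum fun n => (hsh' n).lintegral_prod_right'.aemeasurable).symm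
    _ = ∫⁻ x in unitCell d, ∫⁻ y, F x y := by
        simp only [lintegral_eq_tsum_unitCell]

end Lattice

/-! ### The periodisation of the kernel -/

namespace HighContrastModel

variable {d : ℕ} (M : HighContrastModel d)

/-- The periodisation of `a` with values in `[0, ∞]`, where the lattice sum need not converge. -/
def aTildeE (ξ : EuclideanSpace ℝ (Fin d)) : ℝ≥0∞ :=
  ∑' n : Fin d → ℤ, ENNReal.ofReal (M.a (ξ + latticeVec n))

theorem aTilde_eq_toReal (ξ : EuclideanSpace ℝ (Fin d)) : M.aTilde ξ = (M.aTildeE ξ).toReal := by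
  rw [aTildeE, ENNReal.tsum_toReal_eq fun _ => ENNReal.ofReal_ne_top, aTilde]
  exact tsum_congr fun n => (ENNReal.toReal_ofReal (M.a_nonneg _)).symm

theorem measurable_aTildeE : Measurable M.aTildeE :=
  Measurable.tsum fun _ =>
    ENNReal.measurable_ofReal.comp (M.a_measurable.comp (measurable_id.add_const _))

theorem measurable_aTilde : Measurable M.aTilde := by
  have : M.aTilde = fun ξ => (M.aTildeE ξ).toReal := funext M.aTilde_eq_toReal
  rw [this]
  exact M.measurable_aTildeE.ennreal_toReal

theorem aTilde_nonneg (ξ : EuclideanSpace ℝ (Fin d)) : 0 ≤ M.aTilde ξ := by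
  rw [aTilde_eq_toReal]
  exact ENNReal.toReal_nonneg

theorem aTildeE_periodic (n : Fin d → ℤ) (ξ : EuclideanSpace ℝ (Fin d)) :
    M.aTildeE (ξ + latticeVec n) = M.aTildeE ξ := by
  rw [aTildeE, aTildeE, ← (Equiv.addLeft n).tsum_eq
    fun m => ENNReal.ofReal (M.a (ξ + latticeVec m))]
  refine tsum_congr fun m => ?_
  rw [Equiv.coe_addLeft, latticeVec_add, add_assoc]

theorem aTilde_periodic (n : Fin d → ℤ) (ξ : EuclideanSpace ℝ (Fin d)) :
    M.aTilde (ξ + latticeVec n) = M.aTilde ξ := by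
  rw [aTilde_eq_toReal, aTildeE_periodic, aTilde_eq_toReal]

theorem aTilde_neg (ξ : EuclideanSpace ℝ (Fin d)) : M.aTilde (-ξ) = M.aTilde ξ := by
  rw [aTilde, aTilde, ← (Equiv.neg (Fin d → ℤ)).tsum_eq fun m => M.a (ξ + latticeVec m)]
  refine tsum_congr fun m => ?_
  rw [Equiv.neg_apply, latticeVec_neg, ← M.a_even]
  congr 1
  abel

theorem aTilde_sub_comm (ξ η : EuclideanSpace ℝ (Fin d)) :
    M.aTilde (ξ - η) = M.aTilde (η - ξ) := by
  rw [← M.aTilde_neg, neg_sub]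

theorem a_sub_comm (ξ η : EuclideanSpace ℝ (Fin d)) : M.a (ξ - η) = M.a (η - ξ) := by
  rw [← M.a_even, neg_sub]

/-- Integrating the periodisation against a periodic function over a cell unfolds to the integral
of `a` over the whole space. -/
theorem lintegral_cell_aTildeE_mul {h : EuclideanSpace ℝ (Fin d) → ℝ≥0∞} (hh : Measurable h)
    (hper : ∀ (n : Fin d → ℤ) x, h (x + latticeVec n) = h x) (ξ : EuclideanSpace ℝ (Fin d)) :
    ∫⁻ η in unitCell d, M.aTildeE (ξ - η) * h η = ∫⁻ η, ENNReal.ofReal (M.a (ξ - η)) * h η := by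
  have hm : ∀ n : Fin d → ℤ, Measurable fun η : EuclideanSpace ℝ (Fin d) =>
      ENNReal.ofReal (M.a (ξ - η + latticeVec n)) * h η := fun n =>
    (ENNReal.measurable_ofReal.comp (M.a_measurable.comp (by fun_prop))).mul hh
  rw [lintegral_eq_tsum_unitCell, ← (Equiv.neg (Fin d → ℤ)).tsum_eq, ← lintegral_tsum]
  · refine lintegral_congr fun η => ?_
    rw [aTildeE, ← ENNReal.tsum_mul_right]
    refine tsum_congr fun n => ?_
    rw [hper, Equiv.neg_apply, latticeVec_neg]
    congr 3
    abel
  · intro n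
    exact ((ENNReal.measurable_ofReal.comp (M.a_measurable.comp (by fun_prop))).mul
      (hh.comp (by fun_prop))).aemeasurable

theorem lintegral_ofReal_a : ∫⁻ z, ENNReal.ofReal (M.a z) = ENNReal.ofReal (∫ z, M.a z) :=
  (ofReal_integral_eq_lintegral_ofReal M.a_integrable
    (Eventually.of_forall M.a_nonneg)).symm

/-- The lattice sum defining `ã` converges almost everywhere, since its integral over a cell is the
integral of `a`; elsewhere `ã` takes the junk value zero. -/
theorem ae_aTildeE_lt_top : ∀ᵐ z, M.aTildeE z < ∞ := by
  refine ae_of_ae_unitCell ?_ fun n x hx => by rwa [aTildeE_periodic] at hx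
  rw [← ae_restrict_iff' measurableSet_unitCell]
  refine ae_lt_top M.measurable_aTildeE ?_
  have h := M.lintegral_cell_aTildeE_mul (h := fun _ => 1) measurable_const (fun _ _ => rfl) 0
  simp only [mul_one] at h
  rw [setLIntegral_unitCell_sub M.aTildeE_periodic] at h
  rw [h]
  simp only [zero_sub, M.a_even, lintegral_ofReal_a]
  exact ENNReal.ofReal_ne_top

theorem ae_aTildeE_sub_lt_top (ξ : EuclideanSpace ℝ (Fin d)) :
    ∀ᵐ η, M.aTildeE (ξ - η) < ∞ :=
  (Measure.measurePreserving_sub_left volume ξ).quasiMeasurePreserving.ae M.ae_aTildeE_lt_top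

theorem ofReal_aTilde {z : EuclideanSpace ℝ (Fin d)} (hz : M.aTildeE z < ∞) :
    ENNReal.ofReal (M.aTilde z) = M.aTildeE z := by
  rw [aTilde_eq_toReal, ENNReal.ofReal_toReal hz.ne]

theorem a_le_aTilde {z : EuclideanSpace ℝ (Fin d)} (hz : M.aTildeE z < ∞) :
    M.a z ≤ M.aTilde z := by
  rw [← ENNReal.ofReal_le_ofReal_iff (M.aTilde_nonneg z), M.ofReal_aTilde hz]
  have := ENNReal.le_tsum (f := fun n : Fin d → ℤ => ENNReal.ofReal (M.a (z + latticeVec n))) 0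
  rwa [latticeVec_zero, add_zero] at this

theorem lintegral_cell_aTilde_mul {h : EuclideanSpace ℝ (Fin d) → ℝ≥0∞} (hh : Measurable h)
    (hper : ∀ (n : Fin d → ℤ) x, h (x + latticeVec n) = h x) (ξ : EuclideanSpace ℝ (Fin d)) :
    ∫⁻ η in unitCell d, ENNReal.ofReal (M.aTilde (ξ - η)) * h η =
      ∫⁻ η, ENNReal.ofReal (M.a (ξ - η)) * h η := by
  rw [← M.lintegral_cell_aTildeE_mul hh hper]
  refine lintegral_congr_ae (ae_restrict_of_ae ?_)
  filter_upwards [M.ae_aTildeE_sub_lt_top ξ] with η hη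
  rw [M.ofReal_aTilde hη]

theorem integrable_a_sub (ξ : EuclideanSpace ℝ (Fin d)) : Integrable fun η => M.a (ξ - η) :=
  M.a_integrable.comp_sub_left ξ

theorem lintegral_cell_aTilde (ξ : EuclideanSpace ℝ (Fin d)) :
    ∫⁻ η in unitCell d, ENNReal.ofReal (M.aTilde (ξ - η)) = ENNReal.ofReal (∫ z, M.a z) := by
  have h := M.lintegral_cell_aTilde_mul (h := fun _ => 1) measurable_const (fun _ _ => rfl) ξ
  simp only [mul_one] at h
  rw [h, ← ofReal_integral_eq_lintegral_ofReal (M.integrable_a_sub ξ)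
    (Eventually.of_forall fun _ => M.a_nonneg _), integral_sub_left_eq_self]

theorem integral_cell_aTilde (ξ : EuclideanSpace ℝ (Fin d)) :
    ∫ η in unitCell d, M.aTilde (ξ - η) = ∫ z, M.a z := by
  rw [integral_eq_lintegral_of_nonneg_ae (Eventually.of_forall fun _ => M.aTilde_nonneg _)
    (M.measurable_aTilde.comp (by fun_prop)).aestronglyMeasurable, lintegral_cell_aTilde,
    ENNReal.toReal_ofReal (integral_nonneg M.a_nonneg)]

theorem enorm_aTilde_mul (x : EuclideanSpace ℝ (Fin d)) (r : ℝ) :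
    ‖M.aTilde x * r‖ₑ = ENNReal.ofReal (M.aTilde x) * ‖r‖ₑ := by
  rw [enorm_mul, Real.enorm_of_nonneg (M.aTilde_nonneg x)]

theorem enorm_a_mul (x : EuclideanSpace ℝ (Fin d)) (r : ℝ) :
    ‖M.a x * r‖ₑ = ENNReal.ofReal (M.a x) * ‖r‖ₑ := by
  rw [enorm_mul, Real.enorm_of_nonneg (M.a_nonneg x)]

/-- Unfolding of Bochner integrals against the periodisation. -/
theorem integral_cell_aTilde_mul {h : EuclideanSpace ℝ (Fin d) → ℝ} (hh : Measurable h)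
    (hper : ∀ (n : Fin d → ℤ) x, h (x + latticeVec n) = h x) {ξ : EuclideanSpace ℝ (Fin d)}
    (hi : Integrable fun η => M.a (ξ - η) * h η) :
    IntegrableOn (fun η => M.aTilde (ξ - η) * h η) (unitCell d) ∧
      ∫ η in unitCell d, M.aTilde (ξ - η) * h η = ∫ η, M.a (ξ - η) * h η := by
  have hmt : Measurable fun η => M.aTilde (ξ - η) := M.measurable_aTilde.comp (by fun_prop)
  have h1 : IntegrableOn (fun η => M.aTilde (ξ - η) * h η) (unitCell d) := by
    refine ⟨(hmt.mul hh).aestronglyMeasurable, ?_⟩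
    rw [HasFiniteIntegral]
    simp only [enorm_aTilde_mul]
    rw [M.lintegral_cell_aTilde_mul hh.enorm fun n x => by rw [hper]]
    have := hi.2
    rw [HasFiniteIntegral] at this
    simpa only [enorm_a_mul] using this
  refine ⟨h1, ?_⟩
  rw [integral_eq_lintegral_pos_part_sub_lintegral_neg_part h1,
    integral_eq_lintegral_pos_part_sub_lintegral_neg_part hi]
  have e1 : ∀ {r s : ℝ}, 0 ≤ r → ENNReal.ofReal (r * s) = ENNReal.ofReal r * ENNReal.ofReal s :=
    fun hr => ENNReal.ofReal_mul hr
  simp only [← mul_neg]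
  simp only [e1 (M.aTilde_nonneg _), e1 (M.a_nonneg _)]
  rw [M.lintegral_cell_aTilde_mul (h := fun η => ENNReal.ofReal (h η)) (by fun_prop)
    (fun n x => by rw [hper]), M.lintegral_cell_aTilde_mul (h := fun η => ENNReal.ofReal (-h η))
    (by fun_prop) (fun n x => by rw [hper])]

end HighContrastModel

/-! ### Null sets and local constancy -/

section Geometry

variable {d : ℕ}

/-- The graph of a function over a hyperplane is null: its translates in the normal direction are
the level sets of one function, so only countably many of them can have positive measure. -/
theorem volume_graph_eq_zero {e : EuclideanSpace ℝ (Fin d)} (he : ‖e‖ = 1)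
    {γ : EuclideanSpace ℝ (Fin d) → ℝ} (hγ : Continuous γ) :
    volume {y : EuclideanSpace ℝ (Fin d) | γ (y - inner ℝ e y • e) = inner ℝ e y} = 0 := by
  set g : EuclideanSpace ℝ (Fin d) → ℝ := fun y => inner ℝ e y - γ (y - inner ℝ e y • e) with hg
  have hgc : Continuous g := by fun_prop
  have hsh : ∀ (t : ℝ) y, g (y + t • e) = g y + t := by
    intro t y
    have h1 : inner ℝ e (y + t • e) = inner ℝ e y + t := by
      rw [inner_add_right, inner_smul_right, real_inner_self_eq_norm_sq, he]
      ring
    simp only [hg, h1, add_smul, add_sub_add_right_eq_sub]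
    ring
  have hmeas : ∀ t : ℝ, volume {y | g y = 0} = volume {y | g y = t} := by
    intro t
    have : {y | g y = 0} = (fun y => y + t • e) ⁻¹' {y | g y = t} := by
      ext y
      simp only [Set.mem_ofPred_eq, Set.mem_preimage, hsh]
      constructor <;> intro h <;> linarith
    rw [this, measure_preimage_add_right]
  have h0 : volume {y | g y = 0} = 0 := by
    by_contra hcon
    have hcount := Measure.countable_meas_level_set_pos
      (μ := (volume : Measure (EuclideanSpace ℝ (Fin d)))) hgc.measurable
    have huniv : (Set.univ : Set ℝ).Countable := by
      refine Set.Countable.mono (fun t _ => ?_) hcount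
      rw [Set.mem_ofPred_eq, ← hmeas t]
      exact pos_iff_ne_zero.2 hcon
    simpa using huniv.measure_zero volume
  refine measure_mono_null (fun y hy => ?_) h0
  have hy : γ (y - inner ℝ e y • e) = inner ℝ e y := hy
  simp [hg, hy]

/-- A Lipschitz boundary is null, since it lies locally on the graph of a continuous function. -/
theorem HasLipschitzBoundary.volume_frontier {U : Set (EuclideanSpace ℝ (Fin d))}
    (hU : HasLipschitzBoundary U) : volume (frontier U) = 0 := by
  refine measure_null_of_locally_null _ fun x hx => ?_
  obtain ⟨e, γ, C, r, he, hγ, hr, hball⟩ := hU x hx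
  refine ⟨frontier U ∩ Metric.ball x r, inter_mem_nhdsWithin _ (Metric.ball_mem_nhds x hr), ?_⟩
  refine measure_mono_null ?_ (volume_graph_eq_zero he hγ.continuous)
  rintro y ⟨hy, hyr⟩
  have hγc : Continuous fun y => γ (y - inner ℝ e y • e) := hγ.continuous.comp (by fun_prop)
  have hec : Continuous fun y : EuclideanSpace ℝ (Fin d) => (inner ℝ e y : ℝ) := by fun_prop
  have hb : ∀ᶠ z in 𝓝 y, z ∈ Metric.ball x r := Metric.isOpen_ball.mem_nhds hyr
  rcases lt_trichotomy (γ (y - inner ℝ e y • e)) (inner ℝ e y) with h | h | h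
  · have h1 : ∀ᶠ z in 𝓝 y, γ (z - inner ℝ e z • e) < inner ℝ e z :=
      (isOpen_lt hγc hec).mem_nhds h
    have h2 : U ∈ 𝓝 y := by
      filter_upwards [hb, h1] with z hz hz'
      exact (hball z hz).2 hz'
    exact absurd (mem_interior_iff_mem_nhds.2 h2) hy.2
  · exact h
  · have h1 : ∀ᶠ z in 𝓝 y, inner ℝ e z < γ (z - inner ℝ e z • e) :=
      (isOpen_lt hec hγc).mem_nhds h
    have h2 : Uᶜ ∈ 𝓝 y := by
      filter_upwards [hb, h1] with z hz hz' hzU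
      exact absurd ((hball z hz).1 hzU) (not_lt.2 hz'.le)
    have h3 : y ∈ (closure U)ᶜ := by
      rw [← interior_compl]
      exact mem_interior_iff_mem_nhds.2 h2
    exact absurd hy.1 h3

theorem ball_subset_essPosSet {a : EuclideanSpace ℝ (Fin d) → ℝ} {r₀ : ℝ}
    (ha : ∀ z, ‖z‖ ≤ r₀ → 0 < a z) : Metric.ball 0 r₀ ⊆ essPosSet a := by
  intro z hz U hU
  have h1 : U ∩ Metric.ball 0 r₀ ∈ 𝓝 z := inter_mem hU (Metric.isOpen_ball.mem_nhds hz)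
  refine (Measure.measure_pos_of_mem_nhds volume h1).trans_le
    (measure_mono fun y hy => ⟨hy.1, ha y ?_⟩)
  exact (mem_ball_zero_iff.1 hy.2).le

/-- If `a` is positive near the origin, any two points of the whole space are joined by short jumps
along a segment. -/
theorem reflTransGen_univ {a : EuclideanSpace ℝ (Fin d) → ℝ} {r₀ : ℝ} (hr₀ : 0 < r₀)
    (ha : ∀ z, ‖z‖ ≤ r₀ → 0 < a z) (x y : EuclideanSpace ℝ (Fin d)) :
    Relation.ReflTransGen (fun p q => q ∈ (Set.univ : Set (EuclideanSpace ℝ (Fin d))) ∧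
      p - q ∈ essPosSet a) x y := by
  obtain ⟨N, hN⟩ := exists_nat_gt (‖y - x‖ / r₀)
  have hN0 : (0 : ℝ) < N := lt_of_le_of_lt (by positivity) hN
  set v : EuclideanSpace ℝ (Fin d) := (N : ℝ)⁻¹ • (y - x) with hv
  have hvr : ‖v‖ < r₀ := by
    rw [hv, norm_smul, norm_inv, Real.norm_of_nonneg hN0.le, inv_mul_lt_iff₀ hN0]
    rwa [div_lt_iff₀ hr₀] at hN
  have hk : ∀ k : ℕ, Relation.ReflTransGen (fun p q =>
      q ∈ (Set.univ : Set (EuclideanSpace ℝ (Fin d))) ∧ p - q ∈ essPosSet a) x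
      (x + (k : ℝ) • v) := by
    intro k
    induction k with
    | zero => simpa using Relation.ReflTransGen.refl
    | succ k ih =>
      refine ih.tail ⟨Set.mem_univ _, ball_subset_essPosSet ha ?_⟩
      have : x + (k : ℝ) • v - (x + ((k + 1 : ℕ) : ℝ) • v) = -v := by
        push_cast
        rw [add_smul, one_smul]
        abel
      rw [this, mem_ball_zero_iff, norm_neg]
      exact hvr
  have := hk N
  rwa [hv, smul_inv_smul₀ hN0.ne', add_sub_cancel] at this

/-- A function that takes equal values at almost all pairs of points of `U` whose difference lies in
`{a > 0}` is almost everywhere constant on `U`, if `U` is connected by jumps in the essential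
support of `a`. Such a function is constant near every point, and a jump preserves the value. -/
theorem exists_ae_eq_const_of_jump {β : Type*} {U : Set (EuclideanSpace ℝ (Fin d))} (hU : IsOpen U)
    (hne : U.Nonempty) {a : EuclideanSpace ℝ (Fin d) → ℝ} {r₀ : ℝ}
    (hr₀ : 0 < r₀) (hpos : ∀ z, ‖z‖ ≤ r₀ → 0 < a z)
    (hconn : ∀ x ∈ U, ∀ y ∈ U, Relation.ReflTransGen (fun p q => q ∈ U ∧ p - q ∈ essPosSet a) x y)
    {u : EuclideanSpace ℝ (Fin d) → β}
    (hu : ∀ᵐ p ∂(volume.prod volume), p.1 ∈ U → p.2 ∈ U → 0 < a (p.1 - p.2) → u p.1 = u p.2) :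
    ∃ k, ∀ᵐ x, x ∈ U → u x = k := by
  have hu1 : ∀ᵐ η, ∀ᵐ ξ, ξ ∈ U → η ∈ U → 0 < a (ξ - η) → u ξ = u η :=
    Measure.ae_ae_of_ae_prod (Measure.measurePreserving_swap.quasiMeasurePreserving.ae hu)
  -- `P x k`: the function is almost everywhere equal to `k` near `x`
  let P : EuclideanSpace ℝ (Fin d) → β → Prop := fun x k =>
    ∃ r > 0, Metric.ball x r ⊆ U ∧ ∀ᵐ y, y ∈ Metric.ball x r → u y = k
  have hex : ∀ (x : EuclideanSpace ℝ (Fin d)) (r : ℝ), 0 < r → ∀ {p : EuclideanSpace ℝ (Fin d) →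
      Prop}, (∀ᵐ y, p y) → ∃ y ∈ Metric.ball x r, p y := by
    intro x r hr p hp
    by_contra! hcon
    have h1 : ∀ᵐ y, y ∉ Metric.ball x r := by
      filter_upwards [hp] with y hy hyr
      exact hcon y hyr hy
    have h2 : volume (Metric.ball x r) = 0 := measure_eq_zero_iff_ae_notMem.2 h1
    exact (Metric.measure_ball_pos volume x hr).ne' h2
  have hloc : ∀ x ∈ U, ∃ k, P x k := by
    intro x hx
    obtain ⟨r, hr, hrU⟩ := Metric.isOpen_iff.1 hU x hx
    set s := min r (r₀ / 2) with hs
    have hs0 : 0 < s := lt_min hr (by positivity)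
    have hsU : Metric.ball x s ⊆ U := (Metric.ball_subset_ball (min_le_left _ _)).trans hrU
    obtain ⟨η, hη, h⟩ := hex x s hs0 hu1
    refine ⟨u η, s, hs0, hsU, ?_⟩
    filter_upwards [h] with ξ h1 hξ
    refine h1 (hsU hξ) (hsU hη) (hpos _ ?_)
    rw [← dist_eq_norm]
    have := dist_triangle_right ξ η x
    have h2 : s ≤ r₀ / 2 := min_le_right _ _
    rw [Metric.mem_ball] at hξ hη
    linarith
  have hstep : ∀ x q k, P x k → q ∈ U → x - q ∈ essPosSet a → P q k := by
    rintro x q k ⟨r, hr, hrU, hk⟩ hq hxq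
    obtain ⟨k', r', hr', hrU', hk'⟩ := hloc q hq
    suffices h : k = k' by
      rw [h]
      exact ⟨r', hr', hrU', hk'⟩
    by_contra hkk
    set s := min r' (r / 2) with hs
    have hs0 : 0 < s := lt_min hr' (by positivity)
    obtain ⟨η, hη, h1, h2⟩ := hex q s hs0 (hu1.and hk')
    have hη' : η ∈ Metric.ball q r' := Metric.ball_subset_ball (min_le_left _ _) hη
    have hZ := hxq (Metric.ball (x - q) s) (Metric.ball_mem_nhds _ hs0)
    -- the `ξ` near `x` with `a (ξ - η) > 0` form a set of positive measure; there `u ξ = u η`, while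
    -- `u ξ = k` almost everywhere, so that the values near `x` and near `q` agree
    rw [← measure_preimage_add_right volume (-η)] at hZ
    refine hZ.ne' ?_
    have h3 : ∀ᵐ ξ, ¬ ξ ∈ (fun h => h + -η) ⁻¹' {y ∈ Metric.ball (x - q) s | 0 < a y} := by
      filter_upwards [h1, hk] with ξ h4 h5 hξ
      obtain ⟨hξ1, hξ2⟩ := hξ
      have hξr : ξ ∈ Metric.ball x r := by
        rw [Metric.mem_ball, dist_eq_norm] at hξ1 hη ⊢
        have e1 : ξ - x = (ξ + -η - (x - q)) + (η - q) := by abel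
        have e2 := norm_add_le (ξ + -η - (x - q)) (η - q)
        have e3 : s ≤ r / 2 := min_le_right _ _
        rw [e1]
        linarith
      have hξ2 : 0 < a (ξ - η) := by rwa [sub_eq_add_neg]
      exact hkk ((h5 hξr).symm.trans ((h4 (hrU hξr) (hrU' hη') hξ2).trans (h2 hη')))
    rw [ae_iff] at h3
    simpa using h3
  obtain ⟨x₀, hx₀⟩ := hne
  obtain ⟨k, hk⟩ := hloc x₀ hx₀
  have hall : ∀ x ∈ U, P x k := by
    intro x hx
    have hmem : ∀ y, Relation.ReflTransGen (fun p q => q ∈ U ∧ p - q ∈ essPosSet a) x₀ y →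
        P y k := by
      intro y hy
      induction hy with
      | refl => exact hk
      | tail _ h ih => exact hstep _ _ k ih h.1 h.2
    exact hmem x (hconn x₀ hx₀ x hx)
  refine ⟨k, ?_⟩
  rw [ae_iff]
  refine measure_null_of_locally_null _ fun x hx => ?_
  have hxU : x ∈ U := by
    by_contra h
    exact hx fun h' => absurd h' h
  obtain ⟨r, hr, -, h⟩ := hall x hxU
  refine ⟨_, inter_mem_nhdsWithin _ (Metric.ball_mem_nhds x hr), ?_⟩
  rw [ae_iff] at h
  refine measure_mono_null ?_ h
  rintro y ⟨hy1, hy2⟩ hy3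
  exact hy1 fun _ => hy3 hy2

/-- Sets of positive measure contain subsets of arbitrarily small positive measure. -/
theorem exists_subset_measure_lt {S : Set (EuclideanSpace ℝ (Fin d))}
    {μ : Measure (EuclideanSpace ℝ (Fin d))} [IsLocallyFiniteMeasure μ] [NullSingletonClass μ]
    (hS : MeasurableSet S) (h0 : 0 < μ S) {ε : ℝ≥0∞} (hε : 0 < ε) :
    ∃ S' ⊆ S, MeasurableSet S' ∧ 0 < μ S' ∧ μ S' < ε := by
  -- around some point `x` all neighbourhoods within `S` have positive measure, and small balls
  -- around `x` have small measure since points are null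
  obtain ⟨x, hx, h⟩ := exists_mem_forall_mem_nhdsWithin_pos_measure h0.ne'
  have ht : Tendsto (fun r => μ (Metric.closedBall x r)) (𝓝[>] 0) (𝓝 (μ {x})) := by
    obtain ⟨r, hr, hfin⟩ := (μ.finiteAt_nhds x).exists_mem_basis Metric.nhds_basis_closedBall
    have := tendsto_measure_biInter_gt (μ := μ) (s := fun r => Metric.closedBall x r) (a := 0)
      (fun r _ => Metric.isClosed_closedBall.nullMeasurableSet)
      (fun i j _ hij => Metric.closedBall_subset_closedBall hij) ⟨r, hr, hfin.ne⟩
    convert! this using 2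
    congr 1
    ext y
    simp only [Set.mem_singleton_iff, Set.mem_iInter, Metric.mem_closedBall]
    constructor
    · rintro rfl r hr
      rw [dist_self]
      exact (show (0 : ℝ) < r from hr).le
    · intro hy
      exact dist_le_zero.1 (le_of_forall_gt_imp_ge_of_dense fun r hr => hy r hr)
  rw [measure_singleton] at ht
  obtain ⟨r, hr1, hr2⟩ := ((ht.eventually (gt_mem_nhds hε)).and self_mem_nhdsWithin).exists
  refine ⟨S ∩ Metric.closedBall x r, Set.inter_subset_left, hS.inter measurableSet_closedBall,
    h _ (inter_mem_nhdsWithin _ (Metric.closedBall_mem_nhds x hr2)),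
    (measure_mono Set.inter_subset_right).trans_lt hr1⟩

end Geometry

/-! ### Periodic extension and kernels dominated by the periodisation -/

section CellPart

variable {d : ℕ}

/-- The representative of a point in the periodicity cell. -/
def cellPart (x : EuclideanSpace ℝ (Fin d)) : EuclideanSpace ℝ (Fin d) :=
  x + latticeVec fun i => -⌊x i⌋

theorem cellPart_add (n : Fin d → ℤ) (x : EuclideanSpace ℝ (Fin d)) :
    cellPart (x + latticeVec n) = cellPart x := by
  ext i
  simp only [cellPart, PiLp.add_apply, latticeVec_apply, Int.floor_add_intCast]
  push_cast
  ring

theorem cellPart_of_mem {x : EuclideanSpace ℝ (Fin d)} (hx : x ∈ unitCell d) : cellPart x = x := by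
  ext i
  simp only [cellPart, PiLp.add_apply, latticeVec_apply]
  rw [Int.floor_eq_zero_iff.2 (hx i)]
  simp

theorem measurable_cellPart : Measurable (cellPart : EuclideanSpace ℝ (Fin d) → _) := by
  have h : (cellPart : EuclideanSpace ℝ (Fin d) → _) =
      fun x => WithLp.toLp 2 fun i => x i + ((-⌊x i⌋ : ℤ) : ℝ) := by
    funext x
    ext i
    rfl
  rw [h]
  refine (PiLp.continuous_toLp 2 _).measurable.comp (measurable_pi_lambda _ fun i => ?_)
  have h1 : Measurable fun x : EuclideanSpace ℝ (Fin d) => x i := by fun_prop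
  exact h1.add (measurable_from_top.comp (h1.floor.neg))

end CellPart

instance {d : ℕ} : IsFiniteMeasure (volume.restrict (unitCell d)) :=
  isFiniteMeasure_restrict.mpr volume_unitCell_lt_top.ne

namespace HighContrastModel

variable {d : ℕ} (M : HighContrastModel d)

instance : IsFiniteMeasure (volume.restrict M.Ycell) :=
  isFiniteMeasure_restrict.mpr
    ((measure_mono Set.inter_subset_right).trans_lt volume_unitCell_lt_top).ne

/-- In dimension zero there are no two disjoint non-empty sets. -/
theorem nonempty_fin (M : HighContrastModel d) : Nonempty (Fin d) := by
  by_contra h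
  rw [not_nonempty_iff] at h
  obtain ⟨x, hx⟩ := M.G_nonempty
  obtain ⟨y, hy⟩ := M.Y_nonempty
  have : x = y := Subsingleton.elim _ _
  exact Set.disjoint_left.1 M.G_disjoint_Y hx (this ▸ hy)

theorem α₂_pos : 0 < M.α₂ := M.α₁_pos.trans_le ((M.w_lower 0 0).trans (M.w_upper 0 0))

theorem a_pos_near_zero : ∃ r₀ > 0, ∀ z, ‖z‖ ≤ r₀ → 0 < M.a z := by
  obtain ⟨r₀, hr₀, c, hc, h⟩ := M.a_lower
  exact ⟨r₀, hr₀, fun z hz => hc.trans_le (h z hz)⟩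

theorem integral_a_pos : 0 < ∫ z, M.a z := by
  obtain ⟨r₀, hr₀, h⟩ := M.a_pos_near_zero
  rw [integral_pos_iff_support_of_nonneg M.a_nonneg M.a_integrable]
  refine (Metric.measure_ball_pos volume (0 : EuclideanSpace ℝ (Fin d)) hr₀).trans_le
    (measure_mono fun z hz => (h z (mem_ball_zero_iff.1 hz).le).ne')

theorem v_nonneg (ξ η : EuclideanSpace ℝ (Fin d)) : 0 ≤ M.v ξ η := by
  refine mul_nonneg (M.α₁_pos.le.trans (M.w_lower ξ η)) ?_
  by_cases h1 : ξ ∈ M.Y <;> by_cases h2 : η ∈ M.Y <;> simp [h1, h2]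

theorem v_le (ξ η : EuclideanSpace ℝ (Fin d)) : M.v ξ η ≤ M.α₂ := by
  refine le_trans ?_ (M.w_upper ξ η)
  have h := M.α₁_pos.le.trans (M.w_lower ξ η)
  by_cases h1 : ξ ∈ M.Y <;> by_cases h2 : η ∈ M.Y <;> simp [v, h1, h2, h]

theorem v_symm (ξ η : EuclideanSpace ℝ (Fin d)) : M.v ξ η = M.v η ξ := by
  rw [v, v, M.w_symm, mul_comm (M.Y.indicator _ ξ)]

theorem v_of_notMem {ξ : EuclideanSpace ℝ (Fin d)} (hξ : ξ ∉ M.Y) (η : EuclideanSpace ℝ (Fin d)) :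
    M.v ξ η = M.w ξ η := by simp [v, hξ]

theorem measurable_v : Measurable (Function.uncurry M.v) := by
  have h : Measurable (M.Y.indicator fun _ => (1 : ℝ)) :=
    measurable_const.indicator M.Y_open.measurableSet
  exact M.w_measurable.mul
    (measurable_const.sub ((h.comp measurable_fst).mul (h.comp measurable_snd)))

theorem measurable_aTilde_sub :
    Measurable fun p : EuclideanSpace ℝ (Fin d) × EuclideanSpace ℝ (Fin d) =>
      M.aTilde (p.1 - p.2) := M.measurable_aTilde.comp (measurable_fst.sub measurable_snd)

theorem measurable_kernel : Measurable (Function.uncurry M.kernel) :=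
  M.measurable_aTilde_sub.mul M.measurable_v

theorem kernel_nonneg (ξ η : EuclideanSpace ℝ (Fin d)) : 0 ≤ M.kernel ξ η :=
  mul_nonneg (M.aTilde_nonneg _) (M.v_nonneg _ _)

theorem kernel_symm (ξ η : EuclideanSpace ℝ (Fin d)) : M.kernel ξ η = M.kernel η ξ := by
  rw [kernel, kernel, M.aTilde_sub_comm, M.v_symm]

theorem kernel_le (ξ η : EuclideanSpace ℝ (Fin d)) :
    M.kernel ξ η ≤ M.α₂ * M.aTilde (ξ - η) := by
  rw [kernel, mul_comm]
  exact mul_le_mul_of_nonneg_right (M.v_le _ _) (M.aTilde_nonneg _)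

section Dominated

variable {k : EuclideanSpace ℝ (Fin d) → EuclideanSpace ℝ (Fin d) → ℝ} {α : ℝ}
  {S : Set (EuclideanSpace ℝ (Fin d))}

theorem isSchurKernel_of_le (hm : Measurable (Function.uncurry k)) (h0 : ∀ ξ η, 0 ≤ k ξ η)
    (hs : ∀ ξ η, k ξ η = k η ξ) (hα : 0 ≤ α) (hle : ∀ ξ η, k ξ η ≤ α * M.aTilde (ξ - η))
    (hS : S ⊆ unitCell d) :
    IsSchurKernel k (volume.restrict S) (α * ∫ z, M.a z).toNNReal where
  meas := hm
  nonneg := h0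
  symm := hs
  bound ξ := by
    calc ∫⁻ η in S, ENNReal.ofReal (k ξ η)
        ≤ ∫⁻ η in unitCell d, ENNReal.ofReal α * ENNReal.ofReal (M.aTilde (ξ - η)) := by
          refine lintegral_mono' (Measure.restrict_mono hS le_rfl) fun η => ?_
          rw [← ENNReal.ofReal_mul hα]
          exact ENNReal.ofReal_le_ofReal (hle ξ η)
      _ = ENNReal.ofReal (α * ∫ z, M.a z) := by
          have hm : Measurable fun η => ENNReal.ofReal (M.aTilde (ξ - η)) :=
            ENNReal.measurable_ofReal.comp (M.measurable_aTilde.comp (by fun_prop))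
          rw [lintegral_const_mul _ hm, lintegral_cell_aTilde, ENNReal.ofReal_mul hα]

/-- The excess over a level `N` of a kernel dominated by `α ã(ξ - η)` has marginals bounded by the
integral of `(α ã - N)⁺` over a cell, whatever `ξ` is, and this tends to zero. -/
theorem isTruncatable_of_le (hα : 0 ≤ α) (hle : ∀ ξ η, k ξ η ≤ α * M.aTilde (ξ - η))
    (hS : S ⊆ unitCell d) : IsTruncatable k (volume.restrict S) := by
  intro ε hε
  have hlim : Tendsto (fun N : ℕ => ∫⁻ ζ in unitCell d, ENNReal.ofReal (α * M.aTilde ζ - N))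
      atTop (𝓝 (∫⁻ _ζ in unitCell d, 0)) := by
    refine tendsto_lintegral_of_dominated_convergence
      (fun ζ => ENNReal.ofReal (α * M.aTilde ζ)) (fun N => ?_) (fun N => ?_) ?_ ?_
    · exact ENNReal.measurable_ofReal.comp
        ((measurable_const.mul M.measurable_aTilde).sub_const _)
    · refine Eventually.of_forall fun ζ => ENNReal.ofReal_le_ofReal ?_
      have : (0 : ℝ) ≤ N := Nat.cast_nonneg N
      linarith
    · simp only [ENNReal.ofReal_mul hα]
      have hm : Measurable fun ζ => ENNReal.ofReal (M.aTilde ζ) :=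
        ENNReal.measurable_ofReal.comp M.measurable_aTilde
      rw [lintegral_const_mul _ hm]
      have h := M.lintegral_cell_aTilde 0
      simp only [zero_sub, M.aTilde_neg] at h
      rw [h]
      exact (ENNReal.mul_lt_top ENNReal.ofReal_lt_top ENNReal.ofReal_lt_top).ne
    · refine Eventually.of_forall fun ζ => tendsto_const_nhds.congr' ?_
      obtain ⟨N₀, hN₀⟩ := exists_nat_ge (α * M.aTilde ζ)
      filter_upwards [eventually_ge_atTop N₀] with N hN
      rw [eq_comm, ENNReal.ofReal_eq_zero]
      have : (N₀ : ℝ) ≤ N := by exact_mod_cast hN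
      linarith
  rw [lintegral_zero] at hlim
  obtain ⟨N, hN⟩ := (hlim.eventually (gt_mem_nhds (ENNReal.coe_pos.2 hε))).exists
  refine ⟨N, Nat.cast_nonneg N, fun ξ => le_trans ?_ hN.le⟩
  have hsub := setLIntegral_unitCell_sub
    (F := fun ζ => ENNReal.ofReal (α * M.aTilde ζ - N)) (fun n x => by rw [M.aTilde_periodic]) ξ
  rw [← hsub]
  exact lintegral_mono' (Measure.restrict_mono hS le_rfl) fun η =>
    ENNReal.ofReal_le_ofReal (sub_le_sub_right (hle ξ η) _)

end Dominated

theorem Gcell_subset : M.Gcell ⊆ unitCell d := Set.inter_subset_right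

theorem Ycell_subset : M.Ycell ⊆ unitCell d := Set.inter_subset_right

theorem measurableSet_Gcell : MeasurableSet M.Gcell :=
  M.G_open.measurableSet.inter measurableSet_unitCell

theorem measurableSet_Ycell : MeasurableSet M.Ycell :=
  M.Y_open.measurableSet.inter measurableSet_unitCell

theorem isSchurKernel_kernel :
    IsSchurKernel M.kernel M.μG (M.α₂ * ∫ z, M.a z).toNNReal :=
  M.isSchurKernel_of_le M.measurable_kernel M.kernel_nonneg M.kernel_symm M.α₂_pos.le M.kernel_le
    M.Gcell_subset

theorem isTruncatable_kernel : IsTruncatable M.kernel M.μG :=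
  M.isTruncatable_of_le M.α₂_pos.le M.kernel_le M.Gcell_subset

theorem isSchurKernel_cell : IsSchurKernel M.kernel (volume.restrict (unitCell d))
    (M.α₂ * ∫ z, M.a z).toNNReal :=
  M.isSchurKernel_of_le M.measurable_kernel M.kernel_nonneg M.kernel_symm M.α₂_pos.le M.kernel_le
    subset_rfl

theorem isSchurKernel_Ycell_kernel : IsSchurKernel M.kernel (volume.restrict M.Ycell)
    (M.α₂ * ∫ z, M.a z).toNNReal :=
  M.isSchurKernel_of_le M.measurable_kernel M.kernel_nonneg M.kernel_symm M.α₂_pos.le M.kernel_le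
    M.Ycell_subset

theorem isSchurKernel_aTilde {S : Set (EuclideanSpace ℝ (Fin d))} (hS : S ⊆ unitCell d) :
    IsSchurKernel (fun ξ η => M.aTilde (ξ - η)) (volume.restrict S) (1 * ∫ z, M.a z).toNNReal :=
  M.isSchurKernel_of_le M.measurable_aTilde_sub (fun _ _ => M.aTilde_nonneg _)
    M.aTilde_sub_comm zero_le_one (fun _ _ => (one_mul _).ge) hS

theorem isTruncatable_aTilde {S : Set (EuclideanSpace ℝ (Fin d))} (hS : S ⊆ unitCell d) :
    IsTruncatable (fun ξ η => M.aTilde (ξ - η)) (volume.restrict S) :=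
  M.isTruncatable_of_le zero_le_one (fun _ _ => (one_mul _).ge) hS

/-! ### The potential `Φ` and the operator `Φ - K` -/

theorem ae_mem_G_or_Y : ∀ᵐ x, x ∈ M.G ∨ x ∈ M.Y := by
  have h : ∀ᵐ x, x ∉ frontier M.G :=
    measure_eq_zero_iff_ae_notMem.1 M.G_lipschitz.volume_frontier
  filter_upwards [h] with x hx
  have hx' : x ∈ closure M.G ∪ M.Y := by
    rw [M.cover]
    exact Set.mem_univ x
  rcases hx' with h1 | h1
  · left
    by_contra h2
    exact hx ⟨h1, by rwa [M.G_open.interior_eq]⟩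
  · exact Or.inr h1

theorem Phi_eq_kerMass : M.Phi = kerMass M.kernel (volume.restrict (unitCell d)) := rfl

theorem cTilde_eq_kerMass : M.cTilde = kerMass M.kernel (volume.restrict M.Ycell) := rfl

theorem γ₂_nonneg : 0 ≤ M.γ₂ := mul_nonneg M.α₂_pos.le M.integral_a_pos.le

theorem γ₁_pos : 0 < M.γ₁ := mul_pos M.α₁_pos M.integral_a_pos

theorem γ₁_le_γ₂ : M.γ₁ ≤ M.γ₂ :=
  mul_le_mul_of_nonneg_right ((M.w_lower 0 0).trans (M.w_upper 0 0)) M.integral_a_pos.le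

theorem measurable_Phi : Measurable M.Phi := M.isSchurKernel_cell.measurable_kerMass

theorem abs_Phi_le (ξ : EuclideanSpace ℝ (Fin d)) : |M.Phi ξ| ≤ M.γ₂ := by
  rw [Phi_eq_kerMass, abs_of_nonneg (M.isSchurKernel_cell.kerMass_nonneg ξ)]
  exact (M.isSchurKernel_cell.kerMass_le ξ).trans (Real.coe_toNNReal _ M.γ₂_nonneg).le

theorem measurable_cTilde : Measurable M.cTilde := M.isSchurKernel_Ycell_kernel.measurable_kerMass

theorem cTilde_nonneg (ξ : EuclideanSpace ℝ (Fin d)) : 0 ≤ M.cTilde ξ :=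
  M.isSchurKernel_Ycell_kernel.kerMass_nonneg ξ

theorem cTilde_le (ξ : EuclideanSpace ℝ (Fin d)) : M.cTilde ξ ≤ M.γ₂ :=
  (M.isSchurKernel_Ycell_kernel.kerMass_le ξ).trans (Real.coe_toNNReal _ M.γ₂_nonneg).le

theorem bTilde_eq (ξ : EuclideanSpace ℝ (Fin d)) :
    M.bTilde ξ = (volume.real M.Ycell)⁻¹ * M.cTilde ξ := by
  rw [bTilde, cTilde]
  simp only [M.kernel_symm _ ξ]

/-- `Φ` is the mass of the kernel on `G` plus the rate `c̃` of jumps to `Y`, since `G` and `Y` fill the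
cell up to the null set `∂G`. -/
theorem Phi_eq_add (ξ : EuclideanSpace ℝ (Fin d)) :
    M.Phi ξ = kerMass M.kernel M.μG ξ + M.cTilde ξ := by
  have hae : (unitCell d : Set (EuclideanSpace ℝ (Fin d))) =ᵐ[volume]
      (M.Gcell ∪ M.Ycell : Set (EuclideanSpace ℝ (Fin d))) := by
    filter_upwards [M.ae_mem_G_or_Y] with x hx
    refine propext ⟨fun h => ?_, fun h => ?_⟩
    · exact hx.imp (fun h' => ⟨h', h⟩) fun h' => ⟨h', h⟩
    · exact h.elim (fun h' => h'.2) fun h' => h'.2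
  rw [Phi, setIntegral_congr_set hae, setIntegral_union]
  · rfl
  · exact M.G_disjoint_Y.mono Set.inter_subset_left Set.inter_subset_left
  · exact M.measurableSet_Ycell
  · exact M.isSchurKernel_kernel.integrable ξ
  · exact M.isSchurKernel_Ycell_kernel.integrable ξ

theorem γ₁_le_Phi {ξ : EuclideanSpace ℝ (Fin d)} (hξ : ξ ∈ M.G) : M.γ₁ ≤ M.Phi ξ := by
  have hY : ξ ∉ M.Y := Set.disjoint_left.1 M.G_disjoint_Y hξ
  rw [γ₁, ← M.integral_cell_aTilde ξ, ← integral_const_mul, Phi]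
  refine integral_mono (((M.isSchurKernel_aTilde subset_rfl).integrable ξ).const_mul _)
    (M.isSchurKernel_cell.integrable ξ) fun η => ?_
  simp only [kernel, M.v_of_notMem hY]
  rw [mul_comm]
  exact mul_le_mul_of_nonneg_left (M.w_lower _ _) (M.aTilde_nonneg _)

theorem kerMass_le_Phi : ∀ᵐ ξ ∂M.μG, kerMass M.kernel M.μG ξ ≤ M.Phi ξ :=
  Eventually.of_forall fun ξ => by
    rw [Phi_eq_add]
    linarith [M.cTilde_nonneg ξ]

theorem ae_aTildeE_sub_lt_top_prod :
    ∀ᵐ p : EuclideanSpace ℝ (Fin d) × EuclideanSpace ℝ (Fin d) ∂(volume.prod volume),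
      M.aTildeE (p.1 - p.2) < ∞ := by
  have hm : Measurable fun p : EuclideanSpace ℝ (Fin d) × EuclideanSpace ℝ (Fin d) =>
      M.aTildeE (p.1 - p.2) := M.measurable_aTildeE.comp (measurable_fst.sub measurable_snd)
  rw [Measure.ae_prod_iff_ae_ae (measurableSet_lt hm measurable_const)]
  exact Eventually.of_forall M.ae_aTildeE_sub_lt_top

/-- The operator `Φ - K` is injective: a null vector, extended by zero to the fast phase, is
constant by connectedness of the whole space under jumps, and it vanishes on the fast phase. -/
theorem phiSubK_injective {A : M.L2G →L[ℂ] M.L2G} (hA : IsPotentialSub M.Phi M.kernel A)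
    (u : M.L2G) (hu : A u = 0) : u = 0 := by
  obtain ⟨h1, h2⟩ := hA.of_apply_eq_zero M.isSchurKernel_kernel M.measurable_Phi M.abs_Phi_le
    M.kerMass_le_Phi hu
  have hum : Measurable u := (Lp.stronglyMeasurable u).measurable
  have hv : ∀ {ξ η : EuclideanSpace ℝ (Fin d)}, ξ ∈ M.G → M.kernel ξ η = 0 →
      M.aTilde (ξ - η) = 0 := by
    intro ξ η hξ h
    rw [kernel, M.v_of_notMem (Set.disjoint_left.1 M.G_disjoint_Y hξ)] at h
    exact (mul_eq_zero.1 h).resolve_right (M.α₁_pos.trans_le (M.w_lower _ _)).ne'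
  have hGG : ∀ᵐ p : EuclideanSpace ℝ (Fin d) × EuclideanSpace ℝ (Fin d) ∂(volume.prod volume),
      p.1 ∈ M.Gcell → p.2 ∈ M.Gcell → M.aTilde (p.1 - p.2) = 0 ∨ u p.1 = u p.2 := by
    change ∀ᵐ p ∂((volume.restrict M.Gcell).prod (volume.restrict M.Gcell)), _ at h1
    rw [Measure.prod_restrict,
      ae_restrict_iff' (M.measurableSet_Gcell.prod M.measurableSet_Gcell)] at h1
    filter_upwards [h1] with p hp h3 h4
    exact (hp ⟨h3, h4⟩).imp_left (hv h3.1)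
  have hGY : ∀ᵐ p : EuclideanSpace ℝ (Fin d) × EuclideanSpace ℝ (Fin d) ∂(volume.prod volume),
      p.1 ∈ M.Gcell → p.2 ∈ M.Ycell → M.aTilde (p.1 - p.2) = 0 ∨ u p.1 = 0 := by
    have hms : MeasurableSet {p : EuclideanSpace ℝ (Fin d) × EuclideanSpace ℝ (Fin d) |
        p.1 ∈ M.Gcell → p.2 ∈ M.Ycell → M.aTilde (p.1 - p.2) = 0 ∨ u p.1 = 0} := by
      refine (measurable_fst M.measurableSet_Gcell).imp
        ((measurable_snd M.measurableSet_Ycell).imp (MeasurableSet.union ?_ ?_))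
      · exact M.measurable_aTilde_sub (measurableSet_singleton 0)
      · exact (hum.comp measurable_fst) (measurableSet_singleton 0)
    rw [Measure.ae_prod_iff_ae_ae hms]
    change ∀ᵐ x ∂(volume.restrict M.Gcell), _ at h2
    rw [ae_restrict_iff' M.measurableSet_Gcell] at h2
    filter_upwards [h2] with ξ h3
    by_cases hξ : ξ ∈ M.Gcell
    · rcases h3 hξ with h4 | h4
      · have h5 : kerMass M.kernel (volume.restrict M.Ycell) ξ = 0 := by
          have := M.Phi_eq_add ξ
          rw [cTilde_eq_kerMass] at this
          change M.Phi ξ = kerMass M.kernel M.μG ξ at h4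
          linarith
        rw [kerMass, integral_eq_zero_iff_of_nonneg (M.kernel_nonneg ξ)
          (M.isSchurKernel_Ycell_kernel.integrable ξ)] at h5
        have h6 := (ae_restrict_iff' M.measurableSet_Ycell).1 h5
        filter_upwards [h6] with η h7 _ hη
        exact Or.inl (hv hξ.1 (h7 hη))
      · exact Eventually.of_forall fun η _ _ => Or.inr h4
    · exact Eventually.of_forall fun η h => absurd h hξ
  have hYG := Measure.measurePreserving_swap.quasiMeasurePreserving.ae hGY
  -- the periodic extension of `u`, by zero on the fast phase
  let U : EuclideanSpace ℝ (Fin d) → ℂ := M.G.indicator fun x => u (cellPart x)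
  have hUper : ∀ (n : Fin d → ℤ) x, U (x + latticeVec n) = U x := by
    intro n x
    by_cases hx : x ∈ M.G
    · have := (M.G_periodic n x).2 hx
      simp only [U, Set.indicator_of_mem hx, Set.indicator_of_mem this, cellPart_add]
    · have := (M.G_periodic n x).not.2 hx
      simp only [U, Set.indicator_of_notMem hx, Set.indicator_of_notMem this]
  have hU1 : ∀ {x}, x ∈ M.G → x ∈ unitCell d → U x = u x := by
    intro x hx hx'
    simp only [U, Set.indicator_of_mem hx, cellPart_of_mem hx']
  have hU0 : ∀ {x}, x ∈ M.Y → U x = 0 := by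
    intro x hx
    simp only [U, Set.indicator_of_notMem (Set.disjoint_right.1 M.G_disjoint_Y hx)]
  have hcell : ∀ᵐ p : EuclideanSpace ℝ (Fin d) × EuclideanSpace ℝ (Fin d) ∂(volume.prod volume),
      M.aTilde (p.1 - p.2) = 0 ∨ U p.1 = U p.2 := by
    refine ae_prod_of_ae_unitCell ?_ fun m n x y h => ?_
    · filter_upwards [hGG, hGY, hYG, Measure.quasiMeasurePreserving_fst.ae M.ae_mem_G_or_Y,
        Measure.quasiMeasurePreserving_snd.ae M.ae_mem_G_or_Y] with p e1 e2 e3 e4 e5 c1 c2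
      rcases e4 with e4 | e4 <;> rcases e5 with e5 | e5
      · rw [hU1 e4 c1, hU1 e5 c2]
        exact e1 ⟨e4, c1⟩ ⟨e5, c2⟩
      · rw [hU1 e4 c1, hU0 e5]
        exact e2 ⟨e4, c1⟩ ⟨e5, c2⟩
      · rw [hU1 e5 c2, hU0 e4, M.aTilde_sub_comm, eq_comm (a := (0 : ℂ))]
        exact e3 ⟨e5, c2⟩ ⟨e4, c1⟩
      · rw [hU0 e4, hU0 e5]
        exact Or.inr rfl
    · simp only [hUper] at h
      refine h.imp_left fun h' => ?_
      rwa [add_sub_add_comm, sub_eq_add_neg (latticeVec m), ← latticeVec_neg, ← latticeVec_add,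
        M.aTilde_periodic] at h'
  obtain ⟨r₀, hr₀, hpos⟩ := M.a_pos_near_zero
  obtain ⟨κ, hκ⟩ := exists_ae_eq_const_of_jump isOpen_univ Set.univ_nonempty hr₀ hpos
    (fun x _ y _ => reflTransGen_univ hr₀ hpos x y) (u := U) (by
      filter_upwards [hcell, M.ae_aTildeE_sub_lt_top_prod] with p h3 h4 _ _ h5
      exact h3.resolve_left (h5.trans_le (M.a_le_aTilde h4)).ne')
  have hκ0 : κ = 0 := by
    by_contra hne
    have h3 : ∀ᵐ x, x ∉ M.Y := by
      filter_upwards [hκ] with x hx hY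
      rw [hU0 hY] at hx
      exact hne (hx trivial).symm
    exact (M.Y_open.measure_pos volume M.Y_nonempty).ne' (measure_eq_zero_iff_ae_notMem.2 h3)
  rw [Lp.eq_zero_iff_ae_eq_zero]
  change ∀ᵐ x ∂(volume.restrict M.Gcell), u x = 0
  rw [ae_restrict_iff' M.measurableSet_Gcell]
  filter_upwards [hκ] with x hx hxG
  rw [← hU1 hxG.1 hxG.2, hx trivial, hκ0]

end HighContrastModel

/-! ### The jump measure of the fast phase -/

namespace HighContrastModel

variable {d : ℕ} (M : HighContrastModel d)

/-- The measure `a(ξ - η) dξ dη` of jumps between `Y` and one cell of `Y`. -/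
def jump : Measure (EuclideanSpace ℝ (Fin d) × EuclideanSpace ℝ (Fin d)) :=
  ((volume.restrict M.Y).prod (volume.restrict M.Ycell)).withDensity
    fun p => ENNReal.ofReal (M.a (p.1 - p.2))

theorem measurable_jump_density :
    Measurable fun p : EuclideanSpace ℝ (Fin d) × EuclideanSpace ℝ (Fin d) =>
      ENNReal.ofReal (M.a (p.1 - p.2)) :=
  ENNReal.measurable_ofReal.comp (M.a_measurable.comp (measurable_fst.sub measurable_snd))

theorem lintegral_jump {F : EuclideanSpace ℝ (Fin d) × EuclideanSpace ℝ (Fin d) → ℝ≥0∞}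
    (hF : Measurable F) : ∫⁻ p, F p ∂M.jump =
      ∫⁻ η in M.Ycell, ∫⁻ ξ in M.Y, ENNReal.ofReal (M.a (ξ - η)) * F (ξ, η) := by
  rw [jump, lintegral_withDensity_eq_lintegral_mul _ M.measurable_jump_density hF,
    lintegral_prod_symm _ (M.measurable_jump_density.mul hF).aemeasurable]
  rfl

/-- The jump measure is symmetric on functions invariant under diagonal lattice translations. -/
theorem lintegral_jump_swap {F : EuclideanSpace ℝ (Fin d) × EuclideanSpace ℝ (Fin d) → ℝ≥0∞}
    (hF : Measurable F)
    (hper : ∀ (n : Fin d → ℤ) x y, F (x + latticeVec n, y + latticeVec n) = F (x, y)) :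
    ∫⁻ p, F p.swap ∂M.jump = ∫⁻ p, F p ∂M.jump := by
  have key : ∀ {G : EuclideanSpace ℝ (Fin d) × EuclideanSpace ℝ (Fin d) → ℝ≥0∞}, Measurable G →
      ∫⁻ p, G p ∂M.jump = ∫⁻ η in unitCell d, ∫⁻ ξ,
        (M.Y ×ˢ M.Y).indicator (fun p => ENNReal.ofReal (M.a (p.1 - p.2)) * G p) (ξ, η) := by
    intro G hG
    rw [M.lintegral_jump hG, Ycell, ← setLIntegral_indicator M.Y_open.measurableSet]
    refine lintegral_congr fun η => ?_
    by_cases hη : η ∈ M.Y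
    · rw [Set.indicator_of_mem hη, ← lintegral_indicator M.Y_open.measurableSet]
      refine lintegral_congr fun ξ => ?_
      by_cases hξ : ξ ∈ M.Y
      · rw [Set.indicator_of_mem hξ, Set.indicator_of_mem (Set.mk_mem_prod hξ hη)]
      · rw [Set.indicator_of_notMem hξ, Set.indicator_of_notMem fun h => hξ h.1]
    · rw [Set.indicator_of_notMem hη, eq_comm, ← lintegral_zero]
      refine lintegral_congr fun ξ => ?_
      rw [Set.indicator_of_notMem fun h => hη h.2]
  have hsw : Measurable fun p : EuclideanSpace ℝ (Fin d) × EuclideanSpace ℝ (Fin d) => F p.swap :=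
    hF.comp measurable_swap
  rw [key hF, key hsw, lintegral_cell_swap]
  · refine lintegral_congr fun x => lintegral_congr fun y => ?_
    by_cases h : x ∈ M.Y ∧ y ∈ M.Y
    · rw [Set.indicator_of_mem (Set.mk_mem_prod h.1 h.2),
        Set.indicator_of_mem (Set.mk_mem_prod h.2 h.1), M.a_sub_comm]
      rfl
    · rw [Set.indicator_of_notMem fun h' => h ⟨h'.1, h'.2⟩,
        Set.indicator_of_notMem fun h' => h ⟨h'.2, h'.1⟩]
  · exact (M.measurable_jump_density.mul hsw).indicator
      (M.Y_open.measurableSet.prod M.Y_open.measurableSet)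
  · intro n x y
    have h1 : F (y + latticeVec n, x + latticeVec n) = F (y, x) := hper n y x
    by_cases h : x ∈ M.Y ∧ y ∈ M.Y
    · rw [Set.indicator_of_mem
          (Set.mk_mem_prod ((M.Y_periodic n x).2 h.1) ((M.Y_periodic n y).2 h.2)),
        Set.indicator_of_mem (Set.mk_mem_prod h.1 h.2)]
      simp only [Prod.swap_prod_mk, h1, add_sub_add_right_eq_sub]
    · rw [Set.indicator_of_notMem fun h' =>
          h ⟨(M.Y_periodic n x).1 h'.1, (M.Y_periodic n y).1 h'.2⟩,
        Set.indicator_of_notMem fun h' => h ⟨h'.1, h'.2⟩]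

theorem integral_jump_swap {F : EuclideanSpace ℝ (Fin d) × EuclideanSpace ℝ (Fin d) → ℝ}
    (hF : Measurable F)
    (hper : ∀ (n : Fin d → ℤ) x y, F (x + latticeVec n, y + latticeVec n) = F (x, y))
    (hi : Integrable F M.jump) :
    Integrable (fun p => F p.swap) M.jump ∧ ∫ p, F p.swap ∂M.jump = ∫ p, F p ∂M.jump := by
  have h1 : Integrable (fun p => F p.swap) M.jump := by
    refine ⟨(hF.comp measurable_swap).aestronglyMeasurable, ?_⟩
    have := hi.2
    rw [HasFiniteIntegral] at this ⊢
    rwa [M.lintegral_jump_swap hF.enorm fun n x y => by rw [hper]]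
  refine ⟨h1, ?_⟩
  rw [integral_eq_lintegral_pos_part_sub_lintegral_neg_part h1,
    integral_eq_lintegral_pos_part_sub_lintegral_neg_part hi,
    M.lintegral_jump_swap (F := fun p => ENNReal.ofReal (F p)) (by fun_prop)
      fun n x y => by rw [hper],
    M.lintegral_jump_swap (F := fun p => ENNReal.ofReal (-F p)) (by fun_prop)
      fun n x y => by rw [hper]]

theorem integrable_jump_iff {F : EuclideanSpace ℝ (Fin d) × EuclideanSpace ℝ (Fin d) → ℝ} :
    Integrable F M.jump ↔ Integrable (fun p => M.a (p.1 - p.2) * F p)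
      ((volume.restrict M.Y).prod (volume.restrict M.Ycell)) := by
  rw [jump, integrable_withDensity_iff_integrable_smul' M.measurable_jump_density
    (Eventually.of_forall fun _ => ENNReal.ofReal_lt_top)]
  simp only [ENNReal.toReal_ofReal (M.a_nonneg _), smul_eq_mul]

theorem integral_jump {F : EuclideanSpace ℝ (Fin d) × EuclideanSpace ℝ (Fin d) → ℝ}
    (hF : Integrable F M.jump) :
    ∫ p, F p ∂M.jump = ∫ ξ in M.Y, ∫ η in M.Ycell, M.a (ξ - η) * F (ξ, η) := by
  have h1 := M.integrable_jump_iff.1 hF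
  rw [jump, integral_withDensity_eq_integral_toReal_smul M.measurable_jump_density
    (Eventually.of_forall fun _ => ENNReal.ofReal_lt_top)]
  simp only [ENNReal.toReal_ofReal (M.a_nonneg _), smul_eq_mul]
  exact integral_prod _ h1

theorem integral_jump' {F : EuclideanSpace ℝ (Fin d) × EuclideanSpace ℝ (Fin d) → ℝ}
    (hF : Integrable F M.jump) :
    ∫ p, F p ∂M.jump = ∫ η in M.Ycell, ∫ ξ in M.Y, M.a (ξ - η) * F (ξ, η) := by
  have h1 := M.integrable_jump_iff.1 hF
  rw [jump, integral_withDensity_eq_integral_toReal_smul M.measurable_jump_density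
    (Eventually.of_forall fun _ => ENNReal.ofReal_lt_top)]
  simp only [ENNReal.toReal_ofReal (M.a_nonneg _), smul_eq_mul]
  exact integral_prod_symm _ h1

theorem lintegral_a_sub (η : EuclideanSpace ℝ (Fin d)) :
    ∫⁻ ξ, ENNReal.ofReal (M.a (ξ - η)) = ENNReal.ofReal (∫ z, M.a z) := by
  rw [← M.lintegral_ofReal_a]
  exact lintegral_sub_right_eq_self (fun z => ENNReal.ofReal (M.a z)) η

/-- Functions that are square integrable over a cell of `Y`, evaluated at the second point, are
square integrable for the jump measure. -/
theorem memLp_jump_snd {g : EuclideanSpace ℝ (Fin d) → ℝ} (hg : Measurable g)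
    (hi : MemLp g 2 (volume.restrict M.Ycell)) : MemLp (fun p => g p.2) 2 M.jump := by
  have hgm : Measurable fun p : EuclideanSpace ℝ (Fin d) × EuclideanSpace ℝ (Fin d) => g p.2 :=
    hg.comp measurable_snd
  rw [memLp_two_iff_integrable_sq hgm.aestronglyMeasurable]
  rw [memLp_two_iff_integrable_sq hg.aestronglyMeasurable] at hi
  refine ⟨(hgm.pow_const 2).aestronglyMeasurable, ?_⟩
  have h2 := hi.2
  rw [HasFiniteIntegral] at h2 ⊢
  rw [M.lintegral_jump (hgm.pow_const 2).enorm]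
  calc ∫⁻ η in M.Ycell, ∫⁻ ξ in M.Y, ENNReal.ofReal (M.a (ξ - η)) * ‖g η ^ 2‖ₑ
      ≤ ∫⁻ η in M.Ycell, ENNReal.ofReal (∫ z, M.a z) * ‖g η ^ 2‖ₑ := by
        refine lintegral_mono fun η => ?_
        have ham : Measurable fun ξ => ENNReal.ofReal (M.a (ξ - η)) :=
          ENNReal.measurable_ofReal.comp (M.a_measurable.comp (measurable_id.sub_const η))
        rw [lintegral_mul_const _ ham]
        gcongr
        exact (lintegral_mono' Measure.restrict_le_self le_rfl).trans (M.lintegral_a_sub η).le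
    _ = ENNReal.ofReal (∫ z, M.a z) * ∫⁻ η in M.Ycell, ‖g η ^ 2‖ₑ :=
        lintegral_const_mul _ (hg.pow_const 2).enorm
    _ < ∞ := ENNReal.mul_lt_top ENNReal.ofReal_lt_top h2

theorem memLp_jump_fst {g : EuclideanSpace ℝ (Fin d) → ℝ} (hg : Measurable g)
    (hper : ∀ (n : Fin d → ℤ) x, g (x + latticeVec n) = g x)
    (hi : MemLp g 2 (volume.restrict M.Ycell)) : MemLp (fun p => g p.1) 2 M.jump := by
  have h := M.memLp_jump_snd hg hi
  rw [memLp_two_iff_integrable_sq h.1] at h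
  have hgm : Measurable fun p : EuclideanSpace ℝ (Fin d) × EuclideanSpace ℝ (Fin d) => g p.1 :=
    hg.comp measurable_fst
  rw [memLp_two_iff_integrable_sq hgm.aestronglyMeasurable]
  exact (M.integral_jump_swap (F := fun x => g x.2 ^ 2) ((hg.comp measurable_snd).pow_const 2)
    (fun n x y => by simp only [hper]) h).1

theorem integrable_norm_sq_mul_a : Integrable fun z => ‖z‖ ^ 2 * M.a z := by
  refine (M.a_integrable.add M.a_moment).mono'
    ((measurable_norm.pow_const 2).mul M.a_measurable).aestronglyMeasurable
    (Eventually.of_forall fun z => ?_)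
  rw [Real.norm_of_nonneg (mul_nonneg (by positivity) (M.a_nonneg z)), Pi.add_apply]
  have h1 : ‖z‖ ^ 2 ≤ 1 + ‖z‖ ^ 3 := by
    rcases le_total ‖z‖ 1 with h | h
    · have := norm_nonneg z
      nlinarith [pow_nonneg this 3]
    · nlinarith [sq_nonneg ‖z‖]
  nlinarith [M.a_nonneg z]

theorem integrable_norm_mul_a : Integrable fun z => ‖z‖ * M.a z := by
  refine (M.a_integrable.add M.integrable_norm_sq_mul_a).mono'
    (measurable_norm.mul M.a_measurable).aestronglyMeasurable
    (Eventually.of_forall fun z => ?_)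
  rw [Real.norm_of_nonneg (mul_nonneg (by positivity) (M.a_nonneg z)), Pi.add_apply]
  have h1 : ‖z‖ ≤ 1 + ‖z‖ ^ 2 := by nlinarith [sq_nonneg (‖z‖ - 1)]
  nlinarith [M.a_nonneg z]

/-- The jump length in direction `p` is square integrable for the jump measure. -/
theorem memLp_jump_inner (p : EuclideanSpace ℝ (Fin d)) :
    MemLp (fun x : EuclideanSpace ℝ (Fin d) × EuclideanSpace ℝ (Fin d) =>
      (inner ℝ p (x.1 - x.2) : ℝ)) 2 M.jump := by
  have hm : Measurable fun x : EuclideanSpace ℝ (Fin d) × EuclideanSpace ℝ (Fin d) =>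
      (inner ℝ p (x.1 - x.2) : ℝ) := by fun_prop
  rw [memLp_two_iff_integrable_sq hm.aestronglyMeasurable]
  refine ⟨(hm.pow_const 2).aestronglyMeasurable, ?_⟩
  rw [HasFiniteIntegral, M.lintegral_jump (hm.pow_const 2).enorm]
  have hzm : Measurable fun z => ‖‖z‖ ^ 2 * M.a z‖ₑ :=
    ((measurable_norm.pow_const 2).mul M.a_measurable).enorm
  have hz := M.integrable_norm_sq_mul_a.2
  rw [HasFiniteIntegral] at hz
  calc ∫⁻ η in M.Ycell, ∫⁻ ξ in M.Y, ENNReal.ofReal (M.a (ξ - η)) *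
        ‖(inner ℝ p (ξ - η) : ℝ) ^ 2‖ₑ
      ≤ ∫⁻ η in M.Ycell, ENNReal.ofReal (‖p‖ ^ 2) * ∫⁻ z, ‖‖z‖ ^ 2 * M.a z‖ₑ := by
        refine lintegral_mono fun η => ?_
        refine (lintegral_mono' Measure.restrict_le_self le_rfl).trans ?_
        rw [lintegral_sub_right_eq_self (fun z => ENNReal.ofReal (M.a z) *
          ‖(inner ℝ p z : ℝ) ^ 2‖ₑ) η, ← lintegral_const_mul _ hzm]
        refine lintegral_mono fun z => ?_
        rw [Real.enorm_of_nonneg (sq_nonneg _), Real.enorm_of_nonneg (mul_nonneg (by positivity)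
          (M.a_nonneg z)), ← ENNReal.ofReal_mul (M.a_nonneg z), ← ENNReal.ofReal_mul (by positivity)]
        refine ENNReal.ofReal_le_ofReal ?_
        have h1 : (inner ℝ p z : ℝ) ^ 2 ≤ (‖p‖ * ‖z‖) ^ 2 := by
          rw [← sq_abs]
          exact pow_le_pow_left₀ (abs_nonneg _) (abs_real_inner_le_norm p z) 2
        calc M.a z * (inner ℝ p z : ℝ) ^ 2 ≤ M.a z * (‖p‖ * ‖z‖) ^ 2 :=
              mul_le_mul_of_nonneg_left h1 (M.a_nonneg z)
          _ = ‖p‖ ^ 2 * (‖z‖ ^ 2 * M.a z) := by ring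
    _ = ENNReal.ofReal (‖p‖ ^ 2) * (∫⁻ z, ‖‖z‖ ^ 2 * M.a z‖ₑ) * volume M.Ycell := by
        rw [lintegral_const, Measure.restrict_apply_univ]
    _ < ∞ := by
        refine ENNReal.mul_lt_top (ENNReal.mul_lt_top ENNReal.ofReal_lt_top hz) ?_
        exact (measure_mono Set.inter_subset_right).trans_lt volume_unitCell_lt_top

instance : IsFiniteMeasure M.jump := by
  refine ⟨?_⟩
  rw [← lintegral_one, M.lintegral_jump measurable_const]
  calc ∫⁻ η in M.Ycell, ∫⁻ ξ in M.Y, ENNReal.ofReal (M.a (ξ - η)) * 1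
      ≤ ∫⁻ η in M.Ycell, ENNReal.ofReal (∫ z, M.a z) := by
        refine lintegral_mono fun η => ?_
        simp only [mul_one]
        exact (lintegral_mono' Measure.restrict_le_self le_rfl).trans (M.lintegral_a_sub η).le
    _ < ∞ := by
        rw [lintegral_const, Measure.restrict_apply_univ]
        exact ENNReal.mul_lt_top ENNReal.ofReal_lt_top
          ((measure_mono Set.inter_subset_right).trans_lt volume_unitCell_lt_top)

/-- The mean jump vanishes, by symmetry of the jump measure. -/
theorem integral_jump_inner (p : EuclideanSpace ℝ (Fin d)) :
    ∫ x, (inner ℝ p (x.1 - x.2) : ℝ) ∂M.jump = 0 := by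
  have h := (M.integral_jump_swap (F := fun x => (inner ℝ p (x.1 - x.2) : ℝ)) (by fun_prop)
    (fun n x y => by simp only [add_sub_add_right_eq_sub])
    ((M.memLp_jump_inner p).integrable one_le_two)).2
  have h1 : ∀ x : EuclideanSpace ℝ (Fin d) × EuclideanSpace ℝ (Fin d),
      (inner ℝ p (x.swap.1 - x.swap.2) : ℝ) = -inner ℝ p (x.1 - x.2) := by
    intro x
    rw [← inner_neg_right, neg_sub]
    rfl
  simp only [h1, integral_neg] at h
  linarith

/-! ### Existence of correctors -/

/-- Integrals over a cell of `Y` against the periodisation unfold to integrals over `Y`. -/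
theorem integral_Ycell_aTilde_mul {h : EuclideanSpace ℝ (Fin d) → ℝ} (hh : Measurable h)
    (hper : ∀ (n : Fin d → ℤ) x, h (x + latticeVec n) = h x) {ξ : EuclideanSpace ℝ (Fin d)}
    (hi : IntegrableOn (fun η => M.a (ξ - η) * h η) M.Y) :
    ∫ η in M.Ycell, M.aTilde (ξ - η) * h η = ∫ η in M.Y, M.a (ξ - η) * h η := by
  have hYm := M.Y_open.measurableSet
  have hp : ∀ (n : Fin d → ℤ) x, M.Y.indicator h (x + latticeVec n) = M.Y.indicator h x := by
    intro n x
    by_cases hx : x ∈ M.Y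
    · rw [Set.indicator_of_mem hx, Set.indicator_of_mem ((M.Y_periodic n x).2 hx), hper]
    · rw [Set.indicator_of_notMem hx, Set.indicator_of_notMem ((M.Y_periodic n x).not.2 hx)]
  have e1 : ∀ (f : EuclideanSpace ℝ (Fin d) → ℝ) η, f η * M.Y.indicator h η =
      M.Y.indicator (fun η => f η * h η) η := by
    intro f η
    by_cases hη : η ∈ M.Y <;> simp [hη]
  have h1 := (M.integral_cell_aTilde_mul (h := M.Y.indicator h) (hh.indicator hYm) hp (ξ := ξ) (by
    simp only [e1 fun η => M.a (ξ - η)]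
    exact (integrable_indicator_iff hYm).2 hi)).2
  simp only [e1 fun η => M.a (ξ - η), e1 fun η => M.aTilde (ξ - η)] at h1
  rwa [setIntegral_indicator hYm, integral_indicator hYm, Set.inter_comm] at h1

theorem integrableOn_a_sub (ξ : EuclideanSpace ℝ (Fin d)) (S : Set (EuclideanSpace ℝ (Fin d))) :
    IntegrableOn (fun η => M.a (ξ - η)) S := (M.integrable_a_sub ξ).integrableOn

/-- The jump rate inside the fast phase is bounded below: near each point of the compact closure of
the cell, the ball of radius `r₀` meets `Y` in a set of measure bounded below. -/
theorem exists_le_kerMass_Ycell : ∃ m₀ > 0, ∀ ξ ∈ M.Ycell,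
    m₀ ≤ kerMass (fun ξ η => M.aTilde (ξ - η)) (volume.restrict M.Ycell) ξ := by
  obtain ⟨r₀, hr₀, c, hc, hac⟩ := M.a_lower
  have hcomp : IsCompact (closure M.Ycell) :=
    (isBounded_unitCell.subset M.Ycell_subset).isCompact_closure
  have hball : ∃ m > 0, ∀ ξ ∈ closure M.Ycell, m ≤ volume.real (M.Y ∩ Metric.ball ξ r₀) := by
    refine hcomp.induction_on (p := fun S => ∃ m > 0, ∀ ξ ∈ S,
      m ≤ volume.real (M.Y ∩ Metric.ball ξ r₀)) ⟨1, one_pos, by simp⟩ ?_ ?_ ?_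
    · rintro s t hst ⟨m, hm, h⟩
      exact ⟨m, hm, fun ξ hξ => h ξ (hst hξ)⟩
    · rintro s t ⟨m, hm, h⟩ ⟨m', hm', h'⟩
      refine ⟨min m m', lt_min hm hm', fun ξ hξ => ?_⟩
      rcases hξ with hξ | hξ
      · exact (min_le_left _ _).trans (h ξ hξ)
      · exact (min_le_right _ _).trans (h' ξ hξ)
    · intro ξ hξ
      have hne : (M.Y ∩ Metric.ball ξ (r₀ / 2)).Nonempty := by
        obtain ⟨y, hy, hyd⟩ := Metric.mem_closure_iff.1 hξ (r₀ / 2) (by positivity)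
        exact ⟨y, hy.1, by rwa [Metric.mem_ball, dist_comm]⟩
      have hpos : 0 < volume.real (M.Y ∩ Metric.ball ξ (r₀ / 2)) := by
        refine ENNReal.toReal_pos
          ((M.Y_open.inter Metric.isOpen_ball).measure_pos volume hne).ne' ?_
        exact ((measure_mono Set.inter_subset_right).trans_lt measure_ball_lt_top).ne
      refine ⟨Metric.ball ξ (r₀ / 2), mem_nhdsWithin_of_mem_nhds
        (Metric.ball_mem_nhds ξ (by positivity)), _, hpos, fun ξ' hξ' => ?_⟩
      refine measureReal_mono (Set.inter_subset_inter_right _ fun y hy => ?_)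
        ((measure_mono Set.inter_subset_right).trans_lt measure_ball_lt_top).ne
      rw [Metric.mem_ball] at hy hξ' ⊢
      have := dist_triangle_right y ξ' ξ
      linarith
  obtain ⟨m, hm, h⟩ := hball
  refine ⟨c * m, by positivity, fun ξ hξ => ?_⟩
  have h1 := M.integral_Ycell_aTilde_mul (h := fun _ => 1) measurable_const (fun _ _ => rfl)
    (ξ := ξ) (by simpa using M.integrableOn_a_sub ξ M.Y)
  simp only [mul_one] at h1
  rw [kerMass, h1]
  have hfin : volume (M.Y ∩ Metric.ball ξ r₀) < ∞ :=
    (measure_mono Set.inter_subset_right).trans_lt measure_ball_lt_top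
  calc c * m ≤ c * volume.real (M.Y ∩ Metric.ball ξ r₀) := by
        gcongr
        exact h ξ (subset_closure hξ)
    _ = ∫ _η in M.Y ∩ Metric.ball ξ r₀, c := by
        rw [setIntegral_const, smul_eq_mul, mul_comm]
    _ ≤ ∫ η in M.Y ∩ Metric.ball ξ r₀, M.a (ξ - η) := by
        refine setIntegral_mono_on (integrableOn_const hfin.ne) (M.integrableOn_a_sub ξ _)
          (M.Y_open.measurableSet.inter measurableSet_ball) fun η hη => hac _ ?_
        have := hη.2
        rw [Metric.mem_ball, dist_comm, dist_eq_norm] at this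
        exact this.le
    _ ≤ ∫ η in M.Y, M.a (ξ - η) :=
        setIntegral_mono_set (M.integrableOn_a_sub ξ _)
          (Eventually.of_forall fun _ => M.a_nonneg _)
          (Set.inter_subset_left : M.Y ∩ _ ⊆ M.Y).eventuallyLE

end HighContrastModel

namespace HighContrastModel

variable {d : ℕ} (M : HighContrastModel d)

/-- The kernel `ã(ξ - η)` of the fast phase. -/
def fastKernel (ξ η : EuclideanSpace ℝ (Fin d)) : ℝ := M.aTilde (ξ - η)

/-- Lebesgue measure on one cell of `Y`. -/
def μY : Measure (EuclideanSpace ℝ (Fin d)) := volume.restrict M.Ycell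

instance : IsFiniteMeasure M.μY := inferInstanceAs (IsFiniteMeasure (volume.restrict M.Ycell))

theorem isSchurKernel_fast : IsSchurKernel M.fastKernel M.μY (1 * ∫ z, M.a z).toNNReal :=
  M.isSchurKernel_aTilde M.Ycell_subset

theorem isTruncatable_fast : IsTruncatable M.fastKernel M.μY :=
  M.isTruncatable_aTilde M.Ycell_subset

theorem ae_μY_iff {P : EuclideanSpace ℝ (Fin d) → Prop} :
    (∀ᵐ x ∂M.μY, P x) ↔ ∀ᵐ x, x ∈ M.Ycell → P x :=
  ae_restrict_iff' M.measurableSet_Ycell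

/-- A function without jumps inside the fast phase is constant there, since the fast phase is
connected by jumps. -/
theorem exists_ae_eq_const_of_fast {β : Type*} {u : EuclideanSpace ℝ (Fin d) → β}
    (hu : ∀ᵐ p ∂(M.μY.prod M.μY), M.fastKernel p.1 p.2 = 0 ∨ u p.1 = u p.2) :
    ∃ k, ∀ᵐ x ∂M.μY, u x = k := by
  have h1 : ∀ᵐ p : EuclideanSpace ℝ (Fin d) × EuclideanSpace ℝ (Fin d) ∂(volume.prod volume),
      p.1 ∈ M.Y → p.2 ∈ M.Y → M.aTilde (p.1 - p.2) = 0 ∨ u (cellPart p.1) = u (cellPart p.2) := by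
    refine ae_prod_of_ae_unitCell ?_ fun m n x y h hx hy => ?_
    · change ∀ᵐ p ∂((volume.restrict M.Ycell).prod (volume.restrict M.Ycell)), _ at hu
      rw [Measure.prod_restrict,
        ae_restrict_iff' (M.measurableSet_Ycell.prod M.measurableSet_Ycell)] at hu
      filter_upwards [hu] with p hp c1 c2 y1 y2
      rw [cellPart_of_mem c1, cellPart_of_mem c2]
      exact hp ⟨⟨y1, c1⟩, ⟨y2, c2⟩⟩
    · have h' := h ((M.Y_periodic m x).2 hx) ((M.Y_periodic n y).2 hy)
      simp only [cellPart_add] at h'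
      refine h'.imp_left fun h' => ?_
      rwa [add_sub_add_comm, sub_eq_add_neg (latticeVec m), ← latticeVec_neg, ← latticeVec_add,
        M.aTilde_periodic] at h'
  obtain ⟨r₀, hr₀, hpos⟩ := M.a_pos_near_zero
  obtain ⟨k, hk⟩ := exists_ae_eq_const_of_jump M.Y_open M.Y_nonempty hr₀ hpos M.Y_connected
    (u := fun x => u (cellPart x)) (by
      filter_upwards [h1, M.ae_aTildeE_sub_lt_top_prod] with p h3 h4 h6 h7 h5
      exact (h3 h6 h7).resolve_left (h5.trans_le (M.a_le_aTilde h4)).ne')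
  refine ⟨k, M.ae_μY_iff.2 ?_⟩
  filter_upwards [hk] with x hx hxY
  rw [← hx hxY.1, cellPart_of_mem hxY.2]

theorem volume_Ycell_pos : 0 < volume M.Ycell := by
  by_contra h
  have h1 : ∀ᵐ x, x ∉ M.Y := by
    refine ae_of_ae_unitCell ?_ fun n x hx => by rwa [M.Y_periodic] at hx
    filter_upwards [measure_eq_zero_iff_ae_notMem.1 (nonpos_iff_eq_zero.1 (not_lt.1 h))]
      with x hx hxC hxY
    exact hx ⟨hxY, hxC⟩
  exact (M.Y_open.measure_pos volume M.Y_nonempty).ne' (measure_eq_zero_iff_ae_notMem.2 h1)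

theorem volume_Ycell_real_pos : 0 < volume.real M.Ycell :=
  ENNReal.toReal_pos M.volume_Ycell_pos.ne'
    ((measure_mono Set.inter_subset_right).trans_lt volume_unitCell_lt_top).ne

/-- The cell problem is solvable for right-hand sides of mean zero: adding the projection to
constants makes the operator of the fast phase an invertible Fredholm operator. -/
theorem exists_solution_of_mean_zero (F : Lp ℂ 2 M.μY) (hF : ∫ x, F x ∂M.μY = 0) :
    ∃ u : Lp ℂ 2 M.μY, ∀ᵐ ξ ∂M.μY,
      (kerMass M.fastKernel M.μY ξ : ℂ) * u ξ - kerInt M.fastKernel M.μY u ξ = F ξ := by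
  have hk := M.isSchurKernel_fast
  have hV := hk.measurable_kerMass
  have hB : ∀ x, |kerMass M.fastKernel M.μY x| ≤ (1 * ∫ z, M.a z).toNNReal := fun x => by
    rw [abs_of_nonneg (hk.kerMass_nonneg x)]
    exact hk.kerMass_le x
  obtain ⟨A, hA⟩ := exists_isPotentialSub (μ := M.μY) hk hV hB
  obtain ⟨K, hK, -⟩ := hk.exists_clm
  have hm : ∀ᵐ x ∂M.μY, kerMass M.fastKernel M.μY x ≤ kerMass M.fastKernel M.μY x :=
    Eventually.of_forall fun _ => le_rfl
  have hsa := ContinuousLinearMap.isSelfAdjoint_iff_isSymmetric.1 (hA.isSelfAdjoint hk hV hB)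
  -- the constant function `1`, which spans the kernel of `A`
  set e : Lp ℂ 2 M.μY := Lp.const 2 M.μY 1 with he
  have hec : e =ᵐ[M.μY] fun _ => 1 := Lp.coeFn_const ..
  have hAe : A e = 0 := by
    rw [Lp.eq_zero_iff_ae_eq_zero]
    filter_upwards [hA e, hec] with x h1 h2
    rw [h1, h2, kerInt_congr hec, kerInt]
    simp only [mul_one, integral_complex_ofReal, kerMass, sub_self, Pi.zero_apply]
  have hinner : ∀ u : Lp ℂ 2 M.μY, inner ℂ e u = ∫ x, u x ∂M.μY := by
    intro u
    rw [inner_eq_integral_of_ae u (Eventually.of_forall fun _ => rfl)]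
    refine integral_congr_ae ?_
    filter_upwards [hec] with x hx
    rw [hx, map_one, one_mul]
  have hee : inner ℂ e e ≠ 0 := by
    rw [hinner, integral_congr_ae hec]
    simp only [integral_const, ne_eq]
    have : M.μY.real Set.univ = volume.real M.Ycell := by
      rw [μY, measureReal_restrict_apply_univ]
    rw [this]
    simpa using M.volume_Ycell_real_pos.ne'
  set Pr : Lp ℂ 2 M.μY →L[ℂ] Lp ℂ 2 M.μY := (innerSL ℂ e).smulRight e with hPr
  have hPra : ∀ u, Pr u = (inner ℂ e u : ℂ) • e := fun u => rfl
  -- `A` maps to functions of mean zero, so a solution for `A + Pr` with such a right-hand side has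
  -- mean zero, and hence is a solution for `A`
  have hmean : ∀ u, A u + Pr u = F ∨ A u + Pr u = 0 → inner ℂ e u = 0 := by
    intro u hu
    have h1 : inner ℂ e (A u + Pr u) = 0 := by
      rcases hu with hu | hu
      · rw [hu, hinner, hF]
      · rw [hu, inner_zero_right]
    have h2 : inner ℂ e (A u) = 0 := by
      have := hsa e u
      simp only [ContinuousLinearMap.coe_coe] at this
      rw [← this, hAe, inner_zero_left]
    rw [inner_add_right, h2, zero_add, hPra, inner_smul_right] at h1
    exact (mul_eq_zero.1 h1).resolve_right hee
  obtain ⟨m₀, hm₀, hlow⟩ := M.exists_le_kerMass_Ycell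
  have hunit : IsUnit (A + Pr) := by
    refine isUnit_mul_sub_compact (K := K - Pr) hV hm₀ hB
      (M.ae_μY_iff.2 (Eventually.of_forall hlow))
      ((hk.isCompactOperator M.isTruncatable_fast hK).sub (isCompactOperator_rankOne e e))
      (fun u => ?_) fun u hu => ?_
    · have e1 : (A + Pr) u = A u + Pr u := rfl
      have e2 : (K - Pr) u = K u - Pr u := rfl
      rw [e1, e2]
      filter_upwards [hA u, hK u, Lp.coeFn_add (A u) (Pr u), Lp.coeFn_sub (K u) (Pr u)]
        with x h1 h2 h3 h4
      rw [h3, h4, Pi.add_apply, Pi.sub_apply, h1, h2]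
      ring
    · have h1 : A u + Pr u = 0 := hu
      have h2 := hmean u (Or.inr h1)
      rw [hPra, h2, zero_smul, add_zero] at h1
      obtain ⟨h3, -⟩ := hA.of_apply_eq_zero hk hV hB hm h1
      obtain ⟨k, hk'⟩ := M.exists_ae_eq_const_of_fast h3
      have h4 : u = k • e := by
        refine Lp.ext ?_
        filter_upwards [hk', Lp.coeFn_smul k e, hec] with x h5 h6 h7
        rw [h5, h6, Pi.smul_apply, h7, smul_eq_mul, mul_one]
      rw [h4, inner_smul_right] at h2
      rw [h4, (mul_eq_zero.1 h2).resolve_right hee, zero_smul]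
  obtain ⟨⟨T, R, hTR, hRT⟩, hT⟩ := hunit
  have hT : T = A + Pr := hT
  have hRF : A (R F) + Pr (R F) = F := by
    have : (A + Pr) (R F) = F := by
      rw [← hT]
      change (T * R) F = F
      rw [hTR]
      rfl
    exact this
  have h1 := hmean _ (Or.inl hRF)
  rw [hPra, h1, zero_smul, add_zero] at hRF
  refine ⟨R F, ?_⟩
  have h2 := hA (R F)
  rw [hRF] at h2
  exact h2.mono fun x hx => hx.symm

theorem integrable_a_sub_smul (ξ : EuclideanSpace ℝ (Fin d)) :
    Integrable fun η => M.a (ξ - η) • (η - ξ) := by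
  have h : Integrable fun z => M.a z • z := by
    refine M.integrable_norm_mul_a.mono' (M.a_measurable.smul measurable_id).aestronglyMeasurable
      (Eventually.of_forall fun z => ?_)
    rw [norm_smul, Real.norm_of_nonneg (M.a_nonneg z), mul_comm]
  refine (h.comp_sub_right ξ).congr (Eventually.of_forall fun η => ?_)
  simp only [M.a_sub_comm ξ η]

/-- The component of the drift `∫_Y a(ξ - η) (η - ξ) dη` in direction `p`. -/
def drift (p ξ : EuclideanSpace ℝ (Fin d)) : ℝ := ∫ η in M.Y, M.a (ξ - η) * inner ℝ p (η - ξ)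

theorem inner_integral_a (p ξ : EuclideanSpace ℝ (Fin d)) :
    inner ℝ p (∫ η in M.Y, M.a (ξ - η) • (η - ξ)) = M.drift p ξ := by
  rw [← integral_inner (M.integrable_a_sub_smul ξ).integrableOn]
  simp only [inner_smul_right, drift]

theorem measurable_drift (p : EuclideanSpace ℝ (Fin d)) : Measurable (M.drift p) := by
  have h : Measurable fun x : EuclideanSpace ℝ (Fin d) × EuclideanSpace ℝ (Fin d) =>
      M.a (x.1 - x.2) * (inner ℝ p (x.2 - x.1) : ℝ) :=
    (M.a_measurable.comp (measurable_fst.sub measurable_snd)).mul (by fun_prop)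
  exact (h.stronglyMeasurable.integral_prod_right' (ν := volume.restrict M.Y)).measurable

theorem abs_drift_le (p ξ : EuclideanSpace ℝ (Fin d)) :
    |M.drift p ξ| ≤ ‖p‖ * ∫ z, ‖z‖ * M.a z := by
  have h1 : Integrable fun η => ‖η - ξ‖ * M.a (η - ξ) := M.integrable_norm_mul_a.comp_sub_right ξ
  have h2 : ∀ η, ‖M.a (ξ - η) * (inner ℝ p (η - ξ) : ℝ)‖ ≤ ‖p‖ * (‖η - ξ‖ * M.a (η - ξ)) := by
    intro η
    rw [norm_mul, Real.norm_of_nonneg (M.a_nonneg _), M.a_sub_comm]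
    calc M.a (η - ξ) * ‖(inner ℝ p (η - ξ) : ℝ)‖ ≤ M.a (η - ξ) * (‖p‖ * ‖η - ξ‖) :=
          mul_le_mul_of_nonneg_left (norm_inner_le_norm _ _) (M.a_nonneg _)
      _ = _ := by ring
  calc |M.drift p ξ| ≤ ∫ η in M.Y, ‖p‖ * (‖η - ξ‖ * M.a (η - ξ)) :=
        norm_integral_le_of_norm_le (h1.const_mul _).integrableOn (Eventually.of_forall h2)
    _ ≤ ∫ η, ‖p‖ * (‖η - ξ‖ * M.a (η - ξ)) :=
        setIntegral_le_integral (h1.const_mul _) (Eventually.of_forall fun η => by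
          have := M.a_nonneg (η - ξ)
          positivity)
    _ = ‖p‖ * ∫ z, ‖z‖ * M.a z := by
        rw [integral_const_mul, integral_sub_right_eq_self (fun z => ‖z‖ * M.a z)]

/-- The drift has mean zero over a cell, so that the cell problem for it is solvable. -/
theorem integral_drift (p : EuclideanSpace ℝ (Fin d)) : ∫ ξ, M.drift p ξ ∂M.μY = 0 := by
  have h := M.integral_jump' ((M.memLp_jump_inner p).integrable one_le_two)
  rw [M.integral_jump_inner] at h
  rw [h]
  refine integral_congr_ae (Eventually.of_forall fun η => ?_)
  simp only [drift, M.a_sub_comm η]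

theorem exists_drift_solution (p : EuclideanSpace ℝ (Fin d)) :
    ∃ u : Lp ℂ 2 M.μY, ∀ᵐ ξ ∂M.μY, (kerMass M.fastKernel M.μY ξ : ℂ) * u ξ
      - kerInt M.fastKernel M.μY u ξ = (M.drift p ξ : ℂ) := by
  have hmem : MemLp (fun ξ => (M.drift p ξ : ℂ)) 2 M.μY := by
    refine MemLp.of_bound (Complex.measurable_ofReal.comp
      (M.measurable_drift p)).aestronglyMeasurable (‖p‖ * ∫ z, ‖z‖ * M.a z)
      (Eventually.of_forall fun ξ => ?_)
    rw [Complex.norm_real]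
    exact M.abs_drift_le p ξ
  obtain ⟨u, hu⟩ := M.exists_solution_of_mean_zero (hmem.toLp _) (by
    rw [integral_congr_ae hmem.coeFn_toLp, integral_complex_ofReal, M.integral_drift,
      Complex.ofReal_zero])
  refine ⟨u, ?_⟩
  filter_upwards [hu, hmem.coeFn_toLp] with ξ h1 h2
  rw [h1, h2]

/-- Correctors exist: their components are real parts of solutions of the cell problem for the drift in
the coordinate directions, extended periodically. -/
theorem exists_isCorrector : ∃ φ, M.IsCorrector φ := by
  choose u hu using fun j : Fin d => M.exists_drift_solution (EuclideanSpace.single j 1)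
  have hk := M.isSchurKernel_fast
  set φ : EuclideanSpace ℝ (Fin d) → EuclideanSpace ℝ (Fin d) :=
    fun ξ => WithLp.toLp 2 fun j => (u j (cellPart ξ)).re with hφ
  have hφc : ∀ ξ ∈ M.Ycell, ∀ j, φ ξ j = (u j ξ).re := by
    intro ξ hξ j
    simp only [hφ, cellPart_of_mem hξ.2]
  have hφae : ∀ j, (fun ξ => φ ξ j) =ᵐ[M.μY] fun ξ => (u j ξ).re := fun j =>
    M.ae_μY_iff.2 (Eventually.of_forall fun ξ hξ => hφc ξ hξ j)
  refine ⟨φ, fun n ξ => ?_, ?_, ?_⟩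
  · simp only [hφ, cellPart_add]
  · change MemLp φ 2 M.μY
    rw [memLp_piLp_iff]
    exact fun j => (Lp.memLp (u j)).re.ae_eq (hφae j).symm
  · change ∀ᵐ ξ ∂M.μY, ∫ η, M.aTilde (ξ - η) • (φ η - φ ξ) ∂M.μY = _
    have hint : ∀ᵐ ξ ∂M.μY, ∀ j, Integrable (fun η => (M.fastKernel ξ η : ℂ) * u j η) M.μY :=
      ae_all_iff.2 fun j => hk.ae_integrable (Lp.memLp (u j))
    filter_upwards [hint, ae_all_iff.2 hu, M.ae_μY_iff.2 (Eventually.of_forall fun ξ hξ => hξ)]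
      with ξ h1 h2 hξ
    have hre : ∀ j, Integrable (fun η => M.fastKernel ξ η * (u j η).re) M.μY := by
      intro j
      refine (h1 j).re.congr (Eventually.of_forall fun η => ?_)
      simp
    have e1 : ∀ j, (fun η => (M.aTilde (ξ - η) • (φ η - φ ξ)) j) =ᵐ[M.μY]
        fun η => M.fastKernel ξ η * (u j η).re - M.fastKernel ξ η * (u j ξ).re := by
      intro j
      filter_upwards [hφae j] with η h3
      rw [PiLp.smul_apply, PiLp.sub_apply, h3, hφc ξ hξ j, smul_eq_mul, mul_sub]
      rfl
    have hi2 : ∀ j, Integrable (fun η => M.fastKernel ξ η * (u j ξ).re) M.μY := fun j =>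
      (hk.integrable ξ).mul_const _
    ext j
    rw [eval_integral_piLp fun j => ((hre j).sub (hi2 j)).congr (e1 j).symm,
      integral_congr_ae (e1 j), integral_sub (hre j) (hi2 j), integral_mul_const]
    have h3 := congrArg Complex.re (h2 j)
    have h4 : (kerInt M.fastKernel M.μY (u j) ξ).re =
        ∫ η, M.fastKernel ξ η * (u j η).re ∂M.μY := by
      rw [kerInt]
      have := integral_re (h1 j)
      simp only [RCLike.re_to_complex, Complex.re_ofReal_mul] at this
      exact this.symm
    rw [Complex.sub_re, Complex.re_ofReal_mul, Complex.ofReal_re, h4,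
      ← M.inner_integral_a, EuclideanSpace.inner_single_left] at h3
    simp only [map_one, one_mul] at h3
    rw [PiLp.neg_apply, ← h3, kerMass]
    ring

end HighContrastModel

/-! ### Ellipticity of the effective matrix -/

namespace HighContrastModel

variable {d : ℕ} (M : HighContrastModel d)

theorem effMatrix_congr {φ φ' : EuclideanSpace ℝ (Fin d) → EuclideanSpace ℝ (Fin d)}
    (h : φ =ᵐ[volume.restrict M.Ycell] φ') : M.effMatrix φ = M.effMatrix φ' := by
  funext i j
  unfold effMatrix
  congr 1
  refine integral_congr_ae (Eventually.of_forall fun ξ => integral_congr_ae ?_)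
  filter_upwards [h] with η hη
  rw [hη]

/-- Every corrector has a measurable periodic representative, with the same effective matrix. -/
theorem exists_measurable_isCorrector
    {φ : EuclideanSpace ℝ (Fin d) → EuclideanSpace ℝ (Fin d)} (hφ : M.IsCorrector φ) :
    ∃ φ', Measurable φ' ∧ M.IsCorrector φ' ∧ M.effMatrix φ = M.effMatrix φ' := by
  obtain ⟨-, hmem, heq⟩ := hφ
  set ψ := hmem.1.mk φ with hψ
  have hψm : Measurable ψ := hmem.1.stronglyMeasurable_mk.measurable
  have h : φ =ᵐ[volume.restrict M.Ycell] fun x => ψ (cellPart x) := by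
    have h1 := hmem.1.ae_eq_mk
    have h2 : ∀ᵐ x ∂(volume.restrict M.Ycell), x ∈ M.Ycell := ae_restrict_mem M.measurableSet_Ycell
    filter_upwards [h1, h2] with x hx hxY
    rw [hx, cellPart_of_mem hxY.2]
  refine ⟨fun x => ψ (cellPart x), hψm.comp measurable_cellPart,
    ⟨fun n ξ => by simp only [cellPart_add], hmem.ae_eq h, ?_⟩, M.effMatrix_congr h⟩
  filter_upwards [heq, h] with ξ h1 h2
  rw [← h1]
  refine integral_congr_ae ?_
  filter_upwards [h] with η h3
  rw [h3, h2]

section Corrector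

variable {M} {φ : EuclideanSpace ℝ (Fin d) → EuclideanSpace ℝ (Fin d)}

theorem IsCorrector.periodic_inner (hφ : M.IsCorrector φ) (p : EuclideanSpace ℝ (Fin d))
    (n : Fin d → ℤ) (x : EuclideanSpace ℝ (Fin d)) :
    (inner ℝ p (φ (x + latticeVec n)) : ℝ) = inner ℝ p (φ x) := by
  rw [hφ.1]

theorem measurable_inner_field (hm : Measurable φ) (p : EuclideanSpace ℝ (Fin d)) :
    Measurable fun x => (inner ℝ p (φ x) : ℝ) := by fun_prop

theorem IsCorrector.memLp_inner (hφ : M.IsCorrector φ) (p : EuclideanSpace ℝ (Fin d)) :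
    MemLp (fun x => (inner ℝ p (φ x) : ℝ)) 2 (volume.restrict M.Ycell) :=
  MemLp.const_inner (𝕜 := ℝ) p hφ.2.1

theorem IsCorrector.memLp_snd (hφ : M.IsCorrector φ) (hm : Measurable φ)
    (p : EuclideanSpace ℝ (Fin d)) :
    MemLp (fun x : EuclideanSpace ℝ (Fin d) × EuclideanSpace ℝ (Fin d) =>
      (inner ℝ p (φ x.2) : ℝ)) 2 M.jump :=
  M.memLp_jump_snd (g := fun x => (inner ℝ p (φ x) : ℝ)) (measurable_inner_field hm p)
    (hφ.memLp_inner p)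

theorem IsCorrector.memLp_fst (hφ : M.IsCorrector φ) (hm : Measurable φ)
    (p : EuclideanSpace ℝ (Fin d)) :
    MemLp (fun x : EuclideanSpace ℝ (Fin d) × EuclideanSpace ℝ (Fin d) =>
      (inner ℝ p (φ x.1) : ℝ)) 2 M.jump :=
  M.memLp_jump_fst (g := fun x => (inner ℝ p (φ x) : ℝ)) (measurable_inner_field hm p)
    (hφ.periodic_inner p) (hφ.memLp_inner p)

/-- The corrector equation in direction `p`, with both integrals over the whole fast phase. -/
theorem IsCorrector.ae_integral_eq (hφ : M.IsCorrector φ) (hm : Measurable φ)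
    (p : EuclideanSpace ℝ (Fin d)) :
    ∀ᵐ η ∂(volume.restrict M.Ycell),
      ∫ ξ in M.Y, M.a (ξ - η) * ((inner ℝ p (φ ξ) : ℝ) - inner ℝ p (φ η)) =
        -∫ ξ in M.Y, M.a (ξ - η) * (inner ℝ p (ξ - η) : ℝ) := by
  have hk := M.isSchurKernel_fast
  have h1 := hk.ae_integrable (u := fun η => ((‖φ η‖ : ℝ) : ℂ)) hφ.2.1.norm.ofReal
  have h2 := (M.integrable_jump_iff.1
    ((hφ.memLp_fst hm p).integrable one_le_two)).prod_left_ae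
  filter_upwards [h1, h2, hφ.2.2] with η h1 h2 h3
  have i1 : Integrable (fun ξ => M.aTilde (η - ξ) * ‖φ ξ‖) (volume.restrict M.Ycell) := by
    refine h1.re.congr (Eventually.of_forall fun ξ => ?_)
    simp [fastKernel]
  have i2 : Integrable (fun ξ => M.aTilde (η - ξ)) (volume.restrict M.Ycell) := hk.integrable η
  have i3 : Integrable (fun ξ => M.aTilde (η - ξ) • (φ ξ - φ η)) (volume.restrict M.Ycell) := by
    refine (i1.add (i2.mul_const ‖φ η‖)).mono' ?_ (Eventually.of_forall fun ξ => ?_)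
    · exact i2.1.smul (hm.sub_const _).aestronglyMeasurable
    · rw [norm_smul, Real.norm_of_nonneg (M.aTilde_nonneg _), Pi.add_apply, ← mul_add]
      exact mul_le_mul_of_nonneg_left (norm_sub_le _ _) (M.aTilde_nonneg _)
  have h4 := congrArg (fun v => (inner ℝ p v : ℝ)) h3
  simp only [inner_neg_right] at h4
  rw [M.inner_integral_a, ← integral_inner i3] at h4
  simp only [inner_smul_right, inner_sub_right] at h4
  have i4 : IntegrableOn (fun ξ => M.a (η - ξ) * ((inner ℝ p (φ ξ) : ℝ) - inner ℝ p (φ η)))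
      M.Y := by
    simp only [mul_sub, M.a_sub_comm η]
    exact h2.sub ((M.integrableOn_a_sub η M.Y).congr_fun
      (fun ξ _ => M.a_sub_comm η ξ) M.Y_open.measurableSet |>.mul_const _)
  rw [M.integral_Ycell_aTilde_mul ((measurable_inner_field hm p).sub_const _)
    (fun n x => by rw [hφ.1]) i4, drift] at h4
  simpa only [M.a_sub_comm η] using h4

/-- The corrector equation tested against the corrector itself. -/
theorem IsCorrector.integral_sub_mul (hφ : M.IsCorrector φ) (hm : Measurable φ)
    (p : EuclideanSpace ℝ (Fin d)) :
    ∫ x, ((inner ℝ p (φ x.1) : ℝ) - inner ℝ p (φ x.2)) * inner ℝ p (φ x.2) ∂M.jump =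
      -∫ x, (inner ℝ p (x.1 - x.2) : ℝ) * inner ℝ p (φ x.2) ∂M.jump := by
  have i1 : Integrable (fun x : EuclideanSpace ℝ (Fin d) × EuclideanSpace ℝ (Fin d) =>
      ((inner ℝ p (φ x.1) : ℝ) - inner ℝ p (φ x.2)) * inner ℝ p (φ x.2)) M.jump :=
    ((hφ.memLp_fst hm p).sub (hφ.memLp_snd hm p)).integrable_mul (hφ.memLp_snd hm p)
  have i2 : Integrable (fun x : EuclideanSpace ℝ (Fin d) × EuclideanSpace ℝ (Fin d) =>
      (inner ℝ p (x.1 - x.2) : ℝ) * inner ℝ p (φ x.2)) M.jump :=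
    (M.memLp_jump_inner p).integrable_mul (hφ.memLp_snd hm p)
  rw [M.integral_jump' i1, M.integral_jump' i2, ← integral_neg]
  refine integral_congr_ae ?_
  filter_upwards [hφ.ae_integral_eq hm p] with η h
  simp only [← mul_assoc, integral_mul_const]
  rw [h, neg_mul]

/-- The integral defining the effective matrix is the Dirichlet energy of `p · (ξ + φ)`: expand the
square, and use the symmetry of the jump measure and the corrector equation. -/
theorem IsCorrector.energy_eq (hφ : M.IsCorrector φ) (hm : Measurable φ)
    (p : EuclideanSpace ℝ (Fin d)) :
    ∫ x, (2⁻¹ * (inner ℝ p (x.1 - x.2) : ℝ) ^ 2 -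
        (inner ℝ p (x.1 - x.2) : ℝ) * inner ℝ p (φ x.2)) ∂M.jump =
      2⁻¹ * ∫ x, ((inner ℝ p (x.1 - x.2) : ℝ) + inner ℝ p (φ x.1) - inner ℝ p (φ x.2)) ^ 2
        ∂M.jump := by
  have hz := M.memLp_jump_inner p
  have h1 := hφ.memLp_fst hm p
  have h2 := hφ.memLp_snd hm p
  have hgm := measurable_inner_field hm p
  have s1 := (M.integral_jump_swap
    (F := fun x => (inner ℝ p (x.1 - x.2) : ℝ) * inner ℝ p (φ x.2)) (by fun_prop)
    (fun n x y => by simp only [add_sub_add_right_eq_sub, hφ.1]) (hz.integrable_mul h2)).2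
  have s2 := (M.integral_jump_swap
    (F := fun x => ((inner ℝ p (φ x.1) : ℝ) - inner ℝ p (φ x.2)) * inner ℝ p (φ x.2))
    (by fun_prop) (fun n x y => by simp only [hφ.1]) ((h1.sub h2).integrable_mul h2)).2
  have c := hφ.integral_sub_mul hm p
  have e1 : ∀ x : EuclideanSpace ℝ (Fin d) × EuclideanSpace ℝ (Fin d),
      (inner ℝ p (x.swap.1 - x.swap.2) : ℝ) * inner ℝ p (φ x.swap.2) =
        -((inner ℝ p (x.1 - x.2) : ℝ) * inner ℝ p (φ x.1)) := by
    rintro ⟨x, y⟩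
    simp only [Prod.swap_prod_mk, inner_sub_right]
    ring
  have e2 : ∀ x : EuclideanSpace ℝ (Fin d) × EuclideanSpace ℝ (Fin d),
      ((inner ℝ p (φ x.swap.1) : ℝ) - inner ℝ p (φ x.swap.2)) * inner ℝ p (φ x.swap.2) =
        -(((inner ℝ p (φ x.1) : ℝ) - inner ℝ p (φ x.2)) * inner ℝ p (φ x.1)) := by
    rintro ⟨x, y⟩
    simp only [Prod.swap_prod_mk]
    ring
  simp only [e1, integral_neg] at s1
  simp only [e2, integral_neg] at s2
  have i1 : Integrable (fun x : EuclideanSpace ℝ (Fin d) × EuclideanSpace ℝ (Fin d) =>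
      (inner ℝ p (x.1 - x.2) : ℝ) ^ 2) M.jump := hz.integrable_sq
  have i2 : Integrable (fun x : EuclideanSpace ℝ (Fin d) × EuclideanSpace ℝ (Fin d) =>
      (inner ℝ p (x.1 - x.2) : ℝ) * inner ℝ p (φ x.1)) M.jump := hz.integrable_mul h1
  have i3 : Integrable (fun x : EuclideanSpace ℝ (Fin d) × EuclideanSpace ℝ (Fin d) =>
      (inner ℝ p (x.1 - x.2) : ℝ) * inner ℝ p (φ x.2)) M.jump := hz.integrable_mul h2
  have i4 : Integrable (fun x : EuclideanSpace ℝ (Fin d) × EuclideanSpace ℝ (Fin d) =>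
      ((inner ℝ p (φ x.1) : ℝ) - inner ℝ p (φ x.2)) * inner ℝ p (φ x.1)) M.jump :=
    (h1.sub h2).integrable_mul h1
  have i5 : Integrable (fun x : EuclideanSpace ℝ (Fin d) × EuclideanSpace ℝ (Fin d) =>
      ((inner ℝ p (φ x.1) : ℝ) - inner ℝ p (φ x.2)) * inner ℝ p (φ x.2)) M.jump :=
    (h1.sub h2).integrable_mul h2
  have e3 : ∀ x : EuclideanSpace ℝ (Fin d) × EuclideanSpace ℝ (Fin d),
      ((inner ℝ p (x.1 - x.2) : ℝ) + inner ℝ p (φ x.1) - inner ℝ p (φ x.2)) ^ 2 =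
      (inner ℝ p (x.1 - x.2) : ℝ) ^ 2 + (2 * ((inner ℝ p (x.1 - x.2) : ℝ) * inner ℝ p (φ x.1))
      - 2 * ((inner ℝ p (x.1 - x.2) : ℝ) * inner ℝ p (φ x.2))
      + (((inner ℝ p (φ x.1) : ℝ) - inner ℝ p (φ x.2)) * inner ℝ p (φ x.1)
      - ((inner ℝ p (φ x.1) : ℝ) - inner ℝ p (φ x.2)) * inner ℝ p (φ x.2))) := fun x => by ring
  simp only [e3]
  have i6 := (i2.const_mul 2).sub' (i3.const_mul 2)
  have i7 := i4.sub' i5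
  have i8 := i6.fun_add i7
  rw [integral_sub (i1.const_mul _) i3, integral_const_mul, integral_add i1 i8,
    integral_add i6 i7, integral_sub (i2.const_mul _) (i3.const_mul _), integral_sub i4 i5,
    integral_const_mul, integral_const_mul]
  linarith

/-- The quadratic form of the effective matrix is the Dirichlet energy of `p · (ξ + φ)` per volume of
the fast phase. -/
theorem IsCorrector.matForm_effMatrix (hφ : M.IsCorrector φ) (hm : Measurable φ)
    (p : EuclideanSpace ℝ (Fin d)) :
    matForm (M.effMatrix φ) p = (volume.real M.Ycell)⁻¹ *
      (2⁻¹ * ∫ x, ((inner ℝ p (x.1 - x.2) : ℝ) + inner ℝ p (φ x.1) - inner ℝ p (φ x.2)) ^ 2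
        ∂M.jump) := by
  have hz : ∀ i, MemLp (fun x : EuclideanSpace ℝ (Fin d) × EuclideanSpace ℝ (Fin d) =>
      (x.1 - x.2) i) 2 M.jump := by
    intro i
    simpa [EuclideanSpace.inner_single_left] using
      M.memLp_jump_inner (EuclideanSpace.single i (1 : ℝ))
  have hg : ∀ i, MemLp (fun x : EuclideanSpace ℝ (Fin d) × EuclideanSpace ℝ (Fin d) =>
      φ x.2 i) 2 M.jump := by
    intro i
    simpa [EuclideanSpace.inner_single_left] using
      hφ.memLp_snd hm (EuclideanSpace.single i (1 : ℝ))
  have hi : ∀ i j, Integrable (fun x : EuclideanSpace ℝ (Fin d) × EuclideanSpace ℝ (Fin d) =>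
      2⁻¹ * ((x.1 - x.2) i * (x.1 - x.2) j) - (x.1 - x.2) i * φ x.2 j) M.jump := fun i j =>
    (((hz i).integrable_mul (hz j)).const_mul _).sub ((hz i).integrable_mul (hg j))
  have he : ∀ i j, M.effMatrix φ i j = (volume.real M.Ycell)⁻¹ *
      ∫ x, (2⁻¹ * ((x.1 - x.2) i * (x.1 - x.2) j) - (x.1 - x.2) i * φ x.2 j) ∂M.jump := by
    intro i j
    rw [M.integral_jump (hi i j), effMatrix]
  rw [← hφ.energy_eq hm p, matForm]
  simp only [he, mul_assoc, ← Finset.mul_sum]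
  congr 1
  have h1 : ∀ x : EuclideanSpace ℝ (Fin d) × EuclideanSpace ℝ (Fin d),
      2⁻¹ * (inner ℝ p (x.1 - x.2) : ℝ) ^ 2 -
        (inner ℝ p (x.1 - x.2) : ℝ) * inner ℝ p (φ x.2) =
      ∑ i, ∑ j, (2⁻¹ * ((x.1 - x.2) i * (x.1 - x.2) j) - (x.1 - x.2) i * φ x.2 j) *
        (p i * p j) := by
    intro x
    have h2 : ∀ y : EuclideanSpace ℝ (Fin d), (inner ℝ p y : ℝ) = ∑ i, p i * y i := by
      intro y
      simp [PiLp.inner_apply, mul_comm]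
    rw [h2, h2, sq, Finset.sum_mul_sum, Finset.sum_mul_sum, Finset.mul_sum,
      ← Finset.sum_sub_distrib]
    refine Finset.sum_congr rfl fun i _ => ?_
    rw [Finset.mul_sum, ← Finset.sum_sub_distrib]
    exact Finset.sum_congr rfl fun j _ => by ring
  simp only [h1]
  rw [integral_finsetSum _ fun i _ => integrable_finsetSum _ fun j _ => (hi i j).mul_const _]
  refine Finset.sum_congr rfl fun i _ => ?_
  rw [integral_finsetSum _ fun j _ => (hi i j).mul_const _]
  refine Finset.sum_congr rfl fun j _ => ?_
  rw [integral_mul_const]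

/-- If the energy in direction `p` vanishes, then `p · (ξ + φ)` is constant on the fast phase, which
is connected by jumps; as `φ` is periodic, `p` is orthogonal to all lattice vectors, so `p = 0`. -/
theorem IsCorrector.matForm_pos (hφ : M.IsCorrector φ) (hm : Measurable φ)
    {p : EuclideanSpace ℝ (Fin d)} (hp : p ≠ 0) : 0 < matForm (M.effMatrix φ) p := by
  have hz := M.memLp_jump_inner p
  have h1 := hφ.memLp_fst hm p
  have h2 := hφ.memLp_snd hm p
  rw [hφ.matForm_effMatrix hm]
  refine mul_pos (inv_pos.2 M.volume_Ycell_real_pos) (mul_pos (by norm_num) ?_)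
  refine (integral_nonneg fun x => sq_nonneg _).lt_of_ne' fun h0 => hp ?_
  have hi : Integrable (fun x : EuclideanSpace ℝ (Fin d) × EuclideanSpace ℝ (Fin d) =>
      ((inner ℝ p (x.1 - x.2) : ℝ) + inner ℝ p (φ x.1) - inner ℝ p (φ x.2)) ^ 2) M.jump :=
    ((hz.add h1).sub h2).integrable_sq
  rw [integral_eq_zero_iff_of_nonneg (fun x => sq_nonneg _) hi] at h0
  rw [jump, Filter.EventuallyEq, ae_withDensity_iff M.measurable_jump_density,
    Measure.prod_restrict,
    ae_restrict_iff' (M.Y_open.measurableSet.prod M.measurableSet_Ycell)] at h0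
  have h3 : ∀ᵐ x : EuclideanSpace ℝ (Fin d) × EuclideanSpace ℝ (Fin d) ∂(volume.prod volume),
      x.1 ∈ M.Y → x.2 ∈ M.Y → 0 < M.a (x.1 - x.2) →
        (inner ℝ p x.1 : ℝ) + inner ℝ p (φ x.1) = inner ℝ p x.2 + inner ℝ p (φ x.2) := by
    refine ae_prod_of_ae_unitCell_diag ?_ ?_
    · filter_upwards [h0] with x hx hc y1 y2 ha
      have := hx ⟨y1, y2, hc⟩ (ENNReal.ofReal_pos.2 ha).ne'
      simp only [Pi.zero_apply, inner_sub_right] at this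
      have := pow_eq_zero_iff two_ne_zero |>.1 this
      linarith
    · intro n x y h y1 y2 ha
      have := h ((M.Y_periodic n x).2 y1) ((M.Y_periodic n y).2 y2)
        (by simpa only [add_sub_add_right_eq_sub] using ha)
      simp only [hφ.1, inner_add_right] at this ⊢
      linarith
  obtain ⟨r₀, hr₀, hpos⟩ := M.a_pos_near_zero
  obtain ⟨k, hk⟩ := exists_ae_eq_const_of_jump M.Y_open M.Y_nonempty hr₀ hpos M.Y_connected
    (u := fun x => (inner ℝ p x : ℝ) + inner ℝ p (φ x)) h3
  have hlat : ∀ n : Fin d → ℤ, (inner ℝ p (latticeVec n) : ℝ) = 0 := by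
    intro n
    have hk' : ∀ᵐ x, x + latticeVec n ∈ M.Y → (inner ℝ p (x + latticeVec n) : ℝ) +
        inner ℝ p (φ (x + latticeVec n)) = k :=
      (measurePreserving_add_right volume (latticeVec n)).quasiMeasurePreserving.ae hk
    have hYpos : 0 < volume M.Y := M.Y_open.measure_pos volume M.Y_nonempty
    by_contra hne
    refine hYpos.ne' (measure_eq_zero_iff_ae_notMem.2 ?_)
    filter_upwards [hk, hk'] with x e1 e2 hx
    have e3 := e1 hx
    have e4 := e2 ((M.Y_periodic n x).2 hx)
    rw [hφ.1, inner_add_right] at e4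
    exact hne (by linarith)
  ext i
  have := hlat (Pi.single i 1)
  have e : (latticeVec (Pi.single i 1) : EuclideanSpace ℝ (Fin d)) = EuclideanSpace.single i 1 := by
    ext j
    rw [latticeVec_apply]
    by_cases h : j = i
    · subst h
      simp
    · simp [h]
  rw [e, EuclideanSpace.inner_single_right] at this
  simpa using this

/-- The effective matrix is elliptic: its quadratic form has a positive minimum on the sphere. -/
theorem IsCorrector.exists_ellipticity (hφ : M.IsCorrector φ) :
    ∃ c > 0, ∀ p, c * ‖p‖ ^ 2 ≤ matForm (M.effMatrix φ) p := by
  obtain ⟨φ', hm, hφ', he⟩ := M.exists_measurable_isCorrector hφ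
  rw [he]
  have := M.nonempty_fin
  have hcont : Continuous (matForm (M.effMatrix φ')) := by
    unfold matForm
    fun_prop
  obtain ⟨q, hq, hmin⟩ := (isCompact_sphere (0 : EuclideanSpace ℝ (Fin d)) 1).exists_isMinOn
    (NormedSpace.sphere_nonempty.2 zero_le_one) hcont.continuousOn
  have hq0 : q ≠ 0 := by
    rintro rfl
    simp at hq
  refine ⟨_, hφ'.matForm_pos hm hq0, fun p => ?_⟩
  rcases eq_or_ne p 0 with rfl | hp
  · simp [matForm]
  · have h1 : matForm (M.effMatrix φ') q ≤ matForm (M.effMatrix φ') (‖p‖⁻¹ • p) :=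
      hmin (by simp [norm_smul, hp])
    rw [matForm_smul, inv_pow, ← div_eq_inv_mul, le_div_iff₀ (by positivity)] at h1
    exact h1

end Corrector

end HighContrastModel

/-! ### The generator as a block operator -/

theorem IsSchurKernel.ae_integrable_slice {W X : Type*} [MeasurableSpace W] [MeasurableSpace X]
    {ν : Measure W} [SFinite ν] {μ : Measure X} [IsFiniteMeasure μ] {k : X → X → ℝ} {C : NNReal}
    (hk : IsSchurKernel k μ C) (u : Lp ℂ 2 (ν.prod μ)) :
    ∀ᵐ q ∂(ν.prod μ), Integrable (fun y => (k q.2 y : ℂ) * u (q.1, y)) μ := by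
  refine (Measure.ae_prod_iff_ae_ae (measurableSet_integrable
    (f := fun (q : W × X) y => (k q.2 y : ℂ) * u (q.1, y)) ?_)).2 ?_
  · exact (hk.measurable_ofReal_complex.comp
      (by fun_prop : Measurable fun q : (W × X) × X => (q.1.2, q.2))).stronglyMeasurable.mul
      ((Lp.stronglyMeasurable u).comp_measurable
        (by fun_prop : Measurable fun q : (W × X) × X => (q.1.1, q.2)))
  · filter_upwards [(Lp.memLp u).ae_slice] with w hw
    exact hk.ae_integrable hw

namespace HighContrastModel

variable {d : ℕ} (M : HighContrastModel d)

/-- The block data `D` encode the model with effective matrix `Θ`: the half-line operator is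
`-Θ · ∇∇`, the small operator is `Φ - K` on `L²(G)`, amplified to `L²(ℝ^d × G)` along the fibres,
and the distinguished vector is the constant function `1`. -/
structure IsBlockData (Θ : Matrix (Fin d) (Fin d) ℝ)
    (D : BlockData (Lp ℂ 2 (volume : Measure (EuclideanSpace ℝ (Fin d)))) M.L2G
      (Lp ℂ 2 ((volume : Measure (EuclideanSpace ℝ (Fin d))).prod M.μG))) : Prop where
  P_eq : D.P = ellipticGraph Θ
  isPotentialSub : IsPotentialSub M.Phi M.kernel D.A
  AA_ae : ∀ u, D.AA u =ᵐ[volume.prod M.μG] fun q =>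
    (M.Phi q.2 : ℂ) * u q - kerInt M.kernel M.μG (fun ξ' => u (q.1, ξ')) q.2
  J_eq : D.J = tensorL volume M.μG
  e_eq : D.e = Lp.const 2 M.μG 1
  κ_eq : D.κ = volume.real M.Ycell

theorem exists_isBlockData {Θ : Matrix (Fin d) (Fin d) ℝ} {c : ℝ} (hc : 0 < c)
    (hlow : ∀ p, c * ‖p‖ ^ 2 ≤ matForm Θ p) : ∃ D, M.IsBlockData Θ D := by
  have := M.nonempty_fin
  have hk := M.isSchurKernel_kernel
  obtain ⟨A, hA⟩ := exists_isPotentialSub hk M.measurable_Phi M.abs_Phi_le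
  obtain ⟨AA, hAA, hAA'⟩ := hA.exists_fibrewise
    (ν := (volume : Measure (EuclideanSpace ℝ (Fin d)))) hk M.measurable_Phi M.abs_Phi_le
  have hsa := hA.isSelfAdjoint hk M.measurable_Phi M.abs_Phi_le
  exact ⟨{
      P := ellipticGraph Θ
      A := A
      AA := AA
      J := tensorL volume M.μG
      e := Lp.const 2 M.μG 1
      κ := volume.real M.Ycell
      hP := isHalfLineGraph_ellipticGraph hc hlow
      A_selfAdjoint := hsa
      AA_selfAdjoint := hAA.isSelfAdjoint hsa
      AA_J := hAA.apply_tensorL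
      inner_J := inner_tensorL
      lower := fun z r hr h g => hAA.lower hr h g
      κ_pos := M.volume_Ycell_real_pos
      A_nonneg := hA.form_nonneg hk M.measurable_Phi M.abs_Phi_le M.kerMass_le_Phi },
    rfl, hA, hAA', rfl, rfl, rfl⟩

namespace IsBlockData

variable {M} {Θ : Matrix (Fin d) (Fin d) ℝ}
  {D : BlockData (Lp ℂ 2 (volume : Measure (EuclideanSpace ℝ (Fin d)))) M.L2G
    (Lp ℂ 2 ((volume : Measure (EuclideanSpace ℝ (Fin d))).prod M.μG))}

theorem e_ae (hD : M.IsBlockData Θ D) : D.e =ᵐ[M.μG] fun _ => 1 := by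
  rw [hD.e_eq]
  exact Lp.coeFn_const 2 M.μG 1

/-- The vector `(Φ - K) 1` is `c̃`, since `Φ - c̃` is the mass of the kernel on `G`. -/
theorem c_ae (hD : M.IsBlockData Θ D) : D.c =ᵐ[M.μG] fun ξ => (M.cTilde ξ : ℂ) := by
  filter_upwards [hD.isPotentialSub D.e, hD.e_ae] with ξ h1 h2
  rw [BlockData.c, h1, h2, kerInt_congr hD.e_ae, kerInt, M.Phi_eq_add]
  simp only [mul_one, integral_complex_ofReal, kerMass]
  push_cast
  ring

theorem b_ae (hD : M.IsBlockData Θ D) : D.b =ᵐ[M.μG] fun ξ => (M.bTilde ξ : ℂ) := by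
  filter_upwards [Lp.coeFn_smul ((D.κ⁻¹ : ℝ) : ℂ) D.c, hD.c_ae] with ξ h1 h2
  rw [BlockData.b, h1, Pi.smul_apply, h2, M.bTilde_eq, hD.κ_eq, smul_eq_mul]
  push_cast
  ring

theorem inner_b (hD : M.IsBlockData Θ D) (u : M.L2G) :
    inner ℂ D.b u = ∫ ξ, (M.bTilde ξ : ℂ) * u ξ ∂M.μG := by
  rw [inner_eq_integral_of_ae u (Eventually.of_forall fun _ => rfl)]
  refine integral_congr_ae ?_
  filter_upwards [hD.b_ae] with ξ h
  rw [h, Complex.conj_ofReal]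

theorem β_eq (hD : M.IsBlockData Θ D) : D.β = ∫ ξ, (M.bTilde ξ : ℂ) ∂M.μG := by
  rw [BlockData.β, hD.inner_b]
  refine integral_congr_ae ?_
  filter_upwards [hD.e_ae] with ξ h
  rw [h, mul_one]

theorem integrable_bTilde (M : HighContrastModel d) :
    Integrable (fun ξ => (M.bTilde ξ : ℂ)) M.μG := by
  simp only [M.bTilde_eq]
  refine ((Integrable.of_bound M.measurable_cTilde.aestronglyMeasurable M.γ₂
    (Eventually.of_forall fun ξ => ?_)).const_mul _).ofReal
  rw [Real.norm_of_nonneg (M.cTilde_nonneg ξ)]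
  exact M.cTilde_le ξ

theorem mem_phiSubK_graph (hD : M.IsBlockData Θ D) (u h : M.L2G) :
    (u, h) ∈ M.phiSubK.graph ↔ h = D.A u := by
  rw [phiSubK_graph]
  have hA := hD.isPotentialSub u
  constructor
  · rintro ⟨-, he⟩
    refine Lp.ext ?_
    filter_upwards [he, hA] with ξ h1 h2
    rw [h2]
    exact h1
  · rintro rfl
    exact ⟨M.isSchurKernel_kernel.ae_integrable (Lp.memLp u), hA⟩

theorem isResolventAt_iff (hD : M.IsBlockData Θ D) (z : ℂ) (R : M.L2G →L[ℂ] M.L2G) :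
    IsResolventAt M.phiSubK z R ↔ D.IsRes z R := by
  rw [isResolventAt_iff_graph]
  simp only [hD.mem_phiSubK_graph, BlockData.IsRes, sub_eq_iff_eq_add]
  refine and_congr ?_ ?_
  · exact forall_congr' fun u => eq_comm
  · exact ⟨fun h u => h u _ rfl, fun h u v huv => huv ▸ h u⟩

/-- The exchange term in the first component, separated into its gain and loss parts. -/
theorem ae_integral_bTilde (hD : M.IsBlockData Θ D)
    (f : Lp ℂ 2 (volume : Measure (EuclideanSpace ℝ (Fin d))))
    (g : Lp ℂ 2 ((volume : Measure (EuclideanSpace ℝ (Fin d))).prod M.μG)) :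
    ∀ᵐ x, Integrable (fun ξ => (M.bTilde ξ : ℂ) * (g (x, ξ) - f x)) M.μG ∧
      ∫ ξ, (M.bTilde ξ : ℂ) * (g (x, ξ) - f x) ∂M.μG =
        ContinuousLinearMap.adjoint (D.J D.b) g x - D.β * f x := by
  rw [hD.J_eq]
  have hadj := adjoint_tensorL_ae (ν := (volume : Measure (EuclideanSpace ℝ (Fin d)))) D.b g
  filter_upwards [(Lp.memLp g).ae_slice, hadj] with x h1 h2
  have e1 : (fun ξ => starRingEnd ℂ (D.b ξ) * g (x, ξ)) =ᵐ[M.μG]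
      fun ξ => (M.bTilde ξ : ℂ) * g (x, ξ) := by
    filter_upwards [hD.b_ae] with ξ h3
    rw [h3, Complex.conj_ofReal]
  have i1 : Integrable (fun ξ => (M.bTilde ξ : ℂ) * g (x, ξ)) M.μG :=
    (integrable_mul_of_memLp (memLp_conj (Lp.memLp D.b)) h1).congr e1
  have i2 : Integrable (fun ξ => (M.bTilde ξ : ℂ) * f x) M.μG :=
    (integrable_bTilde M).mul_const _
  simp only [mul_sub]
  refine ⟨i1.sub i2, ?_⟩
  rw [integral_sub i1 i2, h2, integral_congr_ae e1, hD.β_eq]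
  congr 1
  exact integral_mul_const _ _

/-- The second component of `L` is `-((Φ - K) g - c̃ f)`, with `Φ` collecting the two loss terms. -/
theorem ae_integral_kernel (hD : M.IsBlockData Θ D)
    (f : Lp ℂ 2 (volume : Measure (EuclideanSpace ℝ (Fin d))))
    (g : Lp ℂ 2 ((volume : Measure (EuclideanSpace ℝ (Fin d))).prod M.μG)) :
    ∀ᵐ q ∂((volume : Measure (EuclideanSpace ℝ (Fin d))).prod M.μG),
      Integrable (fun ξ' => (M.kernel q.2 ξ' : ℂ) * (g (q.1, ξ') - g q)) M.μG ∧
      ∫ ξ', (M.kernel q.2 ξ' : ℂ) * (g (q.1, ξ') - g q) ∂M.μG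
        + (M.cTilde q.2 : ℂ) * (f q.1 - g q) = -(D.AA g q - D.J D.c f q) := by
  rw [hD.J_eq]
  have hk := M.isSchurKernel_kernel
  have hJ := tensorL_ae (ν := (volume : Measure (EuclideanSpace ℝ (Fin d)))) D.c f
  have hc' := (Measure.quasiMeasurePreserving_snd
    (μ := (volume : Measure (EuclideanSpace ℝ (Fin d)))) (ν := M.μG)).ae hD.c_ae
  filter_upwards [hk.ae_integrable_slice g, hD.AA_ae g, hJ, hc'] with q h1 h2 h3 h4
  have i2 : Integrable (fun ξ' => (M.kernel q.2 ξ' : ℂ) * g q) M.μG :=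
    (hk.integrable q.2).ofReal.mul_const _
  have e1 : ∫ ξ', (M.kernel q.2 ξ' : ℂ) * g q ∂M.μG =
      (kerMass M.kernel M.μG q.2 : ℂ) * g q := by
    rw [kerMass, ← integral_complex_ofReal]
    exact integral_mul_const _ _
  simp only [mul_sub]
  refine ⟨h1.sub i2, ?_⟩
  rw [integral_sub h1 i2, e1, h2, h3, h4, M.Phi_eq_add, kerInt]
  push_cast
  ring

/-- The first component of the equation `-h = L (f, g)`, where `u` stands for `Θ · ∇∇ f`. -/
theorem ae_fst_iff (hD : M.IsBlockData Θ D)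
    (f h u : Lp ℂ 2 (volume : Measure (EuclideanSpace ℝ (Fin d))))
    (g : Lp ℂ 2 ((volume : Measure (EuclideanSpace ℝ (Fin d))).prod M.μG)) :
    (∀ᵐ x, (-h) x = u x + ∫ ξ, (M.bTilde ξ : ℂ) * (g (x, ξ) - f x) ∂M.μG) ↔
      h = -u + D.β • f - ContinuousLinearMap.adjoint (D.J D.b) g := by
  have hb := hD.ae_integral_bTilde f g
  generalize ContinuousLinearMap.adjoint (D.J D.b) g = B at hb ⊢
  generalize D.β = β at hb ⊢
  have h1 : ∀ᵐ x, (-u + β • f - B) x = -u x + β * f x - B x := by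
    filter_upwards [Lp.coeFn_sub (-u + β • f) B, Lp.coeFn_add (-u) (β • f), Lp.coeFn_neg u,
      Lp.coeFn_smul β f] with x h4 h5 h6 h7
    rw [h4, Pi.sub_apply, h5, Pi.add_apply, h6, h7, Pi.neg_apply, Pi.smul_apply, smul_eq_mul]
  constructor
  · intro he
    refine Lp.ext ?_
    filter_upwards [he, hb, Lp.coeFn_neg h, h1] with x e1 e2 e3 e4
    rw [e3, e2.2, Pi.neg_apply] at e1
    rw [e4]
    linear_combination -e1
  · rintro rfl
    filter_upwards [hb, Lp.coeFn_neg (-u + β • f - B), h1] with x e2 e3 e4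
    rw [e3, e2.2, Pi.neg_apply, e4]
    ring

/-- The second component of the equation `-h = L (f, g)`. -/
theorem ae_snd_iff (hD : M.IsBlockData Θ D)
    (f : Lp ℂ 2 (volume : Measure (EuclideanSpace ℝ (Fin d))))
    (g h : Lp ℂ 2 ((volume : Measure (EuclideanSpace ℝ (Fin d))).prod M.μG)) :
    (∀ᵐ q ∂((volume : Measure (EuclideanSpace ℝ (Fin d))).prod M.μG),
      (-h) q = ∫ ξ', (M.kernel q.2 ξ' : ℂ) * (g (q.1, ξ') - g q) ∂M.μG
        + (M.cTilde q.2 : ℂ) * (f q.1 - g q)) ↔ h = D.AA g - D.J D.c f := by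
  have hK := hD.ae_integral_kernel f g
  generalize D.AA g = U at hK ⊢
  generalize D.J D.c f = V at hK ⊢
  constructor
  · intro he
    refine Lp.ext ?_
    filter_upwards [he, hK, Lp.coeFn_neg h, Lp.coeFn_sub U V] with q e1 e2 e3 e4
    rw [e3, e2.2, Pi.neg_apply] at e1
    rw [e4, Pi.sub_apply]
    exact neg_injective e1
  · rintro rfl
    filter_upwards [hK, Lp.coeFn_neg (U - V), Lp.coeFn_sub U V] with q e2 e3 e4
    rw [e3, e2.2, Pi.neg_apply, e4, Pi.sub_apply]

theorem neg_generator_graph_iff (M : HighContrastModel d) (Θ : Matrix (Fin d) (Fin d) ℝ)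
    (F h : M.L2E) : (F, h) ∈ (-(M.generator Θ)).graph ↔ (F, -h) ∈ M.generatorGraph Θ := by
  rw [LinearPMap.neg_graph, generator_graph]
  constructor
  · rintro ⟨⟨F', h'⟩, hm, he⟩
    obtain ⟨rfl, rfl⟩ := Prod.mk.inj he
    simpa using hm
  · intro hm
    exact ⟨_, hm, by simp⟩

/-- The operator `-L` is the block operator. -/
theorem mem_neg_generator_graph (hD : M.IsBlockData Θ D) {c : ℝ} (hc : 0 < c)
    (hlow : ∀ p, c * ‖p‖ ^ 2 ≤ matForm Θ p) (F h : M.L2E) :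
    (F, h) ∈ (-(M.generator Θ)).graph ↔ D.Gen F h := by
  rw [neg_generator_graph_iff]
  constructor
  · rintro ⟨hs, -, -, ⟨u, hu, he⟩, hsnd⟩
    refine ⟨-u, ?_, (hD.ae_fst_iff _ _ _ _).1 he, (hD.ae_snd_iff _ _ _).1 hsnd⟩
    rw [hD.P_eq]
    exact (mem_ellipticGraph_iff_memSobolev hc hlow _ _).2 ⟨hs, hu⟩
  · rintro ⟨u, hu, h0, h1⟩
    rw [hD.P_eq, ← neg_neg u] at hu
    obtain ⟨hs, hu'⟩ := (mem_ellipticGraph_iff_memSobolev hc hlow _ _).1 hu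
    exact ⟨hs, (hD.ae_integral_bTilde _ _).mono fun x h => h.1,
      (hD.ae_integral_kernel F.fst F.snd).mono fun q h => h.1,
      ⟨-u, hu', (hD.ae_fst_iff _ _ _ _).2 (by rwa [neg_neg])⟩, (hD.ae_snd_iff _ _ _).2 h1⟩

end IsBlockData

end HighContrastModel

/-! ### The spectrum of the generator -/

namespace HighContrastModel

namespace IsBlockData

variable {d : ℕ} {M : HighContrastModel d} {Θ : Matrix (Fin d) (Fin d) ℝ}
  {D : BlockData (Lp ℂ 2 (volume : Measure (EuclideanSpace ℝ (Fin d)))) M.L2G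
    (Lp ℂ 2 ((volume : Measure (EuclideanSpace ℝ (Fin d))).prod M.μG))}

theorem mem_sigma₁_iff (hD : M.IsBlockData Θ D) (z : ℂ) :
    z ∈ M.sigma₁ ↔ ¬ ∃ R, D.IsRes z R := by
  change (¬ ∃ R, IsResolventAt M.phiSubK z R) ↔ _
  simp only [hD.isResolventAt_iff]

theorem mem_sigma₂_iff (hD : M.IsBlockData Θ D) (z : ℂ) :
    z ∈ M.sigma₂ ↔ ∃ t : ℝ, 0 ≤ t ∧ z = t ∧ ∃ R, D.IsRes z R ∧
      0 ≤ (1 + inner ℂ D.b (R D.e) : ℂ).re := by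
  change (∃ t : ℝ, 0 ≤ t ∧ z = t ∧ ∃ R : M.L2G →L[ℂ] M.L2G, IsResolventAt M.phiSubK z R ∧
    0 ≤ (1 + ∫ ξ, (M.bTilde ξ : ℂ) * R (Lp.const 2 M.μG 1) ξ ∂M.μG).re) ↔ _
  simp only [hD.isResolventAt_iff, hD.inner_b, hD.e_eq]

/-- Off `σ(Φ - K)`, spectrum occurs exactly where the dispersion function lies in `[0, ∞)`, that is at
points `t ≥ 0` with a non-negative bracket. -/
theorem opSpectrum_eq (hD : M.IsBlockData Θ D) {T : M.L2E →ₗ.[ℂ] M.L2E}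
    (hT : ∀ F h, (F, h) ∈ T.graph ↔ D.Gen F h) : opSpectrum T = M.sigma₁ ∪ M.sigma₂ := by
  ext z
  rw [Set.mem_union, hD.mem_sigma₁_iff, hD.mem_sigma₂_iff]
  constructor
  · intro hz
    by_contra! hcon
    obtain ⟨⟨R, hR⟩, h2⟩ := hcon
    exact D.notMem_opSpectrum hT hR (hR.disp_ne fun t ht hzt => h2 t ht hzt R hR) hz
  · rintro (hz | ⟨t, ht, rfl, R, hR, hs⟩)
    · exact essSpectrum_subset_opSpectrum T (D.mem_essSpectrum_of_not_isRes hT hz)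
    · obtain ⟨s, h1, h2, -⟩ := hR.disp_ofReal
      rw [h1, Complex.ofReal_re] at hs
      exact essSpectrum_subset_opSpectrum T
        (D.mem_essSpectrum_of_disp hT hR (mul_nonneg ht hs) h2)

/-- The essential range of `Φ` belongs to the spectrum of `Φ - K`: functions concentrated on small
sets where `Φ` is almost constant are approximate eigenfunctions. -/
theorem not_isRes_of_mem_ranPhi (hD : M.IsBlockData Θ D) {t : ℝ} (ht : t ∈ M.ranPhi) :
    ¬ ∃ R, D.IsRes t R := by
  have := M.nonempty_fin
  rintro ⟨R, hR⟩
  obtain ⟨r, hr, hb⟩ := hR.lower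
  have : NullSingletonClass M.μG := inferInstanceAs (NullSingletonClass (volume.restrict M.Gcell))
  obtain ⟨u, hu, h⟩ := hD.isPotentialSub.exists_approx M.isSchurKernel_kernel
    M.isTruncatable_kernel M.measurable_Phi
    (fun S hS h0 η hη => exists_subset_measure_lt hS h0 hη) ht (half_pos hr)
  have h1 := hb u
  have : 0 < ‖u‖ := norm_pos_iff.2 hu
  nlinarith

/-- `Φ - K` is invertible, as an injective compact perturbation of an invertible multiplication
operator. -/
theorem exists_lower_bound (hD : M.IsBlockData Θ D) :
    ∃ r : ℝ, 0 < r ∧ ∀ u, r * ‖u‖ ≤ ‖D.A u‖ := by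
  obtain ⟨K, hK, -⟩ := M.isSchurKernel_kernel.exists_clm
  refine exists_lower_bound_of_isUnit (isUnit_mul_sub_compact M.measurable_Phi M.γ₁_pos
    M.abs_Phi_le ?_ (M.isSchurKernel_kernel.isCompactOperator M.isTruncatable_kernel hK)
    (fun u => ?_) (M.phiSubK_injective hD.isPotentialSub))
  · change ∀ᵐ ξ ∂(volume.restrict M.Gcell), _
    filter_upwards [ae_restrict_mem M.measurableSet_Gcell] with ξ hξ
    exact M.γ₁_le_Phi hξ.1
  · filter_upwards [hD.isPotentialSub u, hK u] with ξ h1 h2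
    rw [h1, h2]

end IsBlockData

end HighContrastModel

end

theorem mainTheorem4 {d : ℕ} (M : HighContrastModel d) :
    (∃ φ : EuclideanSpace ℝ (Fin d) → EuclideanSpace ℝ (Fin d), M.IsCorrector φ) ∧
    ∀ φ : EuclideanSpace ℝ (Fin d) → EuclideanSpace ℝ (Fin d), M.IsCorrector φ →
      opSpectrum (-(M.generator (M.effMatrix φ))) = M.sigma₁ ∪ M.sigma₂ ∧
      ∃ l₁ l₂ : ℝ, 0 < l₁ ∧ l₁ < M.γ₁ ∧ M.γ₁ ≤ M.γ₂ ∧ M.γ₂ < l₂ ∧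
        (∀ t ∈ Set.Icc 0 l₁ ∪ M.ranPhi ∪ Set.Ici l₂,
          (t : ℂ) ∈ essSpectrum (-(M.generator (M.effMatrix φ)))) ∧
        (∀ t ∈ Set.Icc 0 l₁ ∪ Set.Ici l₂,
          (t : ℂ) ∈ contSpectrum (-(M.generator (M.effMatrix φ)))) ∧
        (∀ t ∈ M.ranPhi, ¬ IsEigenvalue (-(M.generator (M.effMatrix φ))) (t : ℂ) →
          (t : ℂ) ∈ contSpectrum (-(M.generator (M.effMatrix φ)))) := by
  refine ⟨M.exists_isCorrector, fun φ hφ => ?_⟩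
  obtain ⟨c, hc, hlow⟩ := hφ.exists_ellipticity
  obtain ⟨D, hD⟩ := M.exists_isBlockData hc hlow
  have hT := hD.mem_neg_generator_graph hc hlow
  refine ⟨hD.opSpectrum_eq hT, ?_⟩
  obtain ⟨r, hr, hlower⟩ := hD.exists_lower_bound
  have hγ := M.γ₁_pos
  have hmin : 0 < min r M.γ₁ := lt_min hr hγ
  have hRan : ∀ t ∈ M.ranPhi, (t : ℂ) ∈ essSpectrum (-(M.generator (M.effMatrix φ))) :=
    fun t ht => D.mem_essSpectrum_of_not_isRes hT (hD.not_isRes_of_mem_ranPhi ht)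
  -- near zero and at high energies the resolvent exists and the dispersion function is nonnegative
  have hlh : ∀ t ∈ Set.Icc 0 (min r M.γ₁ / 2) ∪
      Set.Ici (max M.γ₂ (‖D.A‖ + ‖D.b‖ * ‖D.e‖ + 1) + 1),
      ∃ R, D.IsRes t R ∧ ∃ s : ℝ, 0 ≤ s ∧ D.disp t R = s := by
    rintro t (ht | ht)
    · exact D.mem_of_lt_lower hlower ht.1
        (ht.2.trans_lt (by linarith [min_le_left r M.γ₁]))
    · refine D.mem_of_norm_lt ?_
      have := Set.mem_Ici.1 ht
      linarith [le_max_right M.γ₂ (‖D.A‖ + ‖D.b‖ * ‖D.e‖ + 1)]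
  have hess : ∀ t ∈ Set.Icc 0 (min r M.γ₁ / 2) ∪
      Set.Ici (max M.γ₂ (‖D.A‖ + ‖D.b‖ * ‖D.e‖ + 1) + 1),
      (t : ℂ) ∈ essSpectrum (-(M.generator (M.effMatrix φ))) := by
    intro t ht
    obtain ⟨R, hR, s, hs, hd⟩ := hlh t ht
    exact D.mem_essSpectrum_of_disp hT hR hs hd
  refine ⟨min r M.γ₁ / 2, max M.γ₂ (‖D.A‖ + ‖D.b‖ * ‖D.e‖ + 1) + 1, half_pos hmin,
    by linarith [min_le_right r M.γ₁], M.γ₁_le_γ₂,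
    by linarith [le_max_left M.γ₂ (‖D.A‖ + ‖D.b‖ * ‖D.e‖ + 1)], ?_, ?_,
    fun t ht he => D.mem_contSpectrum hT (hRan t ht) he⟩
  · rintro t ((ht | ht) | ht)
    · exact hess t (Or.inl ht)
    · exact hRan t ht
    · exact hess t (Or.inr ht)
  · intro t ht
    obtain ⟨R, hR, -⟩ := hlh t ht
    exact D.mem_contSpectrum hT (hess t ht) (D.not_isEigenvalue hT hR)
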